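/- **Setting.** Fix an integer $m\ge 1$, put $\delta=1/m$, and let $N$ range over the positive multiples of $m$. Split $[N]$ into the blocks $B(j)=\{i:(j-1)\delta N<i\le j\delta N\}$, $j\in[1/\delta]$, and let $D^j$ be the diagonal projection of $\mathbb R^N$ onto $B(j)$. Let $c:[0,1]\times\mathbb R\to\{\pm1\}$ be a measurable update rule such that $0<\Pr[c(U,G)=1]<1$ for independent $U\sim\mathrm{Unif}[0,1]$, $G\sim N(0,1)$, and such that $\partial(c^{-1}(1))$ is Lebesgue null in $[0,1]\times\mathbb R$. For each $N$ let $J\sim\mathrm{GOE}(N)$ (centered, jointly Gaussian entries, $\mathbb E J_{ij}J_{kl}=(\mathbf 1_{i=k}\mathbf 1_{j=l}+\mathbf 1_{i=l}\mathbf 1_{j=k})/N$), $\boldsymbol\sigma^0\sim\mathrm{Unif}\{\pm1\}^N$, i.i.d. seeds $U_i^t\sim\mathrm{Unif}[0,1]$ and i.i.d. matrices $W^t_j\sim\mathrm{GOE}(N)$ ($t\ge0$, $j\in[1/\delta]$) be mutually independent. In pass $t=1,2,\dots$, started from $\boldsymbol\sigma^{t,0}=\boldsymbol\sigma^{t-1}$,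 the blocks $j=1,\dots,1/\delta$ are updated in order: $\boldsymbol\sigma^{t,j}_i=c\big(U_i^t,(J\boldsymbol\sigma^{t,j-1})_i\big)$ for $i\in B(j)$ and $\boldsymbol\sigma^{t,j}_i=\boldsymbol\sigma^{t,j-1}_i$ otherwise; $\boldsymbol\sigma^t=\boldsymbol\sigma^{t,1/\delta}$. Put $\boldsymbol\sigma^{t|j}=D^j\boldsymbol\sigma^t$ and $\boldsymbol h^{t,j\to k}=D^kJ\boldsymbol\sigma^{t|j}$. Let $\boldsymbol\sigma^{(t)|j}$ and $\boldsymbol h^{(t),j\to k}$ be the $N\times(t+1)$ matrices with columns $\boldsymbol\sigma^{s|j}$, respectively $\boldsymbol h^{s,j\to k}$, $0\le s\le t$. Define, for all $s,r\ge0$, $$\hat C^{j}_{s,r}=\frac{1}{\delta N}\langle\boldsymbol\sigma^{s|j},\boldsymbol\sigma^{r|j}\rangle,\qquad \hat Q^{k\to j}_{s,r}=\frac1{\delta^2N}\langle\boldsymbol h^{s,k\to j},\boldsymbol\sigma^{r|j}\rangle ,$$ let $\hat C^{(t),j}=(\hat C^j_{s,r})_{0\le s,r\le t}$, write $M_{a:b,\,c:d}$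 for blocks of a matrix (rows $a$ to $b$ and columns $c$ to $d$, inclusive), and $\dagger$ for the Moore–Penrose pseudo-inverse. For $t\ge1$ let $$\hat b^{t,j}=\sqrt{1-\hat C^{j}_{t,0:t-1}(\hat C^{(t-1),j})^\dagger\hat C^{j}_{0:t-1,t}},\qquad \hat\psi^{t,j}=(\hat C^{(t-1),j})^\dagger\hat C^{j}_{0:t-1,t}\in\mathbb R^t,$$ $$\hat\theta^{t,j\to k}=(\hat C^{(r),k})^\dagger\hat Q^{k\to j}_{0:r,t}-(\hat C^{(r),k})^\dagger\hat Q^{k\to j}_{0:r,0:t-1}(\hat C^{(t-1),j})^\dagger\hat C^{j}_{0:t-1,t}\in\mathbb R^{r+1},$$ where $r=t$ if $k<j$ and $r=t-1$ if $k\ge j$. Order the pairs $(t,j)$ lexicographically, and let $\tilde{\mathcal F}^t_j$ be the $\sigma$-algebra generated by $\boldsymbol\sigma^0$, by the vectors $J\boldsymbol\sigma^{s|k}$ with $(s,k)<(t,j)$, and by the matrices $W^s_k$ with $(s,k)\le(t,j)$. **Proposition.** For every $N$ there are random vectors $\boldsymbol\xi^{t,j\to k}$ in $\mathbb R^N$ ($t\ge0$,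 $j,k\in[1/\delta]$) with $\boldsymbol\xi^{t,j\to k}\sim N(0,D^k)$, and random vectors $\Delta^{t,j\to k}$, in $\mathbb R^{t}$ if $t\ge1$ and $k>j$ and in $\mathbb R^{t+1}$ otherwise, such that: 1. $\boldsymbol\xi^{t,j\to k}$ is $\tilde{\mathcal F}^s_\ell$-measurable whenever $(s,\ell)>(t,j)$, that is, whenever $s>t$, or $s=t$ and $\ell>j$. 2. For every $k$, the vectors $\boldsymbol\xi^{t,j\to k}$ are (mutually) independent across all $t$ and $j$. 3. For all $j,k$, almost surely $\boldsymbol h^{0,j\to k}=\sqrt\delta\,\boldsymbol\xi^{0,j\to k}+\boldsymbol\sigma^{(0)|k}\Delta^{0,j\to k}$. 4. For all $t\ge1$ and all $j,k$, almost surely $$\boldsymbol h^{t,j\to k}=\begin{cases}\hat b^{t,j}\sqrt\delta\,\boldsymbol\xi^{t,j\to k}+\boldsymbol h^{(t-1),j\to k}\hat\psi^{t,j}+\delta\boldsymbol\sigma^{(t)|k}\hat\theta^{t,j\to k}+\boldsymbol\sigma^{(t)|k}\Delta^{t,j\to k},&k<j,\\ \hat b^{t,j}\sqrt\delta\,\boldsymbol\xi^{t,j\to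 k}+\boldsymbol h^{(t-1),j\to k}\hat\psi^{t,j}+\delta\boldsymbol\sigma^{(t-1)|k}\hat\theta^{t,j\to k}+\boldsymbol\sigma^{(t)|k}\Delta^{t,j\to k},&k=j,\\ \hat b^{t,j}\sqrt\delta\,\boldsymbol\xi^{t,j\to k}+\boldsymbol h^{(t-1),j\to k}\hat\psi^{t,j}+\delta\boldsymbol\sigma^{(t-1)|k}\hat\theta^{t,j\to k}+\boldsymbol\sigma^{(t-1)|k}\Delta^{t,j\to k},&k>j.\end{cases}$$ 5. For all $t\ge0$ and all $j,k$, $\ \|(\Delta^{0,j\to k},\dots,\Delta^{t,j\to k})\|_F\to0$ in probability as $N\to\infty$, where $\|(\Delta^{0},\dots,\Delta^{t})\|_F^2=\sum_{s\le t}\|\Delta^{s}\|^2$. -/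

import Mathlib

open MeasureTheory ProbabilityTheory Filter Topology Matrix

noncomputable section

namespace BlockScan

/-! ### Moore–Penrose pseudo-inverse of a real matrix -/

/-- The four Penrose equations for a real matrix `A` and a candidate pseudo-inverse `X`. -/
def IsMoorePenrose {a b : Type*} [Fintype a] [Fintype b]
    (A : Matrix a b ℝ) (X : Matrix b a ℝ) : Prop :=
  A * X * A = A ∧ X * A * X = X ∧ (A * X)ᵀ = A * X ∧ (X * A)ᵀ = X * A

theorem IsMoorePenrose.unique {a b : Type*} [Fintype a] [Fintype b]
    {A : Matrix a b ℝ} {X Y : Matrix b a ℝ}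
    (hX : IsMoorePenrose A X) (hY : IsMoorePenrose A Y) : X = Y := by
  obtain ⟨x1, x2, x3, x4⟩ := hX
  obtain ⟨y1, y2, y3, y4⟩ := hY
  have h1 : A * X = A * Y := by
    calc A * X = (A * Y * A) * X := by rw [y1]
      _ = (A * Y) * (A * X) := by simp only [Matrix.mul_assoc]
      _ = (A * Y)ᵀ * (A * X)ᵀ := by rw [y3, x3]
      _ = ((A * X) * (A * Y))ᵀ := by rw [Matrix.transpose_mul (A * X)]
      _ = ((A * X * A) * Y)ᵀ := by simp only [Matrix.mul_assoc]
      _ = A * Y := by rw [x1, y3]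
  have h2 : X * A = Y * A := by
    calc X * A = X * (A * Y * A) := by rw [y1]
      _ = (X * A) * (Y * A) := by simp only [Matrix.mul_assoc]
      _ = (X * A)ᵀ * (Y * A)ᵀ := by rw [x4, y4]
      _ = ((Y * A) * (X * A))ᵀ := by rw [Matrix.transpose_mul (Y * A)]
      _ = (Y * (A * X * A))ᵀ := by simp only [Matrix.mul_assoc]
      _ = Y * A := by rw [x1, y4]
  calc X = X * A * X := x2.symm
    _ = Y * (A * X) := by rw [h2, Matrix.mul_assoc]
    _ = Y * A * Y := by rw [h1, Matrix.mul_assoc]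
    _ = Y := y2

theorem exists_isMoorePenrose_of_isHermitian {b : Type*} [Fintype b] [DecidableEq b]
    {S : Matrix b b ℝ} (hS : S.IsHermitian) : ∃ X, IsMoorePenrose S X ∧ Xᵀ = X := by
  set V : Matrix b b ℝ := (hS.eigenvectorUnitary : Matrix b b ℝ) with hV
  set d := hS.eigenvalues with hd
  have hVV : Vᵀ * V = 1 := by
    have := Unitary.coe_star_mul_self hS.eigenvectorUnitary
    simpa [Matrix.star_eq_conjTranspose, Matrix.conjTranspose_eq_transpose_of_trivial] using this
  have hSd : S = V * diagonal d * Vᵀ := by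
    have := hS.spectral_theorem
    rw [Unitary.conjStarAlgAut_apply] at this
    simpa [Matrix.star_eq_conjTranspose, Matrix.conjTranspose_eq_transpose_of_trivial,
      Function.comp_def] using this
  have key : ∀ e f : b → ℝ, (V * diagonal e * Vᵀ) * (V * diagonal f * Vᵀ)
      = V * diagonal (fun i => e i * f i) * Vᵀ := by
    intro e f
    calc (V * diagonal e * Vᵀ) * (V * diagonal f * Vᵀ)
        = V * diagonal e * (Vᵀ * V) * diagonal f * Vᵀ := by simp only [Matrix.mul_assoc]
      _ = V * (diagonal e * diagonal f) * Vᵀ := by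
          rw [hVV, Matrix.mul_one]; simp only [Matrix.mul_assoc]
      _ = _ := by rw [Matrix.diagonal_mul_diagonal]
  have symm : ∀ e : b → ℝ, (V * diagonal e * Vᵀ)ᵀ = V * diagonal e * Vᵀ := by
    intro e
    simp [Matrix.transpose_mul, Matrix.mul_assoc]
  refine ⟨V * diagonal (fun i => (d i)⁻¹) * Vᵀ, ⟨?_, ?_, ?_, ?_⟩, symm _⟩
  · rw [hSd, key, key]
    congr 3; ext i; exact mul_inv_mul_cancel _
  · rw [hSd, key, key]
    congr 3; ext i; simpa using mul_inv_mul_cancel (d i)⁻¹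
  · rw [hSd, key, symm]
  · rw [hSd, key, symm]

theorem exists_isMoorePenrose {a b : Type*} [Fintype a] [Fintype b]
    (A : Matrix a b ℝ) : ∃ X, IsMoorePenrose A X := by
  classical
  have hS : (Aᵀ * A).IsHermitian := by
    simpa [Matrix.conjTranspose_eq_transpose_of_trivial] using
      Matrix.isHermitian_conjTranspose_mul_self A
  obtain ⟨S, ⟨s1, s2, s3, s4⟩, s5⟩ := exists_isMoorePenrose_of_isHermitian hS
  have h0 : A * (S * (Aᵀ * A) - 1) = 0 := by
    have : Aᴴ * A * (S * (Aᵀ * A) - 1) = 0 := by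
      rw [Matrix.conjTranspose_eq_transpose_of_trivial, Matrix.mul_sub, Matrix.mul_one,
        ← Matrix.mul_assoc, s1, sub_self]
    exact (Matrix.conjTranspose_mul_self_mul_eq_zero A _).1 this
  have h1 : A * (S * Aᵀ) * A = A := by
    rw [Matrix.mul_sub, Matrix.mul_one, sub_eq_zero] at h0
    simpa only [Matrix.mul_assoc] using h0
  refine ⟨S * Aᵀ, h1, ?_, ?_, ?_⟩
  · calc S * Aᵀ * A * (S * Aᵀ) = S * (Aᵀ * A) * S * Aᵀ := by simp only [Matrix.mul_assoc]
      _ = S * Aᵀ := by rw [s2]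
  · simp [Matrix.transpose_mul, s5, Matrix.mul_assoc]
  · simpa only [Matrix.mul_assoc] using s4

/-- The Moore–Penrose pseudo-inverse: the unique solution of the Penrose equations. -/
def pinv {a b : Type*} [Fintype a] [Fintype b] (A : Matrix a b ℝ) : Matrix b a ℝ :=
  (exists_isMoorePenrose A).choose

theorem pinv_spec {a b : Type*} [Fintype a] [Fintype b] (A : Matrix a b ℝ) :
    IsMoorePenrose A (pinv A) :=
  (exists_isMoorePenrose A).choose_spec

/-! ### Gaussian vectors and the GOE -/

/-- `X ∼ N(0, S)`: `X` has a Gaussian law with mean zero and covariance matrix `S`. -/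
def IsCenteredGaussian {Ω ι : Type*} [MeasurableSpace Ω] [Fintype ι]
    (X : Ω → ι → ℝ) (S : ι → ι → ℝ) (P : Measure Ω) : Prop :=
  HasGaussianLaw X P ∧ (∀ a, ∫ ω, X ω a ∂P = 0) ∧ ∀ a b, ∫ ω, X ω a * X ω b ∂P = S a b

/-- `M ∼ GOE(N)`: centered jointly Gaussian entries with
`𝔼 M_{ij} M_{kl} = (1{i=k} 1{j=l} + 1{i=l} 1{j=k}) / N`. -/
def IsGOE {Ω : Type*} [MeasurableSpace Ω] {N : ℕ}
    (M : Ω → Fin N → Fin N → ℝ) (P : Measure Ω) : Prop :=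
  IsCenteredGaussian (fun ω (p : Fin N × Fin N) => M ω p.1 p.2)
    (fun p q => ((if p.1 = q.1 ∧ p.2 = q.2 then 1 else 0)
      + (if p.1 = q.2 ∧ p.2 = q.1 then 1 else 0)) / (N : ℝ)) P

/-! ### Update rules, blocks and the block systematic scan

Throughout `δ = 1 / m`, there are `m` blocks of `n` sites each, and `N = m * n`.
Sites and blocks are numbered from `0`, passes `t = 1, 2, …` as usual; time `0` is the initial
configuration. -/

/-- Admissible randomized update rules `c : [0,1] × ℝ → {±1}`. -/
structure IsUpdateRule (c : unitInterval → ℝ → ℝ) : Prop where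
  measurable : Measurable (Function.uncurry c)
  sign : ∀ u x, c u x = 1 ∨ c u x = -1
  /-- `0 < Pr[c(G) = 1]` for a standard Gaussian `G` -/
  pos : 0 < ((volume : Measure unitInterval).prod (gaussianReal 0 1)) {p | c p.1 p.2 = 1}
  /-- `Pr[c(G) = 1] < 1` for a standard Gaussian `G` -/
  lt_one : ((volume : Measure unitInterval).prod (gaussianReal 0 1)) {p | c p.1 p.2 = 1} < 1
  /-- the boundary of `c⁻¹(1)` is Lebesgue null -/
  boundary : (volume : Measure (unitInterval × ℝ))
    (frontier {p : unitInterval × ℝ | c p.1 p.2 = 1}) = 0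

/-- The block size parameter `δ`. -/
def delta (m : ℕ) : ℝ := 1 / (m : ℝ)

/-- Site `i` belongs to the block number `j`. -/
def InBlock {m n : ℕ} (j : ℕ) (i : Fin (m * n)) : Prop :=
  j * n ≤ (i : ℕ) ∧ (i : ℕ) < (j + 1) * n

instance {m n : ℕ} (j : ℕ) (i : Fin (m * n)) : Decidable (InBlock j i) :=
  inferInstanceAs (Decidable (_ ∧ _))

/-- `D^j`, the diagonal projection onto the `j`-th block. -/
def blockProj (m n : ℕ) (j : Fin m) : Matrix (Fin (m * n)) (Fin (m * n)) ℝ :=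
  Matrix.diagonal fun i => if InBlock (j : ℕ) i then 1 else 0

/-- The configuration after the first `j` blocks have been updated in one pass started from `s`,
with couplings `J` and seeds `u`. -/
def partialPass {m n : ℕ} (c : unitInterval → ℝ → ℝ) (J : Fin (m * n) → Fin (m * n) → ℝ)
    (u : Fin (m * n) → unitInterval) (s : Fin (m * n) → ℝ) : ℕ → Fin (m * n) → ℝ
  | 0 => s
  | j + 1 => fun i =>
      if InBlock j i then c (u i) ((Matrix.of J *ᵥ partialPass c J u s j) i)
      else partialPass c J u s j i

/-- The random input: the couplings `J ∼ GOE(N)`, the initial configuration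
`σ⁰ ∼ Unif{±1}^N`, the i.i.d. `Unif[0,1]` seeds `U_i^t` and the i.i.d. auxiliary matrices
`W_j^t ∼ GOE(N)`; these four are mutually independent. -/
structure Input (m n : ℕ) {Ω : Type*} [MeasurableSpace Ω] (P : Measure Ω) where
  J : Ω → Fin (m * n) → Fin (m * n) → ℝ
  init : Ω → Fin (m * n) → ℝ
  U : Ω → ℕ → Fin (m * n) → unitInterval
  W : Ω → ℕ → Fin m → Fin (m * n) → Fin (m * n) → ℝ
  measurable_J : Measurable J
  measurable_init : Measurable init
  measurable_U : Measurable U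
  measurable_W : Measurable W
  goe_J : IsGOE J P
  sign_init : ∀ ω i, init ω i = 1 ∨ init ω i = -1
  unif_init : ∀ s : Fin (m * n) → ℝ, (∀ i, s i = 1 ∨ s i = -1) →
    P {ω | init ω = s} = (1 / 2 : ENNReal) ^ (m * n)
  unif_U : ∀ t i, P.map (fun ω => U ω t i) = (volume : Measure unitInterval)
  indep_U : iIndepFun (fun (p : ℕ × Fin (m * n)) ω => U ω p.1 p.2) P
  goe_W : ∀ t j, IsGOE (fun ω => W ω t j) P
  indep_W : iIndepFun (fun (p : ℕ × Fin m) ω => W ω p.1 p.2) P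
  indep_init_J : IndepFun init J P
  indep_init_J_U : IndepFun (fun ω => (init ω, J ω)) U P
  indep_init_J_U_W : IndepFun (fun ω => (init ω, J ω, U ω)) W P

namespace Input

variable {m n : ℕ} {Ω : Type*} [MeasurableSpace Ω] {P : Measure Ω}

/-- `σ^t`, the configuration at the end of pass `t`. -/
def spin (X : Input m n P) (c : unitInterval → ℝ → ℝ) : ℕ → Ω → Fin (m * n) → ℝ
  | 0, ω => X.init ω
  | t + 1, ω => partialPass c (X.J ω) (X.U ω (t + 1)) (spin X c t ω) m

/-- `σ^{t|j} = D^j σ^t`. -/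
def spinBlock (X : Input m n P) (c : unitInterval → ℝ → ℝ) (t : ℕ) (j : Fin m) (ω : Ω) :
    Fin (m * n) → ℝ :=
  blockProj m n j *ᵥ X.spin c t ω

/-- `J σ^{t|j}`. -/
def coupledSpin (X : Input m n P) (c : unitInterval → ℝ → ℝ) (t : ℕ) (j : Fin m) (ω : Ω) :
    Fin (m * n) → ℝ :=
  Matrix.of (X.J ω) *ᵥ X.spinBlock c t j ω

/-- `h^{t, j → k} = D^k J σ^{t|j}`, the field contributed by block `j` to block `k`. -/
def field (X : Input m n P) (c : unitInterval → ℝ → ℝ) (t : ℕ) (j k : Fin m) (ω : Ω) :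
    Fin (m * n) → ℝ :=
  blockProj m n k *ᵥ X.coupledSpin c t j ω

/-- The `N × p` matrix with columns `σ^{0|k}, …, σ^{p-1|k}`, that is `σ^{(p-1)|k}`. -/
def spinHist (X : Input m n P) (c : unitInterval → ℝ → ℝ) (p : ℕ) (k : Fin m) (ω : Ω) :
    Matrix (Fin (m * n)) (Fin p) ℝ :=
  Matrix.of fun i a => X.spinBlock c a k ω i

/-- The `N × p` matrix with columns `h^{0, j → k}, …, h^{p-1, j → k}`, that is
`h^{(p-1), j → k}`. -/
def fieldHist (X : Input m n P) (c : unitInterval → ℝ → ℝ) (p : ℕ) (j k : Fin m) (ω : Ω) :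
    Matrix (Fin (m * n)) (Fin p) ℝ :=
  Matrix.of fun i a => X.field c a j k ω i

/-- The overlap `Ĉ^j_{s,r} = ⟨σ^{s|j}, σ^{r|j}⟩ / (δ N)`. -/
def overlapC (X : Input m n P) (c : unitInterval → ℝ → ℝ) (j : Fin m) (ω : Ω) (s r : ℕ) : ℝ :=
  1 / (delta m * ((m * n : ℕ) : ℝ)) * (X.spinBlock c s j ω ⬝ᵥ X.spinBlock c r j ω)

/-- The overlap `Q̂^{k → j}_{s,r} = ⟨h^{s, k → j}, σ^{r|j}⟩ / (δ² N)`. -/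
def overlapQ (X : Input m n P) (c : unitInterval → ℝ → ℝ) (k j : Fin m) (ω : Ω) (s r : ℕ) : ℝ :=
  1 / (delta m ^ 2 * ((m * n : ℕ) : ℝ)) * (X.field c s k j ω ⬝ᵥ X.spinBlock c r j ω)

/-- The `p × q` block `Ĉ^j_{0:p-1, 0:q-1}`; for `p = q = t` it is `Ĉ^{(t-1),j}`. -/
def matC (X : Input m n P) (c : unitInterval → ℝ → ℝ) (p q : ℕ) (j : Fin m) (ω : Ω) :
    Matrix (Fin p) (Fin q) ℝ :=
  Matrix.of fun a b => X.overlapC c j ω a b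

/-- The column `Ĉ^j_{0:p-1, t}`. -/
def colC (X : Input m n P) (c : unitInterval → ℝ → ℝ) (p t : ℕ) (j : Fin m) (ω : Ω) :
    Fin p → ℝ :=
  fun a => X.overlapC c j ω a t

/-- The row `Ĉ^j_{t, 0:p-1}`. -/
def rowC (X : Input m n P) (c : unitInterval → ℝ → ℝ) (p t : ℕ) (j : Fin m) (ω : Ω) :
    Fin p → ℝ :=
  fun a => X.overlapC c j ω t a

/-- The `p × q` block `Q̂^{k → j}_{0:p-1, 0:q-1}`. -/
def matQ (X : Input m n P) (c : unitInterval → ℝ → ℝ) (p q : ℕ) (k j : Fin m) (ω : Ω) :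
    Matrix (Fin p) (Fin q) ℝ :=
  Matrix.of fun a b => X.overlapQ c k j ω a b

/-- The column `Q̂^{k → j}_{0:p-1, t}`. -/
def colQ (X : Input m n P) (c : unitInterval → ℝ → ℝ) (p t : ℕ) (k j : Fin m) (ω : Ω) :
    Fin p → ℝ :=
  fun a => X.overlapQ c k j ω a t

/-- `b̂^{t,j} = √(1 - Ĉ_{t,0:t-1} (Ĉ^{(t-1)})† Ĉ_{0:t-1,t})`. -/
def bHat (X : Input m n P) (c : unitInterval → ℝ → ℝ) (t : ℕ) (j : Fin m) (ω : Ω) : ℝ :=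
  Real.sqrt (1 - X.rowC c t t j ω ⬝ᵥ (pinv (X.matC c t t j ω) *ᵥ X.colC c t t j ω))

/-- `ψ̂^{t,j} = (Ĉ^{(t-1)})† Ĉ_{0:t-1,t} ∈ ℝ^t`. -/
def psiHat (X : Input m n P) (c : unitInterval → ℝ → ℝ) (t : ℕ) (j : Fin m) (ω : Ω) :
    Fin t → ℝ :=
  pinv (X.matC c t t j ω) *ᵥ X.colC c t t j ω

end Input

/-- The dimension of `θ̂^{t, j → k}`: `t + 1` for `k < j` and `t` for `k ≥ j`. -/
def thetaLen {m : ℕ} (t : ℕ) (j k : Fin m) : ℕ := if k < j then t + 1 else t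

/-- The dimension of `Δ^{t, j → k}`: `t` if `t ≥ 1` and `k > j`, and `t + 1` otherwise. -/
def errLen {m : ℕ} (t : ℕ) (j k : Fin m) : ℕ := if 1 ≤ t ∧ j < k then t else t + 1

namespace Input

variable {m n : ℕ} {Ω : Type*} [MeasurableSpace Ω] {P : Measure Ω}

/-- `θ̂^{t, j → k} = (Ĉ^k)† Q̂^{k → j}_{0:p-1, t}
  - (Ĉ^k)† Q̂^{k → j}_{0:p-1, 0:t-1} (Ĉ^{(t-1),j})† Ĉ^j_{0:t-1, t}`,
where `p` is the dimension of `θ̂^{t, j → k}` and `Ĉ^k` is the `p × p` overlap matrix. -/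
def thetaHat (X : Input m n P) (c : unitInterval → ℝ → ℝ) (t : ℕ) (j k : Fin m) (ω : Ω) :
    Fin (thetaLen t j k) → ℝ :=
  pinv (X.matC c (thetaLen t j k) (thetaLen t j k) k ω) *ᵥ X.colQ c (thetaLen t j k) t k j ω
    - (pinv (X.matC c (thetaLen t j k) (thetaLen t j k) k ω)
        * X.matQ c (thetaLen t j k) t k j ω * pinv (X.matC c t t j ω)) *ᵥ X.colC c t t j ω

/-- The extended filtration: the `σ`-algebra generated by `σ⁰`, by the `J σ^{s|k}` with
`(s,k) < (t,j)` and by the `W_k^s` with `(s,k) ≤ (t,j)`, in the lexicographic order. -/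
@[reducible] def extFiltration (X : Input m n P) (c : unitInterval → ℝ → ℝ) (t : ℕ) (j : Fin m) :
    MeasurableSpace Ω :=
  (inferInstance : MeasurableSpace (Fin (m * n) → ℝ)).comap X.init
    ⊔ (⨆ (p : ℕ × Fin m) (_ : p.1 < t ∨ (p.1 = t ∧ p.2 < j)),
        (inferInstance : MeasurableSpace (Fin (m * n) → ℝ)).comap (X.coupledSpin c p.1 p.2))
    ⊔ (⨆ (p : ℕ × Fin m) (_ : p.1 < t ∨ (p.1 = t ∧ p.2 ≤ j)),
        (inferInstance : MeasurableSpace (Fin (m * n) → Fin (m * n) → ℝ)).comap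
          (fun ω => X.W ω p.1 p.2))

end Input

/-- `Y_n → 0` in probability, where `Y_n` may live on a probability space depending on `n`. -/
def TendstoZeroInProbability {Ω : ℕ → Type*} [∀ n, MeasurableSpace (Ω n)]
    (P : ∀ n, Measure (Ω n)) (Y : ∀ n, Ω n → ℝ) : Prop :=
  ∀ ε : ℝ, 0 < ε → Tendsto (fun n => P n {ω | ε ≤ |Y n ω|}) atTop (𝓝 0)

end BlockScan

end

noncomputable section

namespace BlockScan

/-! ### Orthogonal projections onto column spaces -/

section Projection

variable {ι κ : Type*} [Fintype ι] [Fintype κ]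

/-! Order the pairs (t, j) by the single index r = t m + j and write v_r for the block configuration
σ^{t|j} and y_r = J v_r. The configuration read by an update is the sum of the m most recent v's, so
v_r is a function of the initial configuration, the seeds and y_0, …, y_{r-1}. The scan is thus an
adaptive exploration of J through its images (`Exploration`, `flatSpin_eq_scanRule`).

Conditioning. Let Π be the orthogonal projection onto the span of v_0, …, v_{r-1}, f = v_r - Π v_r
and e = f / |f|. For deterministic v's, (1 - Π) J e is independent of the earlier images and has
covariance (1 - Π + e eᵀ) / N. Scaling by √N, shrinking the component along e by 1/√2 and adding Π w
with fresh Gaussian noise w gives a standard Gaussian vector, the innovation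
(`isCenteredGaussian_innov`, `indepFun_innov`). If f = 0, the innovation is w itself. The actual v's
are random but take finitely many values, and following a given history is an event of the past, so
summing over histories transfers the law and the independence (`Exploration.xi_spec`,
`Exploration.iIndepFun_xi`).

Decomposition. Write J v_r = J Π v_r + Π J f + (1 - Π) J f. The first part gives the ψ̂ term, the
second gives θ̂ by the symmetry of J, and the third is solved for the innovation ξ, with coefficient
|f| / √N = b̂ √δ. Since distinct blocks have disjoint supports, D^k turns Π into the projection onto
the past configurations of block k. What is left is a multiple of D^k Π ξ and, for k = j, a multiple
of f; both are combinations of configurations of block k, and their coefficients form Δ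
(`field_eq_innov`).

Adaptedness. The extended filtration contains fields but no seeds. Almost surely x ↦ ⟨J σ^{0|k}, x⟩
is injective on vectors with entries in {0, 1, -1}, and by symmetry ⟨J σ^{0|k}, σ^{s|k}⟩ = ⟨σ^{0|k},
J σ^{s|k}⟩ is known, so the spins can be decoded from the fields (`ae_decodedSpin_eq`).

Vanishing of Δ. Correlations of ξ with past configurations are of order √n, so it suffices that the
Gram matrix of the past of each block is at least ε n with high probability. This follows if every
sign pattern of the past occurs at order n sites of the block (`Rich.le_dotProduct_self`), which is
proved by induction over updates (`eventuallyRich`). Inside one pattern class, sites are paired. The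
half-difference of J f over a pair, with f the residual of the block updated just before, is a fresh
Gaussian, independent of the remaining part of the field, of the past and of the other pairs. Its
variance is bounded below because |f|² is of order n. The remaining part is bounded at half of the
pairs because J is bounded on the explored subspace (`exists_opBound`), so each sign appears with
probability at least κ, and a conditional Chebyshev inequality yields order n sites for both
continuations of the pattern (`measure_fiber_few_le`). -/

theorem pinv_transpose_of_symm {A : Matrix κ κ ℝ} (hA : Aᵀ = A) : (pinv A)ᵀ = pinv A := by
  obtain ⟨h1, h2, h3, h4⟩ := pinv_spec A
  refine IsMoorePenrose.unique (A := A) ⟨?_, ?_, ?_, ?_⟩ (pinv_spec A)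
  · simpa [Matrix.transpose_mul, hA, Matrix.mul_assoc] using congrArg Matrix.transpose h1
  · simpa [Matrix.transpose_mul, hA, Matrix.mul_assoc] using congrArg Matrix.transpose h2
  · rw [Matrix.transpose_mul, Matrix.transpose_transpose, hA]
    simpa [Matrix.transpose_mul, hA] using h4.symm
  · rw [Matrix.transpose_mul, Matrix.transpose_transpose, hA]
    simpa [Matrix.transpose_mul, hA] using h3.symm

theorem pinv_smul {a b : Type*} [Fintype a] [Fintype b] (A : Matrix a b ℝ) {c : ℝ} (hc : c ≠ 0) :
    pinv (c • A) = c⁻¹ • pinv A := by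
  obtain ⟨h1, h2, h3, h4⟩ := pinv_spec A
  refine IsMoorePenrose.unique (pinv_spec _) ⟨?_, ?_, ?_, ?_⟩
  · simp [smul_smul, hc, h1]
  · simp [smul_smul, hc, h2]
  · simp [smul_smul, hc, h3]
  · simp [smul_smul, hc, h4]

/-- The coefficients of the orthogonal projection of `x` onto the column space of `S`. -/
def projCoef (S : Matrix ι κ ℝ) (x : ι → ℝ) : κ → ℝ := pinv (Sᵀ * S) *ᵥ (Sᵀ *ᵥ x)

/-- The orthogonal projection onto the column space of `S`. -/
def spanProj (S : Matrix ι κ ℝ) : Matrix ι ι ℝ := S * pinv (Sᵀ * S) * Sᵀ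

theorem mulVec_projCoef (S : Matrix ι κ ℝ) (x : ι → ℝ) :
    S *ᵥ projCoef S x = spanProj S *ᵥ x := by
  simp [projCoef, spanProj, Matrix.mulVec_mulVec, Matrix.mul_assoc]

theorem spanProj_transpose (S : Matrix ι κ ℝ) : (spanProj S)ᵀ = spanProj S := by
  have : (pinv (Sᵀ * S))ᵀ = pinv (Sᵀ * S) := pinv_transpose_of_symm (by simp)
  simp [spanProj, Matrix.transpose_mul, this, Matrix.mul_assoc]

/-- The Penrose equation gives SᵀS (X SᵀS - 1) = 0, and SᵀS B = 0 forces S B = 0. No independence of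
the columns is needed, which matters because past configurations may coincide. -/
theorem spanProj_mul (S : Matrix ι κ ℝ) : spanProj S * S = S := by
  classical
  have h1 := (pinv_spec (Sᵀ * S)).1
  have h0 : S * (pinv (Sᵀ * S) * (Sᵀ * S) - 1) = 0 := by
    have : Sᴴ * S * (pinv (Sᵀ * S) * (Sᵀ * S) - 1) = 0 := by
      rw [Matrix.conjTranspose_eq_transpose_of_trivial, Matrix.mul_sub, Matrix.mul_one,
        ← Matrix.mul_assoc, h1, sub_self]
    exact (Matrix.conjTranspose_mul_self_mul_eq_zero S _).1 this
  rw [Matrix.mul_sub, Matrix.mul_one, sub_eq_zero] at h0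
  simpa only [spanProj, Matrix.mul_assoc] using h0

theorem spanProj_mul_self (S : Matrix ι κ ℝ) : spanProj S * spanProj S = spanProj S := by
  conv_lhs => rhs; rw [spanProj]
  rw [← Matrix.mul_assoc, ← Matrix.mul_assoc, spanProj_mul, spanProj]

theorem spanProj_mulVec_self (S : Matrix ι κ ℝ) (x : ι → ℝ) :
    spanProj S *ᵥ (spanProj S *ᵥ x) = spanProj S *ᵥ x := by
  rw [Matrix.mulVec_mulVec, spanProj_mul_self]

theorem spanProj_mulVec_col (S : Matrix ι κ ℝ) (a : κ) :
    spanProj S *ᵥ (fun i => S i a) = fun i => S i a := by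
  funext i
  have := congrFun (congrFun (spanProj_mul S) i) a
  simpa [Matrix.mul_apply, Matrix.mulVec, dotProduct] using this

theorem spanProj_mulVec_eq_zero (S : Matrix ι κ ℝ) {x : ι → ℝ}
    (h : ∀ a, x ⬝ᵥ (fun i => S i a) = 0) : spanProj S *ᵥ x = 0 := by
  have : Sᵀ *ᵥ x = 0 := by
    funext a
    simpa [Matrix.mulVec, dotProduct, mul_comm] using h a
  rw [spanProj, ← Matrix.mulVec_mulVec, this, Matrix.mulVec_zero]

theorem dotProduct_mulVec_of_symm {A : Matrix ι ι ℝ} (hA : Aᵀ = A) (x y : ι → ℝ) :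
    x ⬝ᵥ (A *ᵥ y) = (A *ᵥ x) ⬝ᵥ y := by
  rw [Matrix.dotProduct_mulVec, ← Matrix.mulVec_transpose, hA]

theorem dotProduct_spanProj (S : Matrix ι κ ℝ) (x y : ι → ℝ) :
    x ⬝ᵥ (spanProj S *ᵥ y) = (spanProj S *ᵥ x) ⬝ᵥ y :=
  dotProduct_mulVec_of_symm (spanProj_transpose S) x y

/-- The residual is orthogonal to the columns. -/
theorem sub_spanProj_dotProduct_col (S : Matrix ι κ ℝ) (x : ι → ℝ) (a : κ) :
    (x - spanProj S *ᵥ x) ⬝ᵥ (fun i => S i a) = 0 := by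
  rw [sub_dotProduct, ← dotProduct_spanProj, spanProj_mulVec_col, sub_self]

theorem spanProj_sub_spanProj (S : Matrix ι κ ℝ) (x : ι → ℝ) :
    spanProj S *ᵥ (x - spanProj S *ᵥ x) = 0 := by
  rw [Matrix.mulVec_sub, spanProj_mulVec_self, sub_self]

end Projection

/-! ### Linear images of Gaussian vectors -/

section Gaussian

variable {Ω : Type*} [MeasurableSpace Ω] {P : Measure Ω}

theorem HasGaussianLaw.comp_isLinearMap {E F : Type*} [NormedAddCommGroup E] [NormedSpace ℝ E]
    [FiniteDimensional ℝ E] [MeasurableSpace E] [BorelSpace E]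
    [NormedAddCommGroup F] [NormedSpace ℝ F] [MeasurableSpace F] [BorelSpace F]
    {X : Ω → E} (hX : HasGaussianLaw X P) {g : E → F} (hg : IsLinearMap ℝ g) :
    HasGaussianLaw (fun ω => g (X ω)) P :=
  hX.map_fun (LinearMap.toContinuousLinearMap (hg.mk' g))

variable {ι : Type*} [Fintype ι]

theorem IsCenteredGaussian.memLp {X : Ω → ι → ℝ} {S : ι → ι → ℝ} (hX : IsCenteredGaussian X S P)
    (a : ι → ℝ) : MemLp (fun ω => a ⬝ᵥ X ω) 2 P := by
  refine (HasGaussianLaw.comp_isLinearMap hX.1 (g := fun x => a ⬝ᵥ x) ⟨?_, ?_⟩).memLp_two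
  · intro x y; exact dotProduct_add _ _ _
  · intro c x; exact dotProduct_smul _ _ _

theorem IsCenteredGaussian.integral_dotProduct {X : Ω → ι → ℝ} {S : ι → ι → ℝ}
    (hX : IsCenteredGaussian X S P) (a : ι → ℝ) : ∫ ω, a ⬝ᵥ X ω ∂P = 0 := by
  classical
  have := hX.1.isProbabilityMeasure
  simp only [dotProduct]
  rw [integral_finsetSum]
  · simp [integral_const_mul, hX.2.1]
  · intro i _
    have := (hX.memLp (Pi.single i 1)).integrable (by norm_num)
    simpa using this.const_mul (a i)

theorem IsCenteredGaussian.integral_mul {X : Ω → ι → ℝ} {S : ι → ι → ℝ}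
    (hX : IsCenteredGaussian X S P) (a b : ι → ℝ) :
    ∫ ω, (a ⬝ᵥ X ω) * (b ⬝ᵥ X ω) ∂P = ∑ i, ∑ j, a i * b j * S i j := by
  classical
  have := hX.1.isProbabilityMeasure
  have hm : ∀ i, MemLp (fun ω => X ω i) 2 P := fun i => by
    simpa using hX.memLp (Pi.single i 1)
  have hi : ∀ i j, Integrable (fun ω => a i * b j * (X ω i * X ω j)) P := fun i j =>
    ((hm i).integrable_mul (hm j)).const_mul _
  have : ∀ ω, (a ⬝ᵥ X ω) * (b ⬝ᵥ X ω) = ∑ i, ∑ j, a i * b j * (X ω i * X ω j) := by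
    intro ω
    simp only [dotProduct, Finset.sum_mul_sum]
    refine Finset.sum_congr rfl fun i _ => Finset.sum_congr rfl fun j _ => by ring
  simp only [this]
  rw [integral_finsetSum _ fun i _ => integrable_finsetSum _ fun j _ => hi i j]
  refine Finset.sum_congr rfl fun i _ => ?_
  rw [integral_finsetSum _ fun j _ => hi i j]
  refine Finset.sum_congr rfl fun j _ => ?_
  rw [integral_const_mul, hX.2.2]

/-- A Gaussian vector with standard means and covariances of all linear functionals. -/
theorem isCenteredGaussian_of_dotProduct {X : Ω → ι → ℝ} [DecidableEq ι] {S : ι → ι → ℝ}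
    (h : HasGaussianLaw X P) (h0 : ∀ a : ι → ℝ, ∫ ω, a ⬝ᵥ X ω ∂P = 0)
    (h1 : ∀ a b : ι → ℝ, ∫ ω, (a ⬝ᵥ X ω) * (b ⬝ᵥ X ω) ∂P = ∑ i, ∑ j, a i * b j * S i j) :
    IsCenteredGaussian X S P := by
  refine ⟨h, fun i => by simpa using h0 (Pi.single i 1), fun i j => ?_⟩
  have := h1 (Pi.single i 1) (Pi.single j 1)
  simpa [Pi.single_apply, Finset.sum_ite_eq] using this

theorem IsCenteredGaussian.charFunDual_map {X : Ω → ι → ℝ} {S : ι → ι → ℝ} [DecidableEq ι]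
    (hX : IsCenteredGaussian X S P) (L : StrongDual ℝ (ι → ℝ)) :
    charFunDual (P.map X) L = Complex.exp
      (-((∑ i, ∑ j, L (Pi.single i 1) * L (Pi.single j 1) * S i j : ℝ) : ℂ) / 2) := by
  have := hX.1.isProbabilityMeasure
  obtain ⟨l, hl⟩ : ∃ l : ι → ℝ, ∀ i, L (Pi.single i 1) = l i := ⟨_, fun i => rfl⟩
  have hL : ∀ x : ι → ℝ, L x = l ⬝ᵥ x := by
    intro x
    conv_lhs => rw [pi_eq_sum_univ' x]
    simp [dotProduct, mul_comm, map_sum, hl]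
  simp only [hl]
  rw [hX.1.charFunDual_map_eq_fun]
  have h0 : ∫ ω, L (X ω) ∂P = 0 := by simp only [hL]; exact hX.integral_dotProduct _
  rw [h0, variance_eq_sub, h0]
  · simp only [Pi.pow_apply, pow_two]
    have h1 : ∫ ω, L (X ω) * L (X ω) ∂P
        = ∑ i, ∑ j, l i * l j * S i j := by
      simp only [hL]; rw [hX.integral_mul]
    rw [h1]
    simp [neg_div]
  · simp only [hL]; exact hX.memLp _

/-- Centered Gaussian vectors with the same covariance have the same law. -/
theorem IsCenteredGaussian.map_eq {Ω' : Type*} [MeasurableSpace Ω'] {P' : Measure Ω'}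
    {X : Ω → ι → ℝ} {Y : Ω' → ι → ℝ} {S : ι → ι → ℝ}
    (hX : IsCenteredGaussian X S P) (hY : IsCenteredGaussian Y S P') :
    P.map X = P'.map Y := by
  classical
  have := hX.1.isProbabilityMeasure
  have := hY.1.isProbabilityMeasure
  refine Measure.ext_of_charFunDual ?_
  ext L
  rw [hX.charFunDual_map, hY.charFunDual_map]

theorem HasGaussianLaw.of_map_eq {Ω' E : Type*} [MeasurableSpace Ω'] {P' : Measure Ω'}
    [TopologicalSpace E] [AddCommMonoid E] [Module ℝ E] [MeasurableSpace E]
    {X : Ω → E} {Y : Ω' → E} (hX : HasGaussianLaw X P) (h : P'.map Y = P.map X) :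
    HasGaussianLaw Y P' :=
  ⟨h ▸ hX.isGaussian_map⟩

theorem IsCenteredGaussian.of_map_eq {Ω' : Type*} [MeasurableSpace Ω'] {P' : Measure Ω'}
    {X : Ω → ι → ℝ} {Y : Ω' → ι → ℝ} {S : ι → ι → ℝ}
    (hX : IsCenteredGaussian X S P) (hY : AEMeasurable Y P') (h : P'.map Y = P.map X) :
    IsCenteredGaussian Y S P' := by
  have hXm := hX.1.aemeasurable
  refine ⟨HasGaussianLaw.of_map_eq hX.1 h, fun a => ?_, fun a b => ?_⟩
  · have h1 := integral_map hY (f := fun x : ι → ℝ => x a)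
      (by fun_prop : Measurable _).aestronglyMeasurable
    have h2 := integral_map hXm (f := fun x : ι → ℝ => x a)
      (by fun_prop : Measurable _).aestronglyMeasurable
    rw [← h1, h, h2]; exact hX.2.1 a
  · have h1 := integral_map hY (f := fun x : ι → ℝ => x a * x b)
      (by fun_prop : Measurable _).aestronglyMeasurable
    have h2 := integral_map hXm (f := fun x : ι → ℝ => x a * x b)
      (by fun_prop : Measurable _).aestronglyMeasurable
    rw [← h1, h, h2]; exact hX.2.2 a b

end Gaussian

/-! ### Bilinear statistics of the GOE -/

section GOE

variable {Ω : Type*} [MeasurableSpace Ω] {P : Measure Ω} {N : ℕ}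

theorem dotProduct_mulVec_eq_sum (M : Fin N → Fin N → ℝ) (a b : Fin N → ℝ) :
    a ⬝ᵥ (Matrix.of M *ᵥ b) =
      (fun p : Fin N × Fin N => a p.1 * b p.2) ⬝ᵥ (fun p : Fin N × Fin N => M p.1 p.2) := by
  simp only [dotProduct, Matrix.mulVec, Matrix.of_apply, Fintype.sum_prod_type, Finset.mul_sum]
  refine Finset.sum_congr rfl fun i _ => Finset.sum_congr rfl fun j _ => by ring

variable {J : Ω → Fin N → Fin N → ℝ}

theorem IsGOE.memLp (hJ : IsGOE J P) (a b : Fin N → ℝ) :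
    MemLp (fun ω => a ⬝ᵥ (Matrix.of (J ω) *ᵥ b)) 2 P := by
  simp only [dotProduct_mulVec_eq_sum]
  exact IsCenteredGaussian.memLp hJ _

theorem IsGOE.integral_dotProduct (hJ : IsGOE J P) (a b : Fin N → ℝ) :
    ∫ ω, a ⬝ᵥ (Matrix.of (J ω) *ᵥ b) ∂P = 0 := by
  simp only [dotProduct_mulVec_eq_sum]
  exact IsCenteredGaussian.integral_dotProduct hJ _

/-- The second product comes from the symmetry of the matrix. It doubles the variance of ⟨e, J e⟩
for a unit vector e, which is why innovations need whitening. -/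
theorem IsGOE.integral_mul (hJ : IsGOE J P) (a b c d : Fin N → ℝ) :
    ∫ ω, (a ⬝ᵥ (Matrix.of (J ω) *ᵥ b)) * (c ⬝ᵥ (Matrix.of (J ω) *ᵥ d)) ∂P
      = ((a ⬝ᵥ c) * (b ⬝ᵥ d) + (a ⬝ᵥ d) * (b ⬝ᵥ c)) / N := by
  simp only [dotProduct_mulVec_eq_sum]
  rw [IsCenteredGaussian.integral_mul hJ]
  have h1 : ∀ p q : Fin N × Fin N, a p.1 * b p.2 * (c q.1 * d q.2) *
      (((if p.1 = q.1 ∧ p.2 = q.2 then (1 : ℝ) else 0)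
        + (if p.1 = q.2 ∧ p.2 = q.1 then 1 else 0)) / (N : ℝ))
      = (if q = p then a p.1 * b p.2 * (c q.1 * d q.2) / N else 0)
        + (if q = (p.2, p.1) then a p.1 * b p.2 * (c q.1 * d q.2) / N else 0) := by
    intro p q
    have e1 : (p.1 = q.1 ∧ p.2 = q.2) ↔ q = p := by rw [Prod.ext_iff]; tauto
    have e2 : (p.1 = q.2 ∧ p.2 = q.1) ↔ q = (p.2, p.1) := by rw [Prod.ext_iff]; tauto
    simp only [e1, e2]
    split_ifs <;> ring
  simp only [h1, Finset.sum_add_distrib, Finset.sum_ite_eq', Finset.mem_univ, if_true]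
  simp only [dotProduct, Finset.sum_mul_sum, Fintype.sum_prod_type, add_div, Finset.sum_div]
  congr 1 <;> refine Finset.sum_congr rfl fun i _ => Finset.sum_congr rfl fun j _ => by ring

/-- Symmetry is not part of the definition; it follows from the covariance, under which J_ij - J_ji
has second moment zero. -/
theorem IsGOE.ae_symm (hJ : IsGOE J P) : ∀ᵐ ω ∂P, (Matrix.of (J ω))ᵀ = Matrix.of (J ω) := by
  have : ∀ i j, ∀ᵐ ω ∂P, J ω i j = J ω j i := by
    intro i j
    set α : Fin N × Fin N → ℝ := Pi.single (i, j) 1 - Pi.single (j, i) 1 with hα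
    have hα' : ∀ ω, α ⬝ᵥ (fun p : Fin N × Fin N => J ω p.1 p.2) = J ω i j - J ω j i := by
      intro ω; simp [hα, sub_dotProduct]
    have hi := IsCenteredGaussian.integral_mul hJ α α
    have h0 : ∫ ω, (J ω i j - J ω j i) * (J ω i j - J ω j i) ∂P = 0 := by
      simp only [hα'] at hi
      rw [hi, hα]
      simp only [Pi.sub_apply, sub_mul, mul_sub, Finset.sum_sub_distrib, Pi.single_apply]
      simp [ite_and]
      ring
    have hm : Integrable (fun ω => (J ω i j - J ω j i) * (J ω i j - J ω j i)) P := by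
      have := IsCenteredGaussian.memLp hJ α
      simp only [hα'] at this
      exact this.integrable_mul this
    have := (integral_eq_zero_iff_of_nonneg (fun ω => mul_self_nonneg _) hm).1 h0
    filter_upwards [this] with ω hω
    have : J ω i j - J ω j i = 0 := mul_self_eq_zero.1 hω
    linarith
  have := ae_all_iff.2 fun i => ae_all_iff.2 fun j => this i j
  filter_upwards [this] with ω hω
  ext i j
  simp [hω j i]

end GOE

/-! ### Innovations of a sequential exploration -/

section Innovation

variable {N : ℕ}

/-- The matrix with columns `v 0, …, v (r - 1)`. -/
def colMat (v : ℕ → Fin N → ℝ) (r : ℕ) : Matrix (Fin N) (Fin r) ℝ := Matrix.of fun i s => v s i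

/-- The orthogonal projection onto the span of `v 0, …, v (r - 1)`. -/
def pastProj (v : ℕ → Fin N → ℝ) (r : ℕ) : Matrix (Fin N) (Fin N) ℝ := spanProj (colMat v r)

/-- The component of `v r` orthogonal to `v 0, …, v (r - 1)`. -/
def resid (v : ℕ → Fin N → ℝ) (r : ℕ) : Fin N → ℝ := v r - pastProj v r *ᵥ v r

def residNorm (v : ℕ → Fin N → ℝ) (r : ℕ) : ℝ := Real.sqrt (resid v r ⬝ᵥ resid v r)

/-- The normalized residual; it vanishes if the residual does. -/
def residDir (v : ℕ → Fin N → ℝ) (r : ℕ) : Fin N → ℝ := (residNorm v r)⁻¹ • resid v r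

/-- The image of the residual under the matrix that maps `v s` to `y s`. -/
def residImage (v y : ℕ → Fin N → ℝ) (r : ℕ) : Fin N → ℝ :=
  y r - ∑ s : Fin r, projCoef (colMat v r) (v r) s • y s

/-- The constant `1 - 1 / √2` that whitens the direction of the residual. -/
def whiten : ℝ := 1 - (Real.sqrt 2)⁻¹

/-- The whitened image of the normalized residual, or the auxiliary noise `w` if the residual
vanishes. -/
def whiteImage (v y : ℕ → Fin N → ℝ) (w : Fin N → ℝ) (r : ℕ) : Fin N → ℝ :=
  if resid v r = 0 then w else
    Real.sqrt N • ((residNorm v r)⁻¹ • residImage v y r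
      - (whiten * (residDir v r ⬝ᵥ ((residNorm v r)⁻¹ • residImage v y r))) • residDir v r)

/-- The innovation revealed by `y r`, completed by the auxiliary noise `w` along the span of
`v 0, …, v (r - 1)`. -/
def innov (v y : ℕ → Fin N → ℝ) (w : Fin N → ℝ) (r : ℕ) : Fin N → ℝ :=
  whiteImage v y w r - pastProj v r *ᵥ whiteImage v y w r + pastProj v r *ᵥ w

/-- This is 2 (1 - `whiten`)² = 1: along the residual direction the variance factor 2 is brought
down to 1. -/
theorem whiten_eq : 1 - 4 * whiten + 2 * whiten ^ 2 = 0 := by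
  have h : (Real.sqrt 2)⁻¹ ^ 2 = 1 / 2 := by rw [inv_pow, Real.sq_sqrt (by norm_num)]; norm_num
  unfold whiten
  nlinarith

theorem dotProduct_pastProj (v : ℕ → Fin N → ℝ) (r : ℕ) (x y : Fin N → ℝ) :
    x ⬝ᵥ (pastProj v r *ᵥ y) = (pastProj v r *ᵥ x) ⬝ᵥ y := dotProduct_spanProj _ _ _

theorem pastProj_mulVec_self (v : ℕ → Fin N → ℝ) (r : ℕ) (x : Fin N → ℝ) :
    pastProj v r *ᵥ (pastProj v r *ᵥ x) = pastProj v r *ᵥ x := spanProj_mulVec_self _ _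

theorem sub_pastProj_dotProduct (v : ℕ → Fin N → ℝ) {r s : ℕ} (h : s < r) (x : Fin N → ℝ) :
    (x - pastProj v r *ᵥ x) ⬝ᵥ v s = 0 :=
  sub_spanProj_dotProduct_col (colMat v r) x ⟨s, h⟩

theorem pastProj_sub_pastProj (v : ℕ → Fin N → ℝ) (r : ℕ) (x : Fin N → ℝ) :
    pastProj v r *ᵥ (x - pastProj v r *ᵥ x) = 0 := spanProj_sub_spanProj _ _

theorem resid_dotProduct (v : ℕ → Fin N → ℝ) {r s : ℕ} (h : s < r) : resid v r ⬝ᵥ v s = 0 :=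
  sub_pastProj_dotProduct v h _

theorem residDir_dotProduct (v : ℕ → Fin N → ℝ) {r s : ℕ} (h : s < r) :
    residDir v r ⬝ᵥ v s = 0 := by
  rw [residDir, smul_dotProduct, resid_dotProduct v h, smul_zero]

theorem pastProj_resid (v : ℕ → Fin N → ℝ) (r : ℕ) : pastProj v r *ᵥ resid v r = 0 :=
  pastProj_sub_pastProj _ _ _

theorem pastProj_residDir (v : ℕ → Fin N → ℝ) (r : ℕ) : pastProj v r *ᵥ residDir v r = 0 := by
  rw [residDir, Matrix.mulVec_smul, pastProj_resid, smul_zero]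

theorem dotProduct_self_nonneg' (x : Fin N → ℝ) : 0 ≤ x ⬝ᵥ x :=
  Finset.sum_nonneg fun i _ => mul_self_nonneg (x i)

theorem residNorm_sq (v : ℕ → Fin N → ℝ) (r : ℕ) : residNorm v r ^ 2 = resid v r ⬝ᵥ resid v r :=
  Real.sq_sqrt (dotProduct_self_nonneg' _)

theorem residNorm_eq_zero (v : ℕ → Fin N → ℝ) (r : ℕ) : residNorm v r = 0 ↔ resid v r = 0 := by
  rw [residNorm, Real.sqrt_eq_zero (dotProduct_self_nonneg' _), dotProduct_self_eq_zero]

theorem residNorm_smul_residDir (v : ℕ → Fin N → ℝ) (r : ℕ) :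
    residNorm v r • residDir v r = resid v r := by
  by_cases h : resid v r = 0
  · simp [residDir, h]
  · rw [residDir, smul_smul, mul_inv_cancel₀ (mt (residNorm_eq_zero v r).1 h), one_smul]

theorem residDir_dotProduct_self (v : ℕ → Fin N → ℝ) (r : ℕ) (h : resid v r ≠ 0) :
    residDir v r ⬝ᵥ residDir v r = 1 := by
  have h0 := mt (residNorm_eq_zero v r).1 h
  rw [residDir, smul_dotProduct, dotProduct_smul, ← residNorm_sq, smul_eq_mul, smul_eq_mul]
  field_simp

theorem pastProj_mulVec_eq_sum (v : ℕ → Fin N → ℝ) (r : ℕ) (x : Fin N → ℝ) :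
    pastProj v r *ᵥ x = ∑ s : Fin r, projCoef (colMat v r) x s • v s := by
  rw [pastProj, ← mulVec_projCoef]
  funext i
  simp [Matrix.mulVec, dotProduct, colMat, Finset.sum_apply, mul_comm]

/-- Innovations are defined from the revealed images alone, so that their measurability is visible;
this identifies them with expressions in the matrix. -/
theorem mulVec_residImage (A : Matrix (Fin N) (Fin N) ℝ) (v : ℕ → Fin N → ℝ) (r : ℕ) :
    residImage v (fun s => A *ᵥ v s) r = A *ᵥ resid v r := by
  rw [residImage, resid, Matrix.mulVec_sub, pastProj_mulVec_eq_sum, Matrix.mulVec_sum]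
  simp only [Matrix.mulVec_smul]

theorem mulVec_residDir (A : Matrix (Fin N) (Fin N) ℝ) (v : ℕ → Fin N → ℝ) (r : ℕ) :
    A *ᵥ residDir v r = (residNorm v r)⁻¹ • residImage v (fun s => A *ᵥ v s) r := by
  rw [mulVec_residImage, residDir, Matrix.mulVec_smul]

theorem whiteImage_mulVec (A : Matrix (Fin N) (Fin N) ℝ) (v : ℕ → Fin N → ℝ) (w : Fin N → ℝ)
    {r : ℕ} (h : resid v r ≠ 0) :
    whiteImage v (fun s => A *ᵥ v s) w r = Real.sqrt N • (A *ᵥ residDir v r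
      - (whiten * (residDir v r ⬝ᵥ (A *ᵥ residDir v r))) • residDir v r) := by
  rw [whiteImage, if_neg h, ← mulVec_residDir]

theorem pastProj_innov (v y : ℕ → Fin N → ℝ) (w : Fin N → ℝ) (r : ℕ) :
    pastProj v r *ᵥ innov v y w r = pastProj v r *ᵥ w := by
  rw [innov, Matrix.mulVec_add, pastProj_sub_pastProj, pastProj_mulVec_self, zero_add]

theorem innov_of_resid_eq_zero (v y : ℕ → Fin N → ℝ) (w : Fin N → ℝ) {r : ℕ}
    (h : resid v r = 0) : innov v y w r = w := by
  rw [innov, whiteImage, if_pos h, sub_add_cancel]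

/-- The functional `a` of the white image of `A`, as a bilinear expression in `A`. -/
theorem dotProduct_innov (A : Matrix (Fin N) (Fin N) ℝ) (v : ℕ → Fin N → ℝ) (w : Fin N → ℝ)
    {r : ℕ} (h : resid v r ≠ 0) (a : Fin N → ℝ) :
    a ⬝ᵥ innov v (fun s => A *ᵥ v s) w r
      = (Real.sqrt N • (a - pastProj v r *ᵥ a - (whiten * (a ⬝ᵥ residDir v r)) • residDir v r))
          ⬝ᵥ (A *ᵥ residDir v r) + (pastProj v r *ᵥ a) ⬝ᵥ w := by
  have h1 : (pastProj v r *ᵥ a) ⬝ᵥ residDir v r = 0 := by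
    rw [← dotProduct_pastProj, pastProj_residDir, dotProduct_zero]
  rw [innov, dotProduct_add, dotProduct_sub, dotProduct_pastProj, dotProduct_pastProj,
    ← sub_dotProduct, whiteImage_mulVec A v w h]
  simp only [smul_dotProduct, dotProduct_smul, sub_dotProduct, dotProduct_sub, h1, smul_eq_mul]
  ring

/-- The recovered image of the residual in terms of the innovation. -/
theorem mulVec_resid_eq_innov (A : Matrix (Fin N) (Fin N) ℝ) (v : ℕ → Fin N → ℝ)
    (w : Fin N → ℝ) (r : ℕ) (hN : 0 < N) :
    A *ᵥ resid v r - pastProj v r *ᵥ (A *ᵥ resid v r)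
      = (residNorm v r / Real.sqrt N) • (innov v (fun s => A *ᵥ v s) w r
          - pastProj v r *ᵥ innov v (fun s => A *ᵥ v s) w r)
        + ((Real.sqrt 2 - 1) / Real.sqrt N
            * (residDir v r ⬝ᵥ innov v (fun s => A *ᵥ v s) w r)) • resid v r := by
  by_cases h : resid v r = 0
  · simp [h, (residNorm_eq_zero v r).2 h]
  have hN' : Real.sqrt N ≠ 0 := by positivity
  have h0 := mt (residNorm_eq_zero v r).1 h
  set e := residDir v r with he
  set x := A *ᵥ e with hx
  have h1 : A *ᵥ resid v r = residNorm v r • x := by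
    rw [← residNorm_smul_residDir, Matrix.mulVec_smul]
  have h2 : e ⬝ᵥ innov v (fun s => A *ᵥ v s) w r
      = Real.sqrt N * ((1 - whiten) * (e ⬝ᵥ x)) := by
    rw [he, dotProduct_innov A v w h, pastProj_residDir, residDir_dotProduct_self v r h]
    simp only [sub_zero, mul_one, zero_dotProduct, add_zero, smul_dotProduct, sub_dotProduct,
      smul_eq_mul, ← he, ← hx]
    ring
  rw [h2, pastProj_innov, innov, add_sub_cancel_right, whiteImage_mulVec A v w h, h1,
    ← residNorm_smul_residDir v r, ← he, ← hx]
  simp only [Matrix.mulVec_smul, Matrix.mulVec_sub, he, pastProj_residDir, smul_zero, sub_zero]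
  rw [← he]
  -- Undoing the whitening: the innovation retains the fraction 1 - `whiten` of the component along
  -- e, and √2 - 1 times that fraction is exactly the part that was removed.
  have h3 : (Real.sqrt 2 - 1) * (1 - whiten) = whiten := by
    unfold whiten
    have : Real.sqrt 2 ≠ 0 := by positivity
    field_simp
    ring
  funext i
  simp only [Pi.sub_apply, Pi.add_apply, Pi.smul_apply, smul_eq_mul]
  have h4 : (Real.sqrt 2 - 1) / Real.sqrt N * (Real.sqrt N * ((1 - whiten) * (e ⬝ᵥ x)))
      = whiten * (e ⬝ᵥ x) := by
    field_simp
    linear_combination (e ⬝ᵥ x) * h3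
  rw [h4]
  field_simp
  ring

end Innovation

/-! ### Law and independence of innovations for deterministic directions -/

section FixedDirections

variable {Ω : Type*} [MeasurableSpace Ω] {P : Measure Ω} {N : ℕ}

/-- A standard Gaussian vector extracted from a GOE matrix. -/
def noise (M : Fin N → Fin N → ℝ) : Fin N → ℝ := fun i => Real.sqrt (N / 2) * M i i

/-- The diagonal entries are independent with variance 2 / N, hence the factor √(N / 2). -/
theorem IsGOE.noise {M : Ω → Fin N → Fin N → ℝ} (hM : IsGOE M P) :
    IsCenteredGaussian (fun ω => noise (M ω)) (1 : Matrix (Fin N) (Fin N) ℝ) P := by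
  refine ⟨HasGaussianLaw.comp_isLinearMap hM.1
    (g := fun (x : Fin N × Fin N → ℝ) i => Real.sqrt (N / 2) * x (i, i)) ⟨?_, ?_⟩, ?_, ?_⟩
  · intro x y; funext i; simp [mul_add]
  · intro c x; funext i; simp; ring
  · intro a
    simp only [BlockScan.noise, integral_const_mul]
    rw [hM.2.1 (a, a), mul_zero]
  · intro a b
    have hN : (0 : ℝ) < N := by exact_mod_cast a.pos
    have : ∀ ω, BlockScan.noise (M ω) a * BlockScan.noise (M ω) b
        = (N / 2) * (M ω a a * M ω b b) := by
      intro ω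
      simp only [BlockScan.noise]
      have := Real.mul_self_sqrt (show (0 : ℝ) ≤ N / 2 by positivity)
      linear_combination (M ω a a * M ω b b) * this
    simp only [this, integral_const_mul]
    rw [hM.2.2 (a, a) (b, b)]
    by_cases hab : a = b
    · subst hab; simp; field_simp; norm_num
    · simp [hab]

variable {J : Ω → Fin N → Fin N → ℝ} {w : Ω → Fin N → ℝ}

/-- With frozen directions the innovation is linear in the matrix and the noise. Gaussianity, and
independence by vanishing covariances, both rest on this. -/
theorem isLinearMap_innov (v : ℕ → Fin N → ℝ) (r : ℕ) :
    IsLinearMap ℝ (fun z : (Fin N × Fin N → ℝ) × (Fin N → ℝ) =>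
      innov v (fun s => Matrix.of (fun i j => z.1 (i, j)) *ᵥ v s) z.2 r) := by
  have hext : ∀ x y : Fin N → ℝ, (∀ a, a ⬝ᵥ x = a ⬝ᵥ y) → x = y := by
    intro x y h; funext i; simpa using h (Pi.single i 1)
  by_cases h : resid v r = 0
  · constructor <;> intros <;> simp [innov_of_resid_eq_zero _ _ _ h]
  · constructor
    · intro x y
      refine hext _ _ fun a => ?_
      rw [dotProduct_add]
      simp only [dotProduct_innov _ v _ h]
      have : (Matrix.of fun i j => (x + y).1 (i, j)) = (Matrix.of fun i j => x.1 (i, j))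
        + Matrix.of fun i j => y.1 (i, j) := by ext; simp
      rw [this, Matrix.add_mulVec, dotProduct_add, Prod.snd_add, dotProduct_add]
      ring
    · intro c x
      refine hext _ _ fun a => ?_
      rw [dotProduct_smul]
      simp only [dotProduct_innov _ v _ h]
      have : (Matrix.of fun i j => (c • x).1 (i, j)) = c • (Matrix.of fun i j => x.1 (i, j)) := by
        ext; simp
      rw [this, Matrix.smul_mulVec, dotProduct_smul, Prod.smul_snd, dotProduct_smul]
      simp only [smul_eq_mul]
      ring

theorem hasGaussianLaw_pair (hJ : IsGOE J P)
    (hw : IsCenteredGaussian w (1 : Matrix (Fin N) (Fin N) ℝ) P) (hJw : IndepFun J w P) :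
    HasGaussianLaw (fun ω => ((fun p : Fin N × Fin N => J ω p.1 p.2), w ω)) P :=
  IndepFun.hasGaussianLaw hJ.1 hw.1
    (hJw.comp (φ := fun (M : Fin N → Fin N → ℝ) (p : Fin N × Fin N) => M p.1 p.2) (ψ := id)
      (by fun_prop) measurable_id)

theorem integral_dotProduct_mul_noise (hJ : IsGOE J P)
    (hw : IsCenteredGaussian w (1 : Matrix (Fin N) (Fin N) ℝ) P) (hJw : IndepFun J w P)
    (a b c : Fin N → ℝ) :
    ∫ ω, (a ⬝ᵥ (Matrix.of (J ω) *ᵥ b)) * (c ⬝ᵥ w ω) ∂P = 0 := by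
  have : IndepFun (fun ω => a ⬝ᵥ (Matrix.of (J ω) *ᵥ b)) (fun ω => c ⬝ᵥ w ω) P := by
    refine hJw.comp (φ := fun M : Fin N → Fin N → ℝ => a ⬝ᵥ (Matrix.of M *ᵥ b))
      (ψ := fun x => c ⬝ᵥ x) ?_ ?_
    · simp only [dotProduct, Matrix.mulVec, Matrix.of_apply]; fun_prop
    · simp only [dotProduct]; fun_prop
  rw [this.integral_fun_mul_eq_mul_integral (hJ.memLp a b).1 (hw.memLp c).1,
    hJ.integral_dotProduct, zero_mul]

theorem IsCenteredGaussian.integral_mul_one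
    (hw : IsCenteredGaussian w (1 : Matrix (Fin N) (Fin N) ℝ) P) (a b : Fin N → ℝ) :
    ∫ ω, (a ⬝ᵥ w ω) * (b ⬝ᵥ w ω) ∂P = a ⬝ᵥ b := by
  rw [hw.integral_mul]
  simp [Matrix.one_apply, dotProduct]

/-- After removal of the past span, √N J e has covariance 1 - Π + e eᵀ. Whitening reduces it to 1 -
Π, and the independent noise projected to the past span supplies the missing Π. -/
theorem isCenteredGaussian_innov (hJ : IsGOE J P)
    (hw : IsCenteredGaussian w (1 : Matrix (Fin N) (Fin N) ℝ) P) (hJw : IndepFun J w P)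
    (v : ℕ → Fin N → ℝ) (r : ℕ) :
    IsCenteredGaussian (fun ω => innov v (fun s => Matrix.of (J ω) *ᵥ v s) (w ω) r)
      (1 : Matrix (Fin N) (Fin N) ℝ) P := by
  by_cases h : resid v r = 0
  · simpa only [innov_of_resid_eq_zero _ _ _ h] using hw
  have := hw.1.isProbabilityMeasure
  have hN : 0 < N := by
    rcases Nat.eq_zero_or_pos N with rfl | hN
    · exact absurd (Subsingleton.elim _ _) h
    · exact hN
  have hN' : (N : ℝ) ≠ 0 := by positivity
  have hsq : Real.sqrt N * Real.sqrt N = N := Real.mul_self_sqrt (by positivity)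
  refine isCenteredGaussian_of_dotProduct
    (HasGaussianLaw.comp_isLinearMap (hasGaussianLaw_pair hJ hw hJw) (isLinearMap_innov v r))
    (fun a => ?_) (fun a b => ?_)
  · simp only [dotProduct_innov _ v _ h]
    rw [integral_add ((hJ.memLp _ _).integrable (by norm_num))
      ((hw.memLp _).integrable (by norm_num)), hJ.integral_dotProduct, hw.integral_dotProduct,
      add_zero]
  · simp only [dotProduct_innov _ v _ h, add_mul, mul_add]
    have i1 : ∀ a b c d : Fin N → ℝ, Integrable (fun ω => (a ⬝ᵥ (Matrix.of (J ω) *ᵥ b))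
        * (c ⬝ᵥ (Matrix.of (J ω) *ᵥ d))) P :=
      fun a b c d => (hJ.memLp a b).integrable_mul (hJ.memLp c d)
    have i2 : ∀ a b c : Fin N → ℝ, Integrable (fun ω => (a ⬝ᵥ (Matrix.of (J ω) *ᵥ b))
        * (c ⬝ᵥ w ω)) P := fun a b c => (hJ.memLp a b).integrable_mul (hw.memLp c)
    have i3 : ∀ a b c : Fin N → ℝ, Integrable (fun ω => (c ⬝ᵥ w ω)
        * (a ⬝ᵥ (Matrix.of (J ω) *ᵥ b))) P :=
      fun a b c => (hw.memLp c).integrable_mul (hJ.memLp a b)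
    have i4 : ∀ a b : Fin N → ℝ, Integrable (fun ω => (a ⬝ᵥ w ω) * (b ⬝ᵥ w ω)) P :=
      fun a b => (hw.memLp a).integrable_mul (hw.memLp b)
    have i5 : ∀ a b c d f g h : Fin N → ℝ, Integrable (fun ω =>
        (a ⬝ᵥ (Matrix.of (J ω) *ᵥ b)) * (c ⬝ᵥ (Matrix.of (J ω) *ᵥ d))
        + (f ⬝ᵥ w ω) * (g ⬝ᵥ (Matrix.of (J ω) *ᵥ h))) P :=
      fun a b c d f g h => (i1 a b c d).add (i3 g h f)
    have i6 : ∀ a b c d f : Fin N → ℝ, Integrable (fun ω =>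
        (a ⬝ᵥ (Matrix.of (J ω) *ᵥ b)) * (c ⬝ᵥ w ω) + (d ⬝ᵥ w ω) * (f ⬝ᵥ w ω)) P :=
      fun a b c d f => (i2 a b c).add (i4 d f)
    rw [integral_add (i5 _ _ _ _ _ _ _) (i6 _ _ _ _ _),
      integral_add (i1 _ _ _ _) (i3 _ _ _), integral_add (i2 _ _ _) (i4 _ _), hJ.integral_mul,
      integral_dotProduct_mul_noise hJ hw hJw, hw.integral_mul_one]
    simp only [mul_comm (_ ⬝ᵥ w _) (_ ⬝ᵥ (Matrix.of (J _) *ᵥ _))]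
    rw [integral_dotProduct_mul_noise hJ hw hJw, residDir_dotProduct_self v r h]
    set e := residDir v r with he
    have hee : e ⬝ᵥ e = 1 := residDir_dotProduct_self v r h
    have hea : ∀ a, (pastProj v r *ᵥ a) ⬝ᵥ e = 0 := fun a => by
      rw [← dotProduct_pastProj, pastProj_residDir, dotProduct_zero]
    have hea' : ∀ a, e ⬝ᵥ (pastProj v r *ᵥ a) = 0 := fun a => by rw [dotProduct_comm, hea]
    have hpp : ∀ a b, (pastProj v r *ᵥ a) ⬝ᵥ (pastProj v r *ᵥ b) = a ⬝ᵥ (pastProj v r *ᵥ b) := by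
      intro a b
      rw [← dotProduct_pastProj, pastProj_mulVec_self]
    have hR : ∑ i, ∑ j, a i * b j * (1 : Matrix (Fin N) (Fin N) ℝ) i j = a ⬝ᵥ b := by
      simp [Matrix.one_apply, dotProduct]
    rw [hR]
    simp only [smul_dotProduct, dotProduct_smul, sub_dotProduct, dotProduct_sub, hea, hea', hee,
      smul_eq_mul, hpp, ← dotProduct_pastProj, dotProduct_comm e b]
    field_simp
    -- `hsq` normalizes the part orthogonal to the past, and `whiten_eq` cancels the terms in ⟨a,
    -- e⟩⟨b, e⟩.
    linear_combination ((a ⬝ᵥ b) - a ⬝ᵥ (pastProj v r *ᵥ b)) * hsq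
      + (a ⬝ᵥ e) * (b ⬝ᵥ e) * Real.sqrt N ^ 2 * whiten_eq

/-- Both sides are linear images of one Gaussian vector, so vanishing covariances suffice. In the
GOE covariance each of the two products contains a factor ⟨v s, e⟩ or ⟨v s, u⟩ with u orthogonal to
the past. -/
theorem indepFun_innov (hJ : IsGOE J P)
    (hw : IsCenteredGaussian w (1 : Matrix (Fin N) (Fin N) ℝ) P) (hJw : IndepFun J w P)
    (v : ℕ → Fin N → ℝ) (r : ℕ) :
    IndepFun (fun ω (s : Fin r) => Matrix.of (J ω) *ᵥ v s)
      (fun ω => innov v (fun s => Matrix.of (J ω) *ᵥ v s) (w ω) r) P := by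
  have := hw.1.isProbabilityMeasure
  have key : IndepFun (fun ω (p : Fin r × Fin N) => (Matrix.of (J ω) *ᵥ v p.1) p.2)
      (fun ω i => innov v (fun s => Matrix.of (J ω) *ᵥ v s) (w ω) r i) P := by
    refine HasGaussianLaw.indepFun_of_covariance_eval
      (X := fun (p : Fin r × Fin N) ω => (Matrix.of (J ω) *ᵥ v p.1) p.2)
      (Y := fun i ω => innov v (fun s => Matrix.of (J ω) *ᵥ v s) (w ω) r i) ?_ ?_
    · refine HasGaussianLaw.comp_isLinearMap (hasGaussianLaw_pair hJ hw hJw)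
        (g := fun z => (fun (p : Fin r × Fin N) =>
          (Matrix.of (fun i j => z.1 (i, j)) *ᵥ v p.1) p.2,
          innov v (fun s => Matrix.of (fun i j => z.1 (i, j)) *ᵥ v s) z.2 r)) ⟨?_, ?_⟩
      · intro x y
        refine Prod.ext ?_ ((isLinearMap_innov v r).map_add x y)
        funext p
        simp [Matrix.mulVec, dotProduct, add_mul, Finset.sum_add_distrib]
      · intro c x
        refine Prod.ext ?_ ((isLinearMap_innov v r).map_smul c x)
        funext p
        simp [Matrix.mulVec, dotProduct, Finset.mul_sum, mul_assoc]
    · intro p i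
      have hxi := isCenteredGaussian_innov hJ hw hJw v r
      have hX : ∀ ω, (Matrix.of (J ω) *ᵥ v p.1) p.2
          = (Pi.single p.2 1 : Fin N → ℝ) ⬝ᵥ (Matrix.of (J ω) *ᵥ v p.1) := by intro ω; simp
      have hY : ∀ ω, innov v (fun s => Matrix.of (J ω) *ᵥ v s) (w ω) r i
          = (Pi.single i 1 : Fin N → ℝ) ⬝ᵥ innov v (fun s => Matrix.of (J ω) *ᵥ v s) (w ω) r := by
        intro ω; simp
      simp only [hX, hY]
      rw [covariance_eq_sub (hJ.memLp _ _) (hxi.memLp _), hJ.integral_dotProduct, zero_mul,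
        sub_zero]
      simp only [Pi.mul_apply]
      by_cases h : resid v r = 0
      · simp only [innov_of_resid_eq_zero _ _ _ h]
        exact integral_dotProduct_mul_noise hJ hw hJw _ _ _
      · simp only [dotProduct_innov _ v _ h, mul_add]
        have i1 : ∀ a b c d : Fin N → ℝ, Integrable (fun ω => (a ⬝ᵥ (Matrix.of (J ω) *ᵥ b))
            * (c ⬝ᵥ (Matrix.of (J ω) *ᵥ d))) P :=
          fun a b c d => (hJ.memLp a b).integrable_mul (hJ.memLp c d)
        have i2 : ∀ a b c : Fin N → ℝ, Integrable (fun ω => (a ⬝ᵥ (Matrix.of (J ω) *ᵥ b))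
            * (c ⬝ᵥ w ω)) P := fun a b c => (hJ.memLp a b).integrable_mul (hw.memLp c)
        rw [integral_add (i1 _ _ _ _) (i2 _ _ _), integral_dotProduct_mul_noise hJ hw hJw,
          hJ.integral_mul, add_zero]
        have h1 : v p.1 ⬝ᵥ residDir v r = 0 := by
          rw [dotProduct_comm]; exact residDir_dotProduct v p.1.2
        -- The reason for projecting off the past span: it kills the product created by the symmetry
        -- of J.
        have h2 : ∀ a, (a - pastProj v r *ᵥ a - (whiten * (a ⬝ᵥ residDir v r)) • residDir v r)
            ⬝ᵥ v p.1 = 0 := by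
          intro a
          rw [sub_dotProduct, sub_pastProj_dotProduct v p.1.2, smul_dotProduct,
            residDir_dotProduct v p.1.2]
          simp
        rw [h1, dotProduct_comm (v p.1), smul_dotProduct, h2]
        simp
  exact key.comp (φ := fun (y : Fin r × Fin N → ℝ) s i => y (s, i)) (ψ := id)
    (by fun_prop) measurable_id

end FixedDirections

/-! ### Decomposition along a random element with finite range -/

section FiniteRange

/-- No regularity of `g` in its first argument is required. Since spin histories have finite range,
this replaces any measurability statement about the pseudo-inverse. -/
theorem measurable_comp_of_finite_range {Ω H : Type*} {m : MeasurableSpace Ω}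
    {β : Type*} [MeasurableSpace β]
    {h : Ω → H} (hf : (Set.range h).Finite) (hm : ∀ b, MeasurableSet[m] (h ⁻¹' {b}))
    {g : H → Ω → β} (hg : ∀ b, Measurable[m] (g b)) : Measurable[m] (fun ω => g (h ω) ω) := by
  intro s hs
  have : (fun ω => g (h ω) ω) ⁻¹' s = ⋃ b ∈ hf.toFinset, (h ⁻¹' {b} ∩ g b ⁻¹' s) := by
    ext ω
    simp only [Set.mem_preimage, Set.mem_iUnion, Set.mem_inter_iff, Set.mem_singleton_iff,
      exists_prop, Set.Finite.mem_toFinset, Set.mem_range]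
    exact ⟨fun hω => ⟨h ω, ⟨ω, rfl⟩, rfl, hω⟩, fun ⟨b, _, hb, hω⟩ => by rwa [hb]⟩
  rw [this]
  exact Finset.measurableSet_biUnion _ fun b _ => (hm b).inter (hg b hs)

variable {Ω H : Type*} [MeasurableSpace Ω]

theorem measure_eq_sum_fiber (μ : Measure Ω) {h : Ω → H} (hf : (Set.range h).Finite)
    (hm : ∀ b, MeasurableSet (h ⁻¹' {b})) (E : Set Ω) :
    μ E = ∑ b ∈ hf.toFinset, μ (h ⁻¹' {b} ∩ E) := by
  have h1 := sum_measure_preimage_singleton (μ := μ.restrict E) (f := h) hf.toFinset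
    (fun b _ => hm b)
  have h2 : h ⁻¹' (hf.toFinset : Set H) = Set.univ := by
    ext ω; simp
  rw [h2, Measure.restrict_apply_univ] at h1
  rw [← h1]
  exact Finset.sum_congr rfl fun b _ => Measure.restrict_apply (hm b)

/-- If on each level set of `h` the pair `(Y, ξ)` coincides with an independent pair whose second
component has law `γ`, and the level set is determined by the first component, then `Y` and `ξ` are
independent and `ξ` has law `γ`. -/
theorem map_eq_and_indepFun_of_fibers {P : Measure Ω} [IsProbabilityMeasure P] {h : Ω → H}
    (hf : (Set.range h).Finite) (hm : ∀ b, MeasurableSet (h ⁻¹' {b}))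
    {𝒴 E : Type*} [MeasurableSpace 𝒴] [MeasurableSpace E]
    {Y : Ω → 𝒴} {ξ : Ω → E} (hξ : Measurable ξ) {γ : Measure E}
    (Y₀ : Ω → Ω → 𝒴) (ξ₀ : Ω → Ω → E) (hξ₀ : ∀ ω₀, Measurable (ξ₀ ω₀)) (B : Ω → Set 𝒴)
    (hB : ∀ ω₀, MeasurableSet (B ω₀))
    (hBY : ∀ ω₀ ω, h ω = h ω₀ ↔ Y₀ ω₀ ω ∈ B ω₀)
    (hY : ∀ ω₀ ω, h ω = h ω₀ → Y ω = Y₀ ω₀ ω)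
    (hξY : ∀ ω₀ ω, h ω = h ω₀ → ξ ω = ξ₀ ω₀ ω)
    (hind : ∀ ω₀, IndepFun (Y₀ ω₀) (ξ₀ ω₀) P) (hlaw : ∀ ω₀, P.map (ξ₀ ω₀) = γ) :
    P.map ξ = γ ∧ IndepFun Y ξ P := by
  have key : ∀ s t, MeasurableSet s → MeasurableSet t →
      P (Y ⁻¹' s ∩ ξ ⁻¹' t) = P (Y ⁻¹' s) * γ t := by
    intro s t hs ht
    rw [measure_eq_sum_fiber P hf hm (Y ⁻¹' s ∩ ξ ⁻¹' t), measure_eq_sum_fiber P hf hm (Y ⁻¹' s),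
      Finset.sum_mul]
    refine Finset.sum_congr rfl fun b hb => ?_
    obtain ⟨ω₀, rfl⟩ : b ∈ Set.range h := by simpa using hb
    -- On a level set the true pair may be replaced by the frozen one, and the level set is itself
    -- an event of the first frozen component, so independence of the frozen pair applies to the
    -- intersection.
    have e1 : h ⁻¹' {h ω₀} ∩ (Y ⁻¹' s ∩ ξ ⁻¹' t) = Y₀ ω₀ ⁻¹' (B ω₀ ∩ s) ∩ ξ₀ ω₀ ⁻¹' t := by
      ext ω
      simp only [Set.mem_inter_iff, Set.mem_preimage, Set.mem_singleton_iff, ← hBY]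
      constructor
      · rintro ⟨a, b, c⟩
        exact ⟨⟨a, hY ω₀ ω a ▸ b⟩, hξY ω₀ ω a ▸ c⟩
      · rintro ⟨⟨a, b⟩, c⟩
        exact ⟨a, (hY ω₀ ω a).symm ▸ b, (hξY ω₀ ω a).symm ▸ c⟩
    have e2 : h ⁻¹' {h ω₀} ∩ Y ⁻¹' s = Y₀ ω₀ ⁻¹' (B ω₀ ∩ s) := by
      ext ω
      simp only [Set.mem_inter_iff, Set.mem_preimage, Set.mem_singleton_iff, ← hBY]
      constructor
      · rintro ⟨a, b⟩
        exact ⟨a, hY ω₀ ω a ▸ b⟩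
      · rintro ⟨a, b⟩
        exact ⟨a, (hY ω₀ ω a).symm ▸ b⟩
    rw [e1, e2, (hind ω₀).measure_inter_preimage_eq_mul _ _ ((hB ω₀).inter hs) ht, ← hlaw ω₀,
      Measure.map_apply (hξ₀ ω₀) ht]
  have hlaw' : P.map ξ = γ := by
    ext t ht
    have := key Set.univ t MeasurableSet.univ ht
    rw [Measure.map_apply hξ ht]
    simpa using this
  refine ⟨hlaw', indepFun_iff_measure_inter_preimage_eq_mul.2 fun s t hs ht => ?_⟩
  rw [key s t hs ht, ← hlaw', Measure.map_apply hξ ht]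

/-- Bounds on the level sets of `h` add up. -/
theorem measure_le_of_fibers {P : Measure Ω} [IsProbabilityMeasure P] {h : Ω → H}
    (hf : (Set.range h).Finite) (hm : ∀ b, MeasurableSet (h ⁻¹' {b})) {E : Set Ω} {c : ENNReal}
    (hE : ∀ ω₀, P (h ⁻¹' {h ω₀} ∩ E) ≤ P (h ⁻¹' {h ω₀}) * c) : P E ≤ c := by
  rw [measure_eq_sum_fiber P hf hm E]
  calc ∑ b ∈ hf.toFinset, P (h ⁻¹' {b} ∩ E) ≤ ∑ b ∈ hf.toFinset, P (h ⁻¹' {b}) * c := by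
        refine Finset.sum_le_sum fun b hb => ?_
        obtain ⟨ω₀, rfl⟩ : b ∈ Set.range h := by simpa using hb
        exact hE ω₀
    _ = P Set.univ * c := by
        rw [← Finset.sum_mul, measure_eq_sum_fiber P hf hm Set.univ]
        simp
    _ = c := by simp

/-- The truncation matters: the whole infinite sequence need not have finite range. -/
theorem finite_range_trunc {Ω β : Type*} [Zero β] {f : ℕ → Ω → β}
    (hf : ∀ s, (Set.range (f s)).Finite) (r : ℕ) :
    (Set.range fun ω s => if s ≤ r then f s ω else 0).Finite := by
  have h1 : {g : Fin (r + 1) → β | ∀ s : Fin (r + 1), g s ∈ Set.range (f s)}.Finite :=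
    Set.Finite.pi' fun s => hf s
  refine (h1.image fun (g : Fin (r + 1) → β) (s : ℕ) =>
    if h : s < r + 1 then g ⟨s, h⟩ else 0).subset ?_
  rintro _ ⟨ω, rfl⟩
  refine ⟨fun s => f s ω, fun s => ⟨ω, rfl⟩, ?_⟩
  funext s
  simp

end FiniteRange

/-! ### Independence of nested pairs -/

section Assoc

variable {Ω : Type*} [MeasurableSpace Ω] {P : Measure Ω} [IsProbabilityMeasure P]
  {α β γ : Type*} [MeasurableSpace α] [MeasurableSpace β] [MeasurableSpace γ]
  {X : Ω → α} {Y : Ω → β} {Z : Ω → γ}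

/-- Associativity of the product of the three laws. -/
theorem indepFun_prodMk_left (hX : Measurable X) (hY : Measurable Y) (hZ : Measurable Z)
    (h : IndepFun X (fun ω => (Y ω, Z ω)) P) (hYZ : IndepFun Y Z P) :
    IndepFun (fun ω => (X ω, Y ω)) Z P := by
  have hXY : IndepFun X Y P := h.comp measurable_id measurable_fst
  rw [indepFun_iff_map_prod_eq_prod_map_map (by fun_prop) (by fun_prop)] at h hYZ hXY ⊢
  rw [hXY]
  have : (fun ω => ((X ω, Y ω), Z ω))
      = MeasurableEquiv.prodAssoc.symm ∘ (fun ω => (X ω, (Y ω, Z ω))) := rfl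
  rw [this, ← Measure.map_map (by fun_prop) (by fun_prop), h, hYZ]
  have : IsProbabilityMeasure (P.map X) := Measure.isProbabilityMeasure_map hX.aemeasurable
  have : IsProbabilityMeasure (P.map Y) := Measure.isProbabilityMeasure_map hY.aemeasurable
  have : IsProbabilityMeasure (P.map Z) := Measure.isProbabilityMeasure_map hZ.aemeasurable
  rw [← Measure.prodAssoc_prod, Measure.map_map (by fun_prop) (by fun_prop)]
  simp

/-- Induction on finite index sets by adding the largest index, whose variable is independent of
everything the earlier ones generate. -/
theorem iIndepFun_nat_of_past {ξ : ℕ → Ω → α}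
    (h : ∀ r, ∃ m : MeasurableSpace Ω, (∀ s < r, Measurable[m] (ξ s)) ∧
      Indep m (MeasurableSpace.comap (ξ r) inferInstance) P) : iIndepFun ξ P := by
  rw [iIndepFun_iff_measure_inter_preimage_eq_mul]
  intro S
  induction S using Finset.induction_on_max with
  | empty => simp
  | insert r S hS ih =>
    intro sets hsets
    obtain ⟨m, hm, hind⟩ := h r
    have hr : r ∉ S := fun hr => lt_irrefl _ (hS r hr)
    rw [Finset.prod_insert hr, Finset.set_biInter_insert, Set.inter_comm, mul_comm,
      ← ih fun i hi => hsets i (Finset.mem_insert_of_mem hi)]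
    rw [Indep_iff] at hind
    refine hind _ _ ?_ ⟨_, hsets r (Finset.mem_insert_self _ _), rfl⟩
    exact Finset.measurableSet_biInter _ fun i hi =>
      hm i (hS i hi) (hsets i (Finset.mem_insert_of_mem hi))

end Assoc

/-! ### Causal explorations of a GOE matrix -/

section InnovMeasurable

variable {N : ℕ}

theorem measurable_mulVec {α : Type*} [MeasurableSpace α] {ι κ : Type*} [Fintype κ]
    (A : Matrix ι κ ℝ) {f : α → κ → ℝ} (hf : Measurable f) : Measurable (fun x => A *ᵥ f x) := by
  refine measurable_pi_lambda _ fun i => ?_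
  simp only [Matrix.mulVec, dotProduct]
  fun_prop

theorem measurable_of_mulVec {α : Type*} [MeasurableSpace α]
    {M : α → Fin N → Fin N → ℝ} (hM : Measurable M) {f : α → Fin N → ℝ} (hf : Measurable f) :
    Measurable (fun x => Matrix.of (M x) *ᵥ f x) := by
  refine measurable_pi_lambda _ fun i => ?_
  simp only [Matrix.mulVec, dotProduct, Matrix.of_apply]
  fun_prop

theorem measurable_dotProduct {α : Type*} [MeasurableSpace α] {ι : Type*} [Fintype ι]
    {f g : α → ι → ℝ} (hf : Measurable f) (hg : Measurable g) :
    Measurable (fun x => f x ⬝ᵥ g x) := by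
  simp only [dotProduct]
  fun_prop

theorem measurable_dite_const {α β : Type*} {m : MeasurableSpace α} [MeasurableSpace β]
    {p : Prop} [Decidable p] {f : p → α → β} {g : α → β} (hf : ∀ h, Measurable[m] (f h))
    (hg : Measurable[m] g) : Measurable[m] (fun x => if h : p then f h x else g x) := by
  by_cases h : p
  · simpa only [h, dite_true] using hf h
  · simpa only [h, dite_false] using hg

theorem measurable_residImage {α : Type*} [MeasurableSpace α] (v : ℕ → Fin N → ℝ) (r : ℕ)
    {y : α → ℕ → Fin N → ℝ} (hy : ∀ s ≤ r, Measurable (fun x => y x s)) :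
    Measurable (fun x => residImage v (y x) r) := by
  unfold residImage
  refine (hy r le_rfl).sub (Finset.measurable_sum _ fun s _ => ?_)
  have := hy s s.2.le
  fun_prop

theorem measurable_innov {α : Type*} [MeasurableSpace α] (v : ℕ → Fin N → ℝ) (r : ℕ)
    {y : α → ℕ → Fin N → ℝ} (hy : ∀ s ≤ r, Measurable (fun x => y x s)) {w : α → Fin N → ℝ}
    (hw : Measurable w) : Measurable (fun x => innov v (y x) (w x) r) := by
  have h1 := measurable_residImage v r hy
  have h2 : Measurable (fun x => whiteImage v (y x) (w x) r) := by
    unfold whiteImage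
    by_cases h : resid v r = 0
    · simpa only [h, if_true] using hw
    · simp only [h, if_false]
      have h3 := measurable_dotProduct (measurable_const (a := residDir v r))
        (show Measurable (fun x => (residNorm v r)⁻¹ • residImage v (y x) r) by fun_prop)
      fun_prop
  unfold innov
  exact (h2.sub (measurable_mulVec _ h2)).add (measurable_mulVec _ hw)

theorem colMat_congr {v v' : ℕ → Fin N → ℝ} {r : ℕ} (h : ∀ s < r, v s = v' s) :
    colMat v r = colMat v' r := by
  ext i s
  simp [colMat, h s s.2]

theorem innov_congr {v v' y y' : ℕ → Fin N → ℝ} {w : Fin N → ℝ} {r : ℕ}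
    (hv : ∀ s ≤ r, v s = v' s) (hy : ∀ s ≤ r, y s = y' s) :
    innov v y w r = innov v' y' w r := by
  have h1 : colMat v r = colMat v' r := colMat_congr fun s hs => hv s hs.le
  have h2 : pastProj v r = pastProj v' r := by rw [pastProj, h1, pastProj]
  have h3 : resid v r = resid v' r := by rw [resid, h2, hv r le_rfl, resid]
  have h4 : residNorm v r = residNorm v' r := by rw [residNorm, h3, residNorm]
  have h5 : residDir v r = residDir v' r := by rw [residDir, h3, h4, residDir]
  have h6 : residImage v y r = residImage v' y' r := by
    rw [residImage, residImage, h1, hv r le_rfl, hy r le_rfl]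
    congr 1
    exact Finset.sum_congr rfl fun s _ => by rw [hy s s.2.le]
  have h7 : whiteImage v y w r = whiteImage v' y' w r := by
    rw [whiteImage, whiteImage, h3, h4, h5, h6]
  rw [innov, innov, h2, h7]

end InnovMeasurable

/-- A sequence of vectors `v 0, v 1, …` with finite range, each chosen as a function of independent
auxiliary randomness `A` and of the images of the earlier ones under a GOE matrix `J`, together
with independent auxiliary noise vectors `w`. -/
structure Exploration (N : ℕ) (𝒰 : Type*) [MeasurableSpace 𝒰] {Ω : Type*} [MeasurableSpace Ω]
    (P : Measure Ω) where
  J : Ω → Fin N → Fin N → ℝ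
  A : Ω → 𝒰
  w : ℕ → Ω → Fin N → ℝ
  v : ℕ → Ω → Fin N → ℝ
  rule : ℕ → 𝒰 → (ℕ → Fin N → ℝ) → Fin N → ℝ
  measurable_J : Measurable J
  measurable_A : Measurable A
  measurable_w : ∀ r, Measurable (w r)
  measurable_rule : ∀ r, Measurable (fun p : 𝒰 × (ℕ → Fin N → ℝ) => rule r p.1 p.2)
  rule_congr : ∀ r a y y', (∀ s < r, y s = y' s) → rule r a y = rule r a y'
  v_eq : ∀ r ω, v r ω = rule r (A ω) (fun s => Matrix.of (J ω) *ᵥ v s ω)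
  finite_v : ∀ r, (Set.range (v r)).Finite
  goe_J : IsGOE J P
  gaussian_w : ∀ r, IsCenteredGaussian (w r) (1 : Matrix (Fin N) (Fin N) ℝ) P
  indep_w : iIndepFun w P
  indep_A_J : IndepFun A J P
  indep_A_J_w : IndepFun (fun ω => (A ω, J ω)) (fun ω r => w r ω) P

namespace Exploration

variable {N : ℕ} {𝒰 : Type*} [MeasurableSpace 𝒰] {Ω : Type*} [MeasurableSpace Ω]
  {P : Measure Ω} (E : Exploration N 𝒰 P)

/-- The image `J v r`. -/
def y (r : ℕ) (ω : Ω) : Fin N → ℝ := Matrix.of (E.J ω) *ᵥ E.v r ω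

/-- The sequence `v` at the sample point `ω`. -/
def vs (ω : Ω) : ℕ → Fin N → ℝ := fun s => E.v s ω

/-- The innovation vectors of the exploration. -/
def xi (r : ℕ) (ω : Ω) : Fin N → ℝ := innov (E.vs ω) (fun s => E.y s ω) (E.w r ω) r

/-- The history `v 0, …, v r`, continued by zero. -/
def hist (r : ℕ) (ω : Ω) : ℕ → Fin N → ℝ := fun s => if s ≤ r then E.v s ω else 0

/-- Everything known before `J v r` is revealed. -/
def past (r : ℕ) (ω : Ω) : (𝒰 × (Fin r → Fin N → ℝ)) × (Fin r → Fin N → ℝ) :=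
  ((E.A ω, fun s => E.w s ω), fun s => E.y s ω)

theorem measurable_v (r : ℕ) : Measurable (E.v r) := by
  induction r using Nat.strong_induction_on with
  | _ r ih =>
    have h : E.v r = fun ω => E.rule r (E.A ω)
        (fun s => if s < r then Matrix.of (E.J ω) *ᵥ E.v s ω else 0) := by
      funext ω
      rw [E.v_eq]
      exact E.rule_congr _ _ _ _ fun s hs => by simp [hs]
    rw [h]
    refine (E.measurable_rule r).comp (E.measurable_A.prodMk (measurable_pi_lambda _ fun s => ?_))
    exact measurable_dite_const (fun hs => measurable_of_mulVec E.measurable_J (ih s hs))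
      measurable_const

theorem measurable_y (r : ℕ) : Measurable (E.y r) :=
  measurable_of_mulVec E.measurable_J (E.measurable_v r)

theorem measurable_hist (r : ℕ) : Measurable (E.hist r) := by
  exact measurable_pi_lambda _ fun s =>
    measurable_dite_const (fun _ => E.measurable_v s) measurable_const

theorem finite_hist (r : ℕ) : (Set.range (E.hist r)).Finite := finite_range_trunc E.finite_v r

theorem measurableSet_hist (r : ℕ) (b : ℕ → Fin N → ℝ) :
    MeasurableSet (E.hist r ⁻¹' {b}) := E.measurable_hist r (measurableSet_singleton b)

theorem hist_eq_iff (r : ℕ) (ω ω₀ : Ω) :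
    E.hist r ω = E.hist r ω₀ ↔ ∀ s ≤ r, E.v s ω = E.v s ω₀ := by
  constructor
  · intro h s hs
    have := congrFun h s
    simpa [hist, hs] using this
  · intro h
    funext s
    by_cases hs : s ≤ r
    · simp [hist, hs, h s hs]
    · simp [hist, hs]

/-- Following a fixed history is an event about the auxiliary randomness and the images of the
fixed vectors. -/
theorem hist_eq_iff_rule (r : ℕ) (ω ω₀ : Ω) :
    E.hist r ω = E.hist r ω₀ ↔
      ∀ s ≤ r, E.rule s (E.A ω) (fun q => Matrix.of (E.J ω) *ᵥ E.v q ω₀) = E.v s ω₀ := by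
  rw [hist_eq_iff]
  constructor
  · intro h s hs
    rw [← h s hs, E.v_eq s ω]
    exact E.rule_congr _ _ _ _ fun q hq => by rw [h q (hq.le.trans hs)]
  · intro h s
    induction s using Nat.strong_induction_on with
    | _ s ih =>
      intro hs
      rw [← h s hs, E.v_eq s ω]
      exact E.rule_congr _ _ _ _ fun q hq => by rw [ih q hq (hq.le.trans hs)]

theorem indep_J_w (r : ℕ) : IndepFun E.J (E.w r) P :=
  E.indep_A_J_w.comp (φ := Prod.snd) (ψ := fun z : ℕ → Fin N → ℝ => z r) measurable_snd
    (by fun_prop)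

theorem measurable_xi (r : ℕ) : Measurable (E.xi r) := by
  have h : E.xi r = fun ω => innov (E.hist r ω) (fun s => E.y s ω) (E.w r ω) r := by
    funext ω
    exact innov_congr (fun s hs => by simp [vs, hist, hs]) fun _ _ => rfl
  rw [h]
  exact measurable_comp_of_finite_range (E.finite_hist r) (E.measurableSet_hist r)
    (g := fun b ω => innov b (fun s => E.y s ω) (E.w r ω) r)
    fun b => measurable_innov b r (fun s _ => E.measurable_y s) (E.measurable_w r)

/-- The rule evaluated on the past. -/
def pastV (r s : ℕ) (z : (𝒰 × (Fin r → Fin N → ℝ)) × (Fin r → Fin N → ℝ)) : Fin N → ℝ :=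
  E.rule s z.1.1 (fun q => if h : q < r then z.2 ⟨q, h⟩ else 0)

theorem measurable_pastV (r s : ℕ) : Measurable (E.pastV r s) := by
  refine (E.measurable_rule s).comp ((measurable_fst.comp measurable_fst).prodMk
    (measurable_pi_lambda _ fun q => ?_))
  exact measurable_dite_const (fun hq => (measurable_pi_apply _).comp measurable_snd)
    measurable_const

theorem pastV_past {r s : ℕ} (hs : s ≤ r) (ω : Ω) : E.pastV r s (E.past r ω) = E.v s ω := by
  rw [E.v_eq, pastV]
  exact E.rule_congr _ _ _ _ fun q hq => by simp [hq.trans_le hs, past, y]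

theorem measurable_hist_past {r s : ℕ} (hs : s ≤ r) :
    Measurable[MeasurableSpace.comap (E.past r) inferInstance] (E.hist s) := by
  have h : E.hist s = (fun z q => if q ≤ s then E.pastV r q z else 0) ∘ E.past r := by
    funext ω q
    by_cases hq : q ≤ s
    · simp [hist, hq, E.pastV_past (hq.trans hs)]
    · simp [hist, hq]
  rw [h]
  refine Measurable.comp ?_ (comap_measurable _)
  exact measurable_pi_lambda _ fun q =>
    measurable_dite_const (fun _ => E.measurable_pastV r q) measurable_const

theorem measurable_y_past {r s : ℕ} (hs : s < r) :
    Measurable[MeasurableSpace.comap (E.past r) inferInstance] (E.y s) :=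
  Measurable.comp (g := fun z : (𝒰 × (Fin r → Fin N → ℝ)) × (Fin r → Fin N → ℝ) => z.2 ⟨s, hs⟩)
    (by fun_prop) (comap_measurable (E.past r))

theorem measurable_w_past {r s : ℕ} (hs : s < r) :
    Measurable[MeasurableSpace.comap (E.past r) inferInstance] (E.w s) :=
  Measurable.comp (g := fun z : (𝒰 × (Fin r → Fin N → ℝ)) × (Fin r → Fin N → ℝ) => z.1.2 ⟨s, hs⟩)
    (by fun_prop) (comap_measurable (E.past r))

theorem measurable_xi_past {r s : ℕ} (hs : s < r) :
    Measurable[MeasurableSpace.comap (E.past r) inferInstance] (E.xi s) := by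
  have h : E.xi s = fun ω => innov (E.hist s ω) (fun q => E.y q ω) (E.w s ω) s := by
    funext ω
    exact innov_congr (fun q hq => by simp [vs, hist, hq]) fun _ _ => rfl
  rw [h]
  refine measurable_comp_of_finite_range (E.finite_hist s)
    (fun b => E.measurable_hist_past hs.le (measurableSet_singleton b))
    (g := fun b ω => innov b (fun q => E.y q ω) (E.w s ω) s) fun b => ?_
  exact @measurable_innov _ _ (MeasurableSpace.comap (E.past r) inferInstance) b s _
    (fun q hq => E.measurable_y_past (hq.trans_lt hs)) _ (E.measurable_w_past hs)

variable [IsProbabilityMeasure P]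

theorem indep_A_past_noise (r : ℕ) :
    IndepFun (fun ω => (E.A ω, fun s : Fin r => E.w s ω)) (fun ω => (E.J ω, E.w r ω)) P := by
  have hwm : Measurable (fun ω (s : Fin r) => E.w s ω) :=
    measurable_pi_lambda _ fun s => E.measurable_w s
  have hwm' : Measurable (fun ω (s : ℕ) => E.w s ω) :=
    measurable_pi_lambda _ fun s => E.measurable_w s
  have hww : IndepFun (E.w r) (fun ω (s : Fin r) => E.w s ω) P := by
    have := E.indep_w.indepFun_finset {r} (Finset.range r) (by simp) E.measurable_w
    exact this.comp (φ := fun f : ({r} : Finset ℕ) → Fin N → ℝ => f ⟨r, by simp⟩)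
      (ψ := fun (f : Finset.range r → Fin N → ℝ) (s : Fin r) => f ⟨s, by simp⟩)
      (by fun_prop) (by fun_prop)
  have h1 : IndepFun (fun ω r => E.w r ω) (fun ω => (E.J ω, E.A ω)) P :=
    (E.indep_A_J_w.comp measurable_swap measurable_id).symm
  have h2 := (indepFun_prodMk_left hwm' E.measurable_J E.measurable_A h1 E.indep_A_J.symm).symm
  have h3 : IndepFun E.A (fun ω => ((fun s : Fin r => E.w s ω), (E.J ω, E.w r ω))) P :=
    h2.comp (φ := id) (ψ := fun z : (ℕ → Fin N → ℝ) × (Fin N → Fin N → ℝ) =>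
      ((fun s : Fin r => z.1 s), (z.2, z.1 r))) measurable_id (by fun_prop)
  have h4 : IndepFun E.J (fun ω => (E.w r ω, fun s : Fin r => E.w s ω)) P :=
    E.indep_A_J_w.comp (φ := Prod.snd)
      (ψ := fun z : ℕ → Fin N → ℝ => (z r, fun s : Fin r => z s)) measurable_snd (by fun_prop)
  have h5 := (indepFun_prodMk_left E.measurable_J (E.measurable_w r) hwm h4 hww).symm
  exact indepFun_prodMk_left E.measurable_A hwm
    (E.measurable_J.prodMk (E.measurable_w r)) h3 h5

/-- Independence for the exploration along fixed vectors. -/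
theorem indep_fixed (r : ℕ) (v : ℕ → Fin N → ℝ) :
    IndepFun (fun ω => ((E.A ω, fun s : Fin r => E.w s ω),
        fun s : Fin r => Matrix.of (E.J ω) *ᵥ v s))
      (fun ω => innov v (fun s => Matrix.of (E.J ω) *ᵥ v s) (E.w r ω) r) P := by
  have hJv : ∀ s, Measurable (fun z : (Fin N → Fin N → ℝ) × (Fin N → ℝ) =>
      Matrix.of z.1 *ᵥ v s) := fun s => measurable_of_mulVec measurable_fst measurable_const
  have hJv' : ∀ s, Measurable (fun ω => Matrix.of (E.J ω) *ᵥ v s) :=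
    fun s => measurable_of_mulVec E.measurable_J measurable_const
  refine indepFun_prodMk_left (E.measurable_A.prodMk
    (measurable_pi_lambda _ fun s => E.measurable_w s)) (measurable_pi_lambda _ fun s => hJv' s)
    (measurable_innov _ _ (fun s _ => hJv' s) (E.measurable_w r)) ?_
    (indepFun_innov E.goe_J (E.gaussian_w r) (E.indep_J_w r) v r)
  have h1 : Measurable (fun z : (Fin N → Fin N → ℝ) × (Fin N → ℝ) =>
      fun s : Fin r => Matrix.of z.1 *ᵥ v s) := measurable_pi_lambda _ fun s => hJv s
  have h2 : Measurable (fun z : (Fin N → Fin N → ℝ) × (Fin N → ℝ) =>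
      innov v (fun s => Matrix.of z.1 *ᵥ v s) z.2 r) :=
    measurable_innov v r (fun s _ => hJv s) measurable_snd
  exact (E.indep_A_past_noise r).comp measurable_id (h1.prodMk h2)

/-- Innovations are standard Gaussian and independent of the past. -/
theorem xi_spec (r : ℕ) :
    IsCenteredGaussian (E.xi r) (1 : Matrix (Fin N) (Fin N) ℝ) P ∧
      IndepFun (E.past r) (E.xi r) P := by
  have hJv : ∀ (v : ℕ → Fin N → ℝ) s, Measurable (fun ω => Matrix.of (E.J ω) *ᵥ v s) :=
    fun v s => measurable_of_mulVec E.measurable_J measurable_const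
  -- The level sets are those of the history v 0, …, v r. The frozen pair is the exploration along
  -- the fixed vectors read off at ω₀, and whether that history is followed is decided by the frozen
  -- past through `pastV`.
  have h := map_eq_and_indepFun_of_fibers (P := P) (E.finite_hist r) (E.measurableSet_hist r)
    (Y := E.past r) (E.measurable_xi r) (γ := P.map (E.w r))
    (fun ω₀ ω => ((E.A ω, fun s : Fin r => E.w s ω),
        fun s : Fin r => Matrix.of (E.J ω) *ᵥ E.vs ω₀ s))
    (fun ω₀ ω => innov (E.vs ω₀) (fun s => Matrix.of (E.J ω) *ᵥ E.vs ω₀ s) (E.w r ω) r)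
    (fun ω₀ => measurable_innov _ _ (fun s _ => hJv _ s) (E.measurable_w r))
    (fun ω₀ => {z | ∀ s ≤ r, E.pastV r s z = E.v s ω₀}) ?_ ?_ ?_ ?_ (fun ω₀ => E.indep_fixed r _) ?_
  · exact ⟨(E.gaussian_w r).of_map_eq (E.measurable_xi r).aemeasurable h.1, h.2⟩
  · intro ω₀
    have : {z | ∀ s ≤ r, E.pastV r s z = E.v s ω₀}
        = ⋂ s ∈ Finset.range (r + 1), {z | E.pastV r s z = E.v s ω₀} := by
      ext z; simp
    rw [this]
    exact Finset.measurableSet_biInter _ fun s _ =>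
      measurableSet_eq_fun (E.measurable_pastV r s) measurable_const
  · intro ω₀ ω
    rw [E.hist_eq_iff_rule]
    simp only [Set.mem_ofPred_eq, pastV]
    refine forall₂_congr fun s hs => ?_
    rw [E.rule_congr s _ (fun q => Matrix.of (E.J ω) *ᵥ E.v q ω₀)
      (fun q => if h : q < r then Matrix.of (E.J ω) *ᵥ E.vs ω₀ q else 0)
      fun q hq => by simp [hq.trans_le hs, vs]]
  · intro ω₀ ω h
    rw [hist_eq_iff] at h
    simp only [past, y, vs]
    congr 1
    funext s
    rw [h s s.2.le]
  · intro ω₀ ω h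
    rw [hist_eq_iff] at h
    exact innov_congr (fun s hs => h s hs) fun s hs => by simp only [y, vs, h s hs]
  · intro ω₀
    exact (isCenteredGaussian_innov E.goe_J (E.gaussian_w r) (E.indep_J_w r) _ r).map_eq
      (E.gaussian_w r)

theorem iIndepFun_xi : iIndepFun E.xi P :=
  iIndepFun_nat_of_past fun r => ⟨MeasurableSpace.comap (E.past r) inferInstance,
    fun _ hs => E.measurable_xi_past hs, (IndepFun_iff_Indep _ _ _).1 (E.xi_spec r).2⟩

end Exploration

/-! ### Euclidean norms and operator bounds on explored subspaces -/

section Norm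

variable {ι : Type*} [Fintype ι]

/-- The Euclidean norm of a vector. -/
def nrm (x : ι → ℝ) : ℝ := ‖(WithLp.toLp 2 x : EuclideanSpace ℝ ι)‖

theorem nrm_nonneg (x : ι → ℝ) : 0 ≤ nrm x := norm_nonneg _

theorem nrm_sq (x : ι → ℝ) : nrm x ^ 2 = x ⬝ᵥ x := by
  rw [nrm, EuclideanSpace.real_norm_sq_eq]
  simp [dotProduct, pow_two]

theorem nrm_add_le (x y : ι → ℝ) : nrm (x + y) ≤ nrm x + nrm y := by
  simpa [nrm] using norm_add_le (WithLp.toLp 2 x : EuclideanSpace ℝ ι) (WithLp.toLp 2 y)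

theorem nrm_smul (c : ℝ) (x : ι → ℝ) : nrm (c • x) = |c| * nrm x := by
  simpa [nrm] using norm_smul c (WithLp.toLp 2 x : EuclideanSpace ℝ ι)

theorem nrm_eq_sqrt (x : ι → ℝ) : nrm x = Real.sqrt (x ⬝ᵥ x) := by
  rw [← nrm_sq, Real.sqrt_sq (nrm_nonneg x)]

theorem abs_dotProduct_le (x y : ι → ℝ) : |x ⬝ᵥ y| ≤ nrm x * nrm y := by
  have := abs_real_inner_le_norm (WithLp.toLp 2 y : EuclideanSpace ℝ ι) (WithLp.toLp 2 x)
  rw [EuclideanSpace.inner_toLp_toLp] at this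
  simpa [nrm, mul_comm] using this

theorem abs_apply_le_nrm (x : ι → ℝ) (i : ι) : |x i| ≤ nrm x := by
  have h : x i ^ 2 ≤ nrm x ^ 2 := by
    rw [nrm_sq, dotProduct]
    have := Finset.single_le_sum (f := fun i => x i * x i) (fun i _ => mul_self_nonneg (x i))
      (Finset.mem_univ i)
    simpa [pow_two] using this
  exact abs_le_of_sq_le_sq h (nrm_nonneg x)

end Norm

section OpBound

variable {N : ℕ}

theorem residNorm_eq_nrm (v : ℕ → Fin N → ℝ) (r : ℕ) : residNorm v r = nrm (resid v r) := by
  rw [nrm_eq_sqrt, residNorm]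

theorem nrm_residDir_le (v : ℕ → Fin N → ℝ) (r : ℕ) : nrm (residDir v r) ≤ 1 := by
  rw [residDir, nrm_smul, residNorm_eq_nrm, abs_of_nonneg (inv_nonneg.2 (nrm_nonneg _))]
  exact inv_mul_le_one

theorem nrm_sub_pastProj_le (v : ℕ → Fin N → ℝ) (r : ℕ) (x : Fin N → ℝ) :
    nrm (x - pastProj v r *ᵥ x) ≤ nrm x := by
  refine abs_le_of_sq_le_sq' ?_ (nrm_nonneg x) |>.2
  rw [nrm_sq, nrm_sq]
  have h1 : (pastProj v r *ᵥ x) ⬝ᵥ (x - pastProj v r *ᵥ x) = 0 := by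
    rw [← dotProduct_pastProj, pastProj_sub_pastProj, dotProduct_zero]
  have h2 := dotProduct_self_nonneg' (pastProj v r *ᵥ x)
  simp only [dotProduct_sub, sub_dotProduct] at h1 ⊢
  have h3 := dotProduct_comm x (pastProj v r *ᵥ x)
  linarith

theorem pastProj_mulVec_mem_span (v : ℕ → Fin N → ℝ) (r : ℕ) (x : Fin N → ℝ) :
    pastProj v r *ᵥ x ∈ Submodule.span ℝ (v '' Set.Iio r) := by
  rw [pastProj_mulVec_eq_sum]
  exact Submodule.sum_mem _ fun s _ => Submodule.smul_mem _ _
    (Submodule.subset_span ⟨s, s.2, rfl⟩)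

theorem dotProduct_eq_zero_of_mem_span {v : ℕ → Fin N → ℝ} {r : ℕ} {x z : Fin N → ℝ}
    (hx : ∀ s < r, x ⬝ᵥ v s = 0) (hz : z ∈ Submodule.span ℝ (v '' Set.Iio r)) : x ⬝ᵥ z = 0 := by
  induction hz using Submodule.span_induction with
  | mem z hz => obtain ⟨s, hs, rfl⟩ := hz; exact hx s hs
  | zero => exact dotProduct_zero _
  | add a b _ _ ha hb => rw [dotProduct_add, ha, hb, add_zero]
  | smul c a _ ha => rw [dotProduct_smul, ha, smul_zero]

/-- `A` is bounded by `L` on the span of `v 0, …, v (r - 1)`. -/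
def OpBound (A : Matrix (Fin N) (Fin N) ℝ) (v : ℕ → Fin N → ℝ) (L : ℝ) (r : ℕ) : Prop :=
  ∀ z ∈ Submodule.span ℝ (v '' Set.Iio r), nrm (A *ᵥ z) ≤ L * nrm z

/-- Let f be the residual of v r and Π the past projection. By symmetry |Π A f|² = ⟨A Π A f, f⟩, so
the old bound gives |Π A f| ≤ L |f|. The complementary part of A f is expressed through the
innovation and is at most 2 K |f|. Adding the old bound on the old span gives (L + 2 K) + L. -/
theorem OpBound.succ {A : Matrix (Fin N) (Fin N) ℝ} (hA : Aᵀ = A) {v : ℕ → Fin N → ℝ} {L : ℝ}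
    (hL : 0 ≤ L) {r : ℕ} (h : OpBound A v L r) (w : Fin N → ℝ) {K : ℝ}
    (hK : nrm (innov v (fun s => A *ᵥ v s) w r) ≤ K * Real.sqrt N) (hN : 0 < N) :
    OpBound A v (2 * L + 2 * K) (r + 1) := by
  have hN' : 0 < Real.sqrt N := by positivity
  set ξ := innov v (fun s => A *ᵥ v s) w r with hξ
  set f := resid v r with hf
  set P := pastProj v r with hP
  have hK0 : 0 ≤ K := by
    by_contra hK0
    have := nrm_nonneg ξ
    nlinarith
  -- the image of the residual
  have h1 : nrm (P *ᵥ (A *ᵥ f)) ≤ L * nrm f := by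
    have h2 : nrm (P *ᵥ (A *ᵥ f)) ^ 2 ≤ L * nrm (P *ᵥ (A *ᵥ f)) * nrm f := by
      have e : nrm (P *ᵥ (A *ᵥ f)) ^ 2 = (A *ᵥ (P *ᵥ (A *ᵥ f))) ⬝ᵥ f := by
        rw [nrm_sq, dotProduct_pastProj, pastProj_mulVec_self, dotProduct_mulVec_of_symm hA]
      rw [e]
      calc _ ≤ |(A *ᵥ (P *ᵥ (A *ᵥ f))) ⬝ᵥ f| := le_abs_self _
        _ ≤ nrm (A *ᵥ (P *ᵥ (A *ᵥ f))) * nrm f := abs_dotProduct_le _ _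
        _ ≤ _ := mul_le_mul_of_nonneg_right (h _ (pastProj_mulVec_mem_span _ _ _)) (nrm_nonneg _)
    rcases (nrm_nonneg (P *ᵥ (A *ᵥ f))).eq_or_lt with h0 | h0
    · rw [← h0]; exact mul_nonneg hL (nrm_nonneg _)
    · nlinarith
  have h3 : nrm (A *ᵥ f - P *ᵥ (A *ᵥ f)) ≤ 2 * K * nrm f := by
    rw [mulVec_resid_eq_innov A v w r hN]
    refine (nrm_add_le _ _).trans ?_
    rw [nrm_smul, nrm_smul, ← hξ, ← hf, ← hP, residNorm_eq_nrm, ← hf, abs_mul,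
      abs_of_nonneg (div_nonneg (nrm_nonneg f) hN'.le)]
    have h4 : |(Real.sqrt 2 - 1) / Real.sqrt N| ≤ 1 / Real.sqrt N := by
      have h5 : 1 ≤ Real.sqrt 2 := Real.one_le_sqrt.2 (by norm_num)
      have h6 : Real.sqrt 2 ≤ 2 := Real.sqrt_le_iff.2 ⟨by norm_num, by norm_num⟩
      rw [abs_of_nonneg (div_nonneg (by linarith) hN'.le)]
      exact div_le_div_of_nonneg_right (by linarith) hN'.le
    have h5 : |residDir v r ⬝ᵥ ξ| ≤ K * Real.sqrt N := by
      calc _ ≤ nrm (residDir v r) * nrm ξ := abs_dotProduct_le _ _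
        _ ≤ 1 * nrm ξ := mul_le_mul_of_nonneg_right (nrm_residDir_le v r) (nrm_nonneg _)
        _ ≤ _ := by linarith
    have h6 : nrm f / Real.sqrt N * nrm (ξ - P *ᵥ ξ) ≤ K * nrm f := by
      calc _ ≤ nrm f / Real.sqrt N * (K * Real.sqrt N) :=
            mul_le_mul_of_nonneg_left ((nrm_sub_pastProj_le v r ξ).trans hK)
              (div_nonneg (nrm_nonneg f) hN'.le)
        _ = _ := by field_simp
    have h7 : |(Real.sqrt 2 - 1) / Real.sqrt N| * |residDir v r ⬝ᵥ ξ| ≤ K := by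
      calc _ ≤ 1 / Real.sqrt N * (K * Real.sqrt N) :=
            mul_le_mul h4 h5 (abs_nonneg _) (by positivity)
        _ = K := by field_simp
    have h8 := mul_le_mul_of_nonneg_right h7 (nrm_nonneg f)
    linarith
  have h4 : nrm (A *ᵥ f) ≤ (L + 2 * K) * nrm f := by
    have : A *ᵥ f = P *ᵥ (A *ᵥ f) + (A *ᵥ f - P *ᵥ (A *ᵥ f)) := by abel
    rw [this]
    have := nrm_add_le (P *ᵥ (A *ᵥ f)) (A *ᵥ f - P *ᵥ (A *ᵥ f))
    linarith
  intro z hz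
  have hI : v '' Set.Iio (r + 1) = insert (v r) (v '' Set.Iio r) := by
    rw [← Set.image_insert_eq]
    congr 1
    ext s
    simp only [Set.mem_Iio, Set.mem_insert_iff]
    omega
  rw [hI, Submodule.mem_span_insert] at hz
  obtain ⟨c, y, hy, rfl⟩ := hz
  -- Any vector of the enlarged span is c f plus a vector of the old span, and these two are
  -- orthogonal.
  set y' := c • (P *ᵥ v r) + y with hy'
  have hz : c • v r + y = c • f + y' := by
    rw [hf, resid, smul_sub, hy']; abel
  have hy'' : y' ∈ Submodule.span ℝ (v '' Set.Iio r) :=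
    Submodule.add_mem _ (Submodule.smul_mem _ _ (pastProj_mulVec_mem_span _ _ _)) hy
  have horth : f ⬝ᵥ y' = 0 :=
    dotProduct_eq_zero_of_mem_span (fun s hs => resid_dotProduct v hs) hy''
  rw [hz]
  have hpy : nrm (c • f + y') ^ 2 = nrm (c • f) ^ 2 + nrm y' ^ 2 := by
    clear_value y'
    have h5 : y' ⬝ᵥ f = 0 := by rw [dotProduct_comm, horth]
    simp only [nrm_sq, dotProduct_add, add_dotProduct, smul_dotProduct, dotProduct_smul, horth, h5]
    simp
  have n1 : nrm (c • f) ≤ nrm (c • f + y') :=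
    (abs_le_of_sq_le_sq' (by nlinarith [sq_nonneg (nrm y')]) (nrm_nonneg _)).2
  have n2 : nrm y' ≤ nrm (c • f + y') :=
    (abs_le_of_sq_le_sq' (by nlinarith [sq_nonneg (nrm (c • f))]) (nrm_nonneg _)).2
  rw [Matrix.mulVec_add, Matrix.mulVec_smul]
  calc nrm (c • A *ᵥ f + A *ᵥ y') ≤ nrm (c • A *ᵥ f) + nrm (A *ᵥ y') := nrm_add_le _ _
    _ ≤ (L + 2 * K) * nrm (c • f) + L * nrm y' := by
        refine add_le_add ?_ (h _ hy'')
        rw [nrm_smul, nrm_smul]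
        nlinarith [abs_nonneg c, mul_le_mul_of_nonneg_left h4 (abs_nonneg c)]
    _ ≤ (L + 2 * K) * nrm (c • f + y') + L * nrm (c • f + y') :=
        add_le_add (mul_le_mul_of_nonneg_left n1 (by linarith))
          (mul_le_mul_of_nonneg_left n2 hL)
    _ = _ := by ring

end OpBound

/-! ### Second moments of innovations -/

section Moments

variable {Ω : Type*} [MeasurableSpace Ω] {P : Measure Ω} {N : ℕ}

/-- Condition on X: a fixed functional x of a standard Gaussian vector has variance |x|². Lower
integrals avoid any integrability hypothesis on X. -/
theorem lintegral_sq_dotProduct [IsProbabilityMeasure P] {X ξ : Ω → Fin N → ℝ}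
    (hX : Measurable X) (hξ : Measurable ξ)
    (hg : IsCenteredGaussian ξ (1 : Matrix (Fin N) (Fin N) ℝ) P) (h : IndepFun X ξ P) :
    ∫⁻ ω, ENNReal.ofReal ((X ω ⬝ᵥ ξ ω) ^ 2) ∂P = ∫⁻ ω, ENNReal.ofReal (X ω ⬝ᵥ X ω) ∂P := by
  have : IsProbabilityMeasure (P.map X) := Measure.isProbabilityMeasure_map hX.aemeasurable
  have : IsProbabilityMeasure (P.map ξ) := Measure.isProbabilityMeasure_map hξ.aemeasurable
  have hm : Measurable (fun z : (Fin N → ℝ) × (Fin N → ℝ) =>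
      ENNReal.ofReal ((z.1 ⬝ᵥ z.2) ^ 2)) :=
    ((measurable_dotProduct measurable_fst measurable_snd).pow_const 2).ennreal_ofReal
  rw [indepFun_iff_map_prod_eq_prod_map_map hX.aemeasurable hξ.aemeasurable] at h
  have h1 : ∫⁻ ω, ENNReal.ofReal ((X ω ⬝ᵥ ξ ω) ^ 2) ∂P
      = ∫⁻ z, ENNReal.ofReal ((z.1 ⬝ᵥ z.2) ^ 2) ∂(P.map (fun ω => (X ω, ξ ω))) :=
    (lintegral_map hm (hX.prodMk hξ)).symm
  have hm' : Measurable (fun x : Fin N → ℝ => ENNReal.ofReal (x ⬝ᵥ x)) :=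
    (measurable_dotProduct measurable_id measurable_id).ennreal_ofReal
  rw [h1, h, lintegral_prod _ hm.aemeasurable, ← lintegral_map hm' hX]
  refine lintegral_congr fun x => ?_
  rw [lintegral_map (f := fun z => ENNReal.ofReal ((x ⬝ᵥ z) ^ 2))
    (((measurable_dotProduct measurable_const measurable_id).pow_const 2).ennreal_ofReal) hξ,
    ← ofReal_integral_eq_lintegral_ofReal (hg.memLp x).integrable_sq
      (Filter.Eventually.of_forall fun ω => sq_nonneg _)]
  congr 1
  have := hg.integral_mul_one x x
  simpa only [pow_two] using this

theorem lintegral_dotProduct_self {ξ : Ω → Fin N → ℝ}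
    (hg : IsCenteredGaussian ξ (1 : Matrix (Fin N) (Fin N) ℝ) P) :
    ∫⁻ ω, ENNReal.ofReal (ξ ω ⬝ᵥ ξ ω) ∂P = N := by
  have hi : ∀ i, Integrable (fun ω => ξ ω i * ξ ω i) P := fun i => by
    have := hg.memLp (Pi.single i 1)
    simp only [single_one_dotProduct] at this
    exact this.integrable_mul this
  have hi' : Integrable (fun ω => ξ ω ⬝ᵥ ξ ω) P := by
    simp only [dotProduct]
    exact integrable_finsetSum _ fun i _ => hi i
  rw [← ofReal_integral_eq_lintegral_ofReal hi'
      (Filter.Eventually.of_forall fun ω => dotProduct_self_nonneg' _)]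
  simp only [dotProduct]
  rw [integral_finsetSum _ fun i _ => hi i]
  simp [hg.2.2]

/-- Markov's inequality for a real random variable, in terms of its second moment. -/
theorem measure_sq_ge_le {f : Ω → ℝ} (hf : Measurable f) {a : ℝ} (ha : 0 < a) :
    P {ω | a ≤ f ω} ≤ (∫⁻ ω, ENNReal.ofReal (f ω) ∂P) / ENNReal.ofReal a := by
  refine le_trans (measure_mono fun ω hω => ?_) (meas_ge_le_lintegral_div
    hf.ennreal_ofReal.aemeasurable (by simpa using ha) ENNReal.ofReal_ne_top)
  exact ENNReal.ofReal_le_ofReal hω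

end Moments

/-! ### Innovations against functions of the history, and operator bounds uniform in the dimension
-/

namespace Exploration

variable {N : ℕ} {𝒰 : Type*} [MeasurableSpace 𝒰] {Ω : Type*} [MeasurableSpace Ω]
  {P : Measure Ω} (E : Exploration N 𝒰 P)

theorem measurable_comp_hist (r : ℕ) {β : Type*} [MeasurableSpace β] (g : (ℕ → Fin N → ℝ) → β) :
    Measurable (fun ω => g (E.hist r ω)) :=
  measurable_comp_of_finite_range (E.finite_hist r) (E.measurableSet_hist r)
    (g := fun b _ => g b) fun _ => measurable_const

variable [IsProbabilityMeasure P]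

theorem indepFun_hist_xi (r : ℕ) {β : Type*} [MeasurableSpace β] (g : (ℕ → Fin N → ℝ) → β) :
    IndepFun (fun ω => g (E.hist r ω)) (E.xi r) P := by
  have h := (IndepFun_iff_Indep _ _ _).1 (E.xi_spec r).2
  rw [IndepFun_iff_Indep]
  refine indep_of_indep_of_le_left h ?_
  have := measurable_comp_of_finite_range (E.finite_hist r)
    (fun b => E.measurable_hist_past le_rfl (measurableSet_singleton b))
    (g := fun b _ => g b) fun _ => measurable_const
  exact this.comap_le

theorem lintegral_sq_hist_dotProduct_xi (r : ℕ) (g : (ℕ → Fin N → ℝ) → Fin N → ℝ) :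
    ∫⁻ ω, ENNReal.ofReal ((g (E.hist r ω) ⬝ᵥ E.xi r ω) ^ 2) ∂P
      = ∫⁻ ω, ENNReal.ofReal (g (E.hist r ω) ⬝ᵥ g (E.hist r ω)) ∂P :=
  lintegral_sq_dotProduct (E.measurable_comp_hist r g) (E.measurable_xi r) (E.xi_spec r).1
    (E.indepFun_hist_xi r g)

/-- With high probability the couplings are bounded on the explored subspace. -/
theorem exists_opBound (R : ℕ) {η : ℝ} (hη : 0 < η) : ∃ L : ℝ, 0 ≤ L ∧
    ∀ {N : ℕ} (_ : 0 < N) {𝒰 : Type*} [MeasurableSpace 𝒰] {Ω : Type*} [MeasurableSpace Ω]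
      {P : Measure Ω} [IsProbabilityMeasure P] (E : Exploration N 𝒰 P),
      P {ω | ¬ OpBound (Matrix.of (E.J ω)) (E.vs ω) L R} ≤ ENNReal.ofReal η := by
  induction R generalizing η with
  | zero =>
    refine ⟨0, le_rfl, fun {N} _ _ _ _ _ P _ E => ?_⟩
    have : {ω | ¬ OpBound (Matrix.of (E.J ω)) (E.vs ω) 0 0} = ∅ := by
      ext ω
      simp [OpBound, nrm, Set.Iio]
    simp [this]
  | succ r ih =>
    obtain ⟨L, hL, h⟩ := ih (η := η / 2) (by positivity)
    -- The innovation has mean squared norm N, so by Markov its squared norm reaches K² N with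
    -- probability at most 1 / K² = η / 2. The resulting L depends on R and η only, not on N or the
    -- exploration.
    set K := Real.sqrt (2 / η) with hK
    have hK2 : K ^ 2 = 2 / η := Real.sq_sqrt (by positivity)
    have hK0 : 0 < K := Real.sqrt_pos.2 (by positivity)
    refine ⟨2 * L + 2 * K, by positivity, fun {N} hN _ _ Ω _ P _ E => ?_⟩
    have h1 : P {ω | K ^ 2 * N ≤ E.xi r ω ⬝ᵥ E.xi r ω} ≤ ENNReal.ofReal (η / 2) := by
      refine (measure_sq_ge_le (measurable_dotProduct (E.measurable_xi r) (E.measurable_xi r))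
        (by positivity)).trans ?_
      rw [lintegral_dotProduct_self (E.xi_spec r).1, hK2]
      rw [← ENNReal.ofReal_natCast, ← ENNReal.ofReal_div_of_pos (by positivity)]
      refine ENNReal.ofReal_le_ofReal (le_of_eq ?_)
      field_simp
    have h2 := E.goe_J.ae_symm
    have h3 : P {ω | ¬ (Matrix.of (E.J ω))ᵀ = Matrix.of (E.J ω)} = 0 := h2
    calc P {ω | ¬ OpBound (Matrix.of (E.J ω)) (E.vs ω) (2 * L + 2 * K) (r + 1)}
        ≤ P ({ω | ¬ OpBound (Matrix.of (E.J ω)) (E.vs ω) L r}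
          ∪ {ω | K ^ 2 * N ≤ E.xi r ω ⬝ᵥ E.xi r ω}
          ∪ {ω | ¬ (Matrix.of (E.J ω))ᵀ = Matrix.of (E.J ω)}) := by
          refine measure_mono fun ω hω => ?_
          by_contra hc
          simp only [Set.mem_union, Set.mem_ofPred_eq, not_or, not_not, not_le] at hc
          refine hω (OpBound.succ hc.2 hL hc.1.1 (E.w r ω) ?_ hN)
          have : nrm (E.xi r ω) ^ 2 ≤ (K * Real.sqrt N) ^ 2 := by
            rw [nrm_sq, mul_pow, Real.sq_sqrt (Nat.cast_nonneg N)]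
            exact hc.1.2.le
          exact (abs_le_of_sq_le_sq' this (by positivity)).2
      _ ≤ _ := by
          refine (measure_union_le _ _).trans ?_
          rw [h3, add_zero]
          refine (measure_union_le _ _).trans ?_
          refine (add_le_add (h hN E) h1).trans ?_
          rw [← ENNReal.ofReal_add (by positivity) (by positivity)]
          exact ENNReal.ofReal_le_ofReal (by linarith)

end Exploration

/-! ### The block scan as an exploration -/

section Blocks

variable {m n : ℕ}

theorem inBlock_iff (b : ℕ) (i : Fin (m * n)) : InBlock b i ↔ (i : ℕ) / n = b := by
  have hn : 0 < n := by
    rcases Nat.eq_zero_or_pos n with rfl | h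
    · exact absurd i.2 (by simp)
    · exact h
  rw [InBlock, Nat.div_eq_iff hn]
  have : (b + 1) * n = b * n + n := by ring
  omega

theorem div_lt_blocks (i : Fin (m * n)) : (i : ℕ) / n < m :=
  Nat.div_lt_of_lt_mul (i.2.trans_eq (Nat.mul_comm m n))

theorem blockProj_mulVec_apply (j : Fin m) (x : Fin (m * n) → ℝ) (i : Fin (m * n)) :
    (blockProj m n j *ᵥ x) i = if InBlock (j : ℕ) i then x i else 0 := by
  rw [blockProj, Matrix.mulVec_diagonal]
  split_ifs <;> simp

theorem card_block {b : ℕ} (hb : b < m) :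
    (Finset.univ.filter fun i : Fin (m * n) => InBlock b i).card = n := by
  have hle : (b + 1) * n ≤ m * n := Nat.mul_le_mul_right n hb
  have hbn : (b + 1) * n = b * n + n := by ring
  refine (Finset.card_bij (s := Finset.univ)
    (t := Finset.univ.filter fun i : Fin (m * n) => InBlock b i) (fun (k : Fin n) _ =>
    (⟨b * n + k, by have := k.2; omega⟩ : Fin (m * n))) ?_ ?_ ?_).symm.trans (by simp)
  · intro k _
    have := k.2
    refine Finset.mem_filter.2 ⟨Finset.mem_univ _, ?_⟩
    simp only [InBlock]
    omega
  · intro k _ k' _ h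
    have := congrArg Fin.val h
    simp only at this
    exact Fin.ext (by omega)
  · intro i hi
    have hi := (Finset.mem_filter.1 hi).2
    simp only [InBlock] at hi
    exact ⟨⟨i - b * n, by omega⟩, Finset.mem_univ _, Fin.ext (by simp; omega)⟩

end Blocks

/-! ### The scan in the flattened order of updates -/

section Dynamics

variable {m n : ℕ}

/-- A site is updated once per pass, when its own block number `i / n` comes up, and is not touched
afterwards. -/
theorem partialPass_of_inBlock (c : unitInterval → ℝ → ℝ) (J : Fin (m * n) → Fin (m * n) → ℝ)
    (u : Fin (m * n) → unitInterval) (s : Fin (m * n) → ℝ) (j : ℕ) (i : Fin (m * n)) :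
    partialPass c J u s j i = if (i : ℕ) / n < j then
      c (u i) ((Matrix.of J *ᵥ partialPass c J u s (i / n)) i) else s i := by
  induction j with
  | zero => simp [partialPass]
  | succ j ih =>
    simp only [partialPass]
    by_cases h : InBlock j i
    · rw [if_pos h]
      rw [inBlock_iff] at h
      rw [if_pos (by omega), h]
    · rw [if_neg h, ih]
      rw [inBlock_iff] at h
      have : (i : ℕ) / n < j + 1 ↔ (i : ℕ) / n < j := by omega
      simp only [this]

namespace Input

variable {Ω : Type*} [MeasurableSpace Ω] {P : Measure Ω} (X : Input m n P)
  (c : unitInterval → ℝ → ℝ)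

theorem spin_succ_apply (t : ℕ) (ω : Ω) (i : Fin (m * n)) :
    X.spin c (t + 1) ω i = c (X.U ω (t + 1) i)
      ((Matrix.of (X.J ω) *ᵥ partialPass c (X.J ω) (X.U ω (t + 1)) (X.spin c t ω) (i / n)) i) := by
  rw [spin, partialPass_of_inBlock, if_pos (div_lt_blocks i)]

theorem partialPass_apply (t j : ℕ) (ω : Ω) (i : Fin (m * n)) :
    partialPass c (X.J ω) (X.U ω (t + 1)) (X.spin c t ω) j i
      = if (i : ℕ) / n < j then X.spin c (t + 1) ω i else X.spin c t ω i := by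
  rw [spin_succ_apply, ← partialPass_of_inBlock]

theorem spin_sign (hc : ∀ u x, c u x = 1 ∨ c u x = -1) (t : ℕ) (ω : Ω) (i : Fin (m * n)) :
    X.spin c t ω i = 1 ∨ X.spin c t ω i = -1 := by
  cases t with
  | zero => exact X.sign_init ω i
  | succ t => rw [spin_succ_apply]; exact hc _ _

variable [NeZero m]

/-- The block configurations in the order in which they are produced. -/
def flatSpin (r : ℕ) (ω : Ω) : Fin (m * n) → ℝ := X.spinBlock c (r / m) (Fin.ofNat m r) ω

theorem flatSpin_apply (r : ℕ) (ω : Ω) (i : Fin (m * n)) :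
    X.flatSpin c r ω i = if InBlock (r % m) i then X.spin c (r / m) ω i else 0 := by
  rw [flatSpin, spinBlock, blockProj_mulVec_apply]
  rfl

theorem flatSpin_mul_add (t : ℕ) (j : Fin m) (ω : Ω) :
    X.flatSpin c (t * m + j) ω = X.spinBlock c t j ω := by
  have hm : 0 < m := Nat.pos_of_ne_zero (NeZero.ne m)
  have h1 : (t * m + j) / m = t := by
    rw [mul_comm, Nat.mul_add_div hm, Nat.div_eq_of_lt j.2, add_zero]
  have h2 : Fin.ofNat m (t * m + j) = j := by
    ext
    simp [Fin.ofNat, Nat.mod_eq_of_lt j.2]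
  rw [flatSpin, h1, h2]

/-- After j updates the blocks below j carry their new values and the others their old ones; in flat
numbering these are the m consecutive indices starting at t m + j. -/
theorem partialPass_eq_sum (t : ℕ) {j : ℕ} (hj : j < m) (ω : Ω) :
    partialPass c (X.J ω) (X.U ω (t + 1)) (X.spin c t ω) j
      = ∑ q ∈ Finset.range m, X.flatSpin c (t * m + j + q) ω := by
  have hm : 0 < m := Nat.pos_of_ne_zero (NeZero.ne m)
  funext i
  rw [partialPass_apply, Finset.sum_apply]
  have hb := div_lt_blocks i
  obtain ⟨b, hbdef⟩ : ∃ b, (i : ℕ) / n = b := ⟨_, rfl⟩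
  rw [hbdef] at hb ⊢
  have hterm : ∀ q ∈ Finset.range m, X.flatSpin c (t * m + j + q) ω i
      = if (j + q) % m = b then X.spin c (t + (j + q) / m) ω i else 0 := by
    intro q _
    have h1 : (t * m + j + q) / m = t + (j + q) / m := by
      rw [add_assoc, mul_comm, Nat.mul_add_div hm]
    have h2 : (t * m + j + q) % m = (j + q) % m := by
      rw [add_assoc, mul_comm, Nat.mul_add_mod]
    rw [flatSpin_apply, h1, h2]
    simp only [inBlock_iff, hbdef, eq_comm]
  rw [Finset.sum_congr rfl hterm]
  by_cases h : b < j
  -- An already updated block b < j lies past the wrap-around of the window, at offset b + m - j and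
  -- with time t + 1; otherwise the offset is b - j and the time is t.
  · rw [if_pos h, Finset.sum_eq_single (b + m - j)]
    · have e : j + (b + m - j) = b + m := by omega
      rw [e, Nat.add_mod_right, Nat.mod_eq_of_lt hb, if_pos rfl, Nat.add_div_right _ hm,
        Nat.div_eq_of_lt hb]
    · intro q hq hne
      rw [if_neg]
      intro he
      have hq' := Finset.mem_range.1 hq
      rcases lt_or_ge (j + q) m with h3 | h3
      · rw [Nat.mod_eq_of_lt h3] at he; omega
      · rw [Nat.mod_eq_sub_mod h3, Nat.mod_eq_of_lt (by omega)] at he; omega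
    · intro hq; exact absurd (Finset.mem_range.2 (by omega)) hq
  · rw [if_neg h, Finset.sum_eq_single (b - j)]
    · have e : j + (b - j) = b := by omega
      rw [e, Nat.mod_eq_of_lt hb, if_pos rfl, Nat.div_eq_of_lt hb, add_zero]
    · intro q hq hne
      rw [if_neg]
      intro he
      have hq' := Finset.mem_range.1 hq
      rcases lt_or_ge (j + q) m with h3 | h3
      · rw [Nat.mod_eq_of_lt h3] at he; omega
      · rw [Nat.mod_eq_sub_mod h3, Nat.mod_eq_of_lt (by omega)] at he; omega
    · intro hq; exact absurd (Finset.mem_range.2 (by omega)) hq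

end Input

/-- The update of the `r`-th block configuration from the auxiliary randomness and the fields of
the preceding ones. -/
def scanRule (m n : ℕ) (c : unitInterval → ℝ → ℝ) (r : ℕ)
    (a : (Fin (m * n) → ℝ) × (ℕ → Fin (m * n) → unitInterval)) (y : ℕ → Fin (m * n) → ℝ) :
    Fin (m * n) → ℝ := fun i =>
  if InBlock (r % m) i then
    if r < m then a.1 i else c (a.2 (r / m) i) (∑ q ∈ Finset.range m, y (r - m + q) i)
  else 0

theorem measurable_scanRule {c : unitInterval → ℝ → ℝ} (hc : Measurable (Function.uncurry c))
    (r : ℕ) : Measurable (fun p : ((Fin (m * n) → ℝ) × (ℕ → Fin (m * n) → unitInterval)) ×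
      (ℕ → Fin (m * n) → ℝ) => scanRule m n c r p.1 p.2) := by
  refine measurable_pi_lambda _ fun i => ?_
  refine measurable_dite_const (fun _ => measurable_dite_const (fun _ => by fun_prop) ?_)
    measurable_const
  have h1 : Measurable (fun p : ((Fin (m * n) → ℝ) × (ℕ → Fin (m * n) → unitInterval)) ×
      (ℕ → Fin (m * n) → ℝ) => (p.1.2 (r / m) i, ∑ q ∈ Finset.range m, p.2 (r - m + q) i)) := by
    fun_prop
  exact hc.comp h1

theorem scanRule_congr {c : unitInterval → ℝ → ℝ} (r : ℕ)
    (a : (Fin (m * n) → ℝ) × (ℕ → Fin (m * n) → unitInterval)) (y y' : ℕ → Fin (m * n) → ℝ)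
    (h : ∀ s < r, y s = y' s) : scanRule m n c r a y = scanRule m n c r a y' := by
  funext i
  unfold scanRule
  by_cases hr : r < m
  · simp [hr]
  · have : ∑ q ∈ Finset.range m, y (r - m + q) i = ∑ q ∈ Finset.range m, y' (r - m + q) i := by
      refine Finset.sum_congr rfl fun q hq => ?_
      have := Finset.mem_range.1 hq
      rw [h _ (by omega)]
    rw [this]

namespace Input

variable {Ω : Type*} [MeasurableSpace Ω] {P : Measure Ω} [NeZero m]

theorem flatSpin_eq_scanRule (X : Input m n P) (c : unitInterval → ℝ → ℝ) (r : ℕ) (ω : Ω) :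
    X.flatSpin c r ω = scanRule m n c r (X.init ω, X.U ω)
      (fun s => Matrix.of (X.J ω) *ᵥ X.flatSpin c s ω) := by
  have hm : 0 < m := Nat.pos_of_ne_zero (NeZero.ne m)
  funext i
  rw [flatSpin_apply, scanRule]
  by_cases hi : InBlock (r % m) i
  · rw [if_pos hi, if_pos hi]
    by_cases hr : r < m
    · rw [if_pos hr, Nat.div_eq_of_lt hr, spin]
    · rw [if_neg hr]
      obtain ⟨t, ht⟩ : ∃ t, r / m = t + 1 :=
        ⟨r / m - 1, by have := Nat.div_pos (not_lt.1 hr) hm; omega⟩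
      have hrm : r - m = t * m + r % m := by
        have := Nat.div_add_mod r m
        rw [ht] at this
        have e : m * (t + 1) = t * m + m := by ring
        omega
      rw [ht, spin_succ_apply, (inBlock_iff _ _).1 hi, partialPass_eq_sum X c t (Nat.mod_lt r hm),
        ← hrm, Matrix.mulVec_sum, Finset.sum_apply]
  · rw [if_neg hi, if_neg hi]

theorem flatSpin_mem (X : Input m n P) {c : unitInterval → ℝ → ℝ}
    (hc : ∀ u x, c u x = 1 ∨ c u x = -1) (r : ℕ) (ω : Ω) (i : Fin (m * n)) :
    X.flatSpin c r ω i ∈ ({0, 1, -1} : Set ℝ) := by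
  rw [flatSpin_apply]
  split_ifs
  · rcases X.spin_sign c hc (r / m) ω i with h | h <;> simp [h]
  · simp

/-- The block scan as an exploration. -/
def exploration [IsProbabilityMeasure P] (X : Input m n P) {c : unitInterval → ℝ → ℝ}
    (hc : Measurable (Function.uncurry c)) (hs : ∀ u x, c u x = 1 ∨ c u x = -1) :
    Exploration (m * n) ((Fin (m * n) → ℝ) × (ℕ → Fin (m * n) → unitInterval)) P where
  J := X.J
  A := fun ω => (X.init ω, X.U ω)
  w := fun r ω => noise (X.W ω (r / m) (Fin.ofNat m r))
  v := X.flatSpin c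
  rule := scanRule m n c
  measurable_J := X.measurable_J
  measurable_A := X.measurable_init.prodMk X.measurable_U
  measurable_w := fun r => by
    have := X.measurable_W
    unfold noise
    fun_prop
  measurable_rule := measurable_scanRule hc
  rule_congr := scanRule_congr
  v_eq := X.flatSpin_eq_scanRule c
  finite_v := fun r => by
    refine (Set.Finite.pi' (t := fun _ : Fin (m * n) => ({0, 1, -1} : Set ℝ))
      fun _ => by simp).subset ?_
    rintro _ ⟨ω, rfl⟩
    exact X.flatSpin_mem hs r ω
  goe_J := X.goe_J
  gaussian_w := fun r => (X.goe_W _ _).noise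
  indep_w := by
    have hinj : Function.Injective (fun r : ℕ => (r / m, Fin.ofNat m r)) := by
      intro r s h
      have h1 : r / m = s / m := congrArg Prod.fst h
      have h2 : r % m = s % m := congrArg (fun p => (p.2 : ℕ)) h
      rw [← Nat.div_add_mod r m, ← Nat.div_add_mod s m, h1, h2]
    refine (X.indep_W.precomp hinj).comp (fun _ => noise) fun _ => ?_
    unfold noise
    fun_prop
  indep_A_J := by
    have h1 := X.indep_init_J_U
    have h2 : IndepFun X.J (fun ω => (X.U ω, X.init ω)) P := by
      have := indepFun_prodMk_left X.measurable_U X.measurable_init X.measurable_J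
        h1.symm X.indep_init_J
      exact this.symm
    exact (h2.comp measurable_id measurable_swap).symm
  indep_A_J_w := by
    refine X.indep_init_J_U_W.comp (φ := fun z => ((z.1, z.2.2), z.2.1))
      (ψ := fun W (r : ℕ) => noise (W (r / m) (Fin.ofNat m r))) (by fun_prop) ?_
    unfold noise
    fun_prop

end Input

end Dynamics

/-! ### Recovering the configurations from the fields -/

section Decode

variable {m n : ℕ}

theorem finite_signVectors (N : ℕ) : {x : Fin N → ℝ | ∀ i, x i ∈ ({0, 1, -1} : Set ℝ)}.Finite :=
  Set.Finite.pi' fun _ => by simp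

/-- The sum of all vectors with entries in `{0, 1, -1}` that solve `z ⬝ᵥ x = a`. -/
def decode {N : ℕ} (z : Fin N → ℝ) (a : ℝ) : Fin N → ℝ :=
  ∑ x ∈ (finite_signVectors N).toFinset, if z ⬝ᵥ x = a then x else 0

theorem measurable_decode {N : ℕ} {α : Type*} [MeasurableSpace α] {z : α → Fin N → ℝ} {a : α → ℝ}
    (hz : Measurable z) (ha : Measurable a) : Measurable (fun ω => decode (z ω) (a ω)) := by
  unfold decode
  refine Finset.measurable_sum _ fun x _ => Measurable.ite ?_ measurable_const measurable_const
  exact measurableSet_eq_fun (measurable_dotProduct hz measurable_const) ha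

theorem finite_range_decode {N : ℕ} {α : Type*} (z : α → Fin N → ℝ) (a : α → ℝ) :
    (Set.range fun ω => decode (z ω) (a ω)).Finite := by
  classical
  refine (((finite_signVectors N).toFinset.powerset.finite_toSet).image
    fun F => ∑ x ∈ F, x).subset ?_
  rintro _ ⟨ω, rfl⟩
  refine ⟨(finite_signVectors N).toFinset.filter fun x => z ω ⬝ᵥ x = a ω, ?_, ?_⟩
  · exact Finset.mem_coe.2 (Finset.mem_powerset.2 (Finset.filter_subset _ _))
  · simp only [decode, Finset.sum_filter]

/-- When z separates x from all other candidates, the sum has a single term. Summing over all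
solutions, rather than choosing one, keeps the decoder measurable. -/
theorem decode_eq {N : ℕ} {z x : Fin N → ℝ} (hx : ∀ i, x i ∈ ({0, 1, -1} : Set ℝ))
    (h : ∀ x', (∀ i, x' i ∈ ({0, 1, -1} : Set ℝ)) → x' ≠ x → z ⬝ᵥ x' ≠ z ⬝ᵥ x) :
    decode z (z ⬝ᵥ x) = x := by
  rw [decode, Finset.sum_eq_single x]
  · simp
  · intro x' hx' hne
    rw [if_neg (h x' (by simpa using hx') hne)]
  · intro hx'
    exact absurd ((finite_signVectors N).mem_toFinset.2 hx) hx'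

/-- A nonzero functional of a nonzero direction of a GOE matrix almost surely does not vanish. -/
theorem IsGOE.ae_ne_zero {Ω : Type*} [MeasurableSpace Ω] {P : Measure Ω} {N : ℕ}
    {J : Ω → Fin N → Fin N → ℝ} (hJ : IsGOE J P) {a b : Fin N → ℝ} (ha : a ≠ 0) (hb : b ≠ 0) :
    ∀ᵐ ω ∂P, a ⬝ᵥ (Matrix.of (J ω) *ᵥ b) ≠ 0 := by
  have hN : 0 < N := by
    rcases Nat.eq_zero_or_pos N with rfl | h
    · exact absurd (Subsingleton.elim _ _) ha
    · exact h
  have hg : HasGaussianLaw (fun ω => a ⬝ᵥ (Matrix.of (J ω) *ᵥ b)) P := by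
    simp only [dotProduct_mulVec_eq_sum]
    refine HasGaussianLaw.comp_isLinearMap hJ.1
      (g := fun x => (fun p : Fin N × Fin N => a p.1 * b p.2) ⬝ᵥ x) ⟨?_, ?_⟩
    · intro x y; exact dotProduct_add _ _ _
    · intro c x; exact dotProduct_smul _ _ _
  have hv : 0 < Var[fun ω => a ⬝ᵥ (Matrix.of (J ω) *ᵥ b); P] := by
    have := hJ.1.isProbabilityMeasure
    rw [variance_eq_sub (hJ.memLp a b), hJ.integral_dotProduct]
    simp only [Pi.pow_apply, pow_two]
    rw [hJ.integral_mul]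
    have h1 : 0 < a ⬝ᵥ a :=
      lt_of_le_of_ne (dotProduct_self_nonneg' a) (Ne.symm (mt dotProduct_self_eq_zero.1 ha))
    have h2 : 0 < b ⬝ᵥ b :=
      lt_of_le_of_ne (dotProduct_self_nonneg' b) (Ne.symm (mt dotProduct_self_eq_zero.1 hb))
    rw [dotProduct_comm b a]
    have : 0 < a ⬝ᵥ a * b ⬝ᵥ b + a ⬝ᵥ b * a ⬝ᵥ b := by nlinarith [mul_pos h1 h2]
    have hN' : (0 : ℝ) < N := by positivity
    simpa using div_pos this hN'
  have hmap := hg.map_eq_gaussianReal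
  have : NullSingletonClass (P.map fun ω => a ⬝ᵥ (Matrix.of (J ω) *ᵥ b)) := by
    rw [hmap]
    exact nullSingletonClass_gaussianReal (by simpa using hv)
  have h0 := measure_singleton (μ := P.map fun ω => a ⬝ᵥ (Matrix.of (J ω) *ᵥ b)) (0 : ℝ)
  rw [Measure.map_apply_of_aemeasurable hg.aemeasurable (measurableSet_singleton 0)] at h0
  exact measure_eq_zero_iff_ae_notMem.1 h0

namespace Input

section Main

variable {Ω : Type*} [MeasurableSpace Ω] {P : Measure Ω} [NeZero m] (X : Input m n P)
  {c : unitInterval → ℝ → ℝ}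

/-- The image of the `r`-th block configuration under the couplings. -/
def flatField (X : Input m n P) (c : unitInterval → ℝ → ℝ) (r : ℕ) (ω : Ω) : Fin (m * n) → ℝ :=
  Matrix.of (X.J ω) *ᵥ X.flatSpin c r ω

/-- The initial configuration in the block number `r`. -/
def initBlock (X : Input m n P) (r : ℕ) (ω : Ω) : Fin (m * n) → ℝ :=
  blockProj m n (Fin.ofNat m r) *ᵥ X.init ω

theorem flatSpin_of_lt (c : unitInterval → ℝ → ℝ) {r : ℕ} (hr : r < m) (ω : Ω) :
    X.flatSpin c r ω = X.initBlock r ω := by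
  rw [flatSpin, spinBlock, Nat.div_eq_of_lt hr, spin, initBlock]

theorem initBlock_mod (r : ℕ) (ω : Ω) : X.initBlock (r % m) ω = X.initBlock r ω := by
  have : Fin.ofNat m (r % m) = Fin.ofNat m r := by ext; simp [Fin.ofNat]
  rw [initBlock, this, initBlock]

/-- The `r`-th block configuration, recovered from the initial configuration and the fields. -/
def decodedSpin (X : Input m n P) (c : unitInterval → ℝ → ℝ) (r : ℕ) (ω : Ω) :
    Fin (m * n) → ℝ :=
  if r < m then X.initBlock r ω
  else decode (X.flatField c (r % m) ω) (X.initBlock r ω ⬝ᵥ X.flatField c r ω)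

theorem finite_range_decodedSpin (hs : ∀ u x, c u x = 1 ∨ c u x = -1) (r : ℕ) :
    (Set.range (X.decodedSpin c r)).Finite := by
  by_cases hr : r < m
  · refine (finite_signVectors (m * n)).subset ?_
    rintro _ ⟨ω, rfl⟩
    intro i
    simp only [decodedSpin, hr, if_true]
    rw [← X.flatSpin_of_lt c hr]
    exact X.flatSpin_mem hs r ω i
  · have : X.decodedSpin c r = fun ω => decode (X.flatField c (r % m) ω)
        (X.initBlock r ω ⬝ᵥ X.flatField c r ω) := by
      funext ω
      simp only [decodedSpin, hr, if_false]
    rw [this]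
    exact finite_range_decode _ _

theorem initBlock_ne_zero (hn : 0 < n) (r : ℕ) (ω : Ω) : X.initBlock r ω ≠ 0 := by
  have hm : 0 < m := Nat.pos_of_ne_zero (NeZero.ne m)
  have hc := card_block (m := m) (n := n) (Nat.mod_lt r hm)
  obtain ⟨i, hi⟩ := Finset.card_pos.1 (hc.symm ▸ hn)
  intro h
  have h1 := congrFun h i
  rw [initBlock, blockProj_mulVec_apply] at h1
  have h2 : InBlock ((Fin.ofNat m r : Fin m) : ℕ) i := (Finset.mem_filter.1 hi).2
  rw [if_pos h2] at h1
  rcases X.sign_init ω i with h3 | h3 <;> rw [h3] at h1 <;> norm_num at h1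

/-- For fixed candidates x ≠ x' and a fixed nonzero s, the Gaussian variable ⟨x' - x, J s⟩ almost
surely does not vanish. There are finitely many such triples, so one null set serves every random
choice of spins and every index. -/
theorem ae_decodedSpin_eq (hs : ∀ u x, c u x = 1 ∨ c u x = -1) (hn : 0 < n) :
    ∀ᵐ ω ∂P, ∀ r, X.decodedSpin c r ω = X.flatSpin c r ω := by
  have hm : 0 < m := Nat.pos_of_ne_zero (NeZero.ne m)
  have h1 : ∀ᵐ ω ∂P, ∀ x ∈ (finite_signVectors (m * n)).toFinset,
      ∀ x' ∈ (finite_signVectors (m * n)).toFinset, ∀ s ∈ (finite_signVectors (m * n)).toFinset,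
      x' ≠ x → s ≠ 0 → (x' - x) ⬝ᵥ (Matrix.of (X.J ω) *ᵥ s) ≠ 0 := by
    refine (ae_ball_iff (Finset.countable_toSet _)).2 fun x _ => ?_
    refine (ae_ball_iff (Finset.countable_toSet _)).2 fun x' _ => ?_
    refine (ae_ball_iff (Finset.countable_toSet _)).2 fun s _ => ?_
    by_cases h : x' ≠ x ∧ s ≠ 0
    · filter_upwards [X.goe_J.ae_ne_zero (sub_ne_zero.2 h.1) h.2] with ω hω _ _
      exact hω
    · exact Filter.Eventually.of_forall fun ω h1 h2 => absurd ⟨h1, h2⟩ h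
  filter_upwards [h1, X.goe_J.ae_symm] with ω hω hJ r
  by_cases hr : r < m
  · rw [decodedSpin, if_pos hr, X.flatSpin_of_lt c hr]
  · have e1 : X.initBlock r ω = X.flatSpin c (r % m) ω := by
      rw [X.flatSpin_of_lt c (Nat.mod_lt r hm), initBlock_mod]
    -- By symmetry of J, the pairing of the known initial block with the known field is a linear
    -- equation for the unknown spin, with known coefficients.
    have e2 : X.initBlock r ω ⬝ᵥ X.flatField c r ω
        = X.flatField c (r % m) ω ⬝ᵥ X.flatSpin c r ω := by
      rw [flatField, dotProduct_mulVec_of_symm hJ, e1, flatField]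
    rw [decodedSpin, if_neg hr, e2]
    refine decode_eq (X.flatSpin_mem hs r ω) fun x' hx' hne h => ?_
    refine hω (X.flatSpin c r ω) ((finite_signVectors (m * n)).mem_toFinset.2
      (X.flatSpin_mem hs r ω)) x'
      ((finite_signVectors (m * n)).mem_toFinset.2 hx') (X.flatSpin c (r % m) ω)
      ((finite_signVectors (m * n)).mem_toFinset.2 (X.flatSpin_mem hs (r % m) ω)) hne
      (e1 ▸ X.initBlock_ne_zero hn r ω) ?_
    rw [flatField] at h
    rw [sub_dotProduct, dotProduct_comm x', dotProduct_comm (X.flatSpin c r ω), h, sub_self]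

/-- The innovations computed from the recovered configurations. -/
def decodedInnov (X : Input m n P) (c : unitInterval → ℝ → ℝ) (r : ℕ) (ω : Ω) :
    Fin (m * n) → ℝ :=
  innov (fun s => if s ≤ r then X.decodedSpin c s ω else 0) (fun s => X.flatField c s ω)
    (noise (X.W ω (r / m) (Fin.ofNat m r))) r

theorem ae_decodedInnov_eq [IsProbabilityMeasure P] (hc : Measurable (Function.uncurry c))
    (hs : ∀ u x, c u x = 1 ∨ c u x = -1) (hn : 0 < n) (r : ℕ) :
    X.decodedInnov c r =ᵐ[P] (X.exploration hc hs).xi r := by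
  filter_upwards [X.ae_decodedSpin_eq hs hn] with ω hω
  refine innov_congr (fun s hsr => ?_) fun _ _ => rfl
  rw [if_pos hsr, hω s]
  rfl

end Main

/-! ### Decoding from the initial configuration, the fields and the noise, over an arbitrary
σ-algebra -/

section SubAlgebra

variable {Ω : Type*} {𝓕 : MeasurableSpace Ω} [MeasurableSpace Ω] {P : Measure Ω} [NeZero m]
  (X : Input m n P) {c : unitInterval → ℝ → ℝ}

theorem measurable_decodedSpin {r : ℕ} (hi : Measurable[𝓕] X.init)
    (hy : ∀ s ≤ r, Measurable[𝓕] (X.flatField c s)) : Measurable[𝓕] (X.decodedSpin c r) := by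
  have h1 : Measurable[𝓕] (X.initBlock r) :=
    @measurable_mulVec _ 𝓕 _ _ _ (blockProj m n (Fin.ofNat m r)) _ hi
  refine @measurable_dite_const _ _ 𝓕 _ _ _ _ _ (fun _ => h1) ?_
  exact @measurable_decode _ _ 𝓕 _ _ (hy _ (Nat.mod_le r m))
    (@measurable_dotProduct _ 𝓕 _ _ _ _ h1 (hy r le_rfl))

/-- The decoded spins have finite range everywhere, not only almost surely, so the innovation may be
evaluated along frozen values without completing the σ-algebra. -/
theorem measurable_decodedInnov (hs : ∀ u x, c u x = 1 ∨ c u x = -1)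
    {r : ℕ} (hi : Measurable[𝓕] X.init) (hy : ∀ s ≤ r, Measurable[𝓕] (X.flatField c s))
    (hW : Measurable[𝓕] (fun ω => X.W ω (r / m) (Fin.ofNat m r))) :
    Measurable[𝓕] (X.decodedInnov c r) := by
  have hw : Measurable[𝓕] (fun ω => noise (X.W ω (r / m) (Fin.ofNat m r))) := by
    refine Measurable.comp (g := noise) ?_ hW
    unfold noise
    fun_prop
  have hd : Measurable[𝓕] (fun ω s => if s ≤ r then X.decodedSpin c s ω else 0) := by
    refine @measurable_pi_lambda _ _ _ 𝓕 _ _ fun s => ?_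
    exact @measurable_dite_const _ _ 𝓕 _ _ _ _ _
      (fun h => X.measurable_decodedSpin hi fun q hq => hy q (hq.trans h)) measurable_const
  exact measurable_comp_of_finite_range (finite_range_trunc (X.finite_range_decodedSpin hs) r)
    (fun b => hd (measurableSet_singleton b))
    (g := fun b ω => innov b (fun s => X.flatField c s ω)
      (noise (X.W ω (r / m) (Fin.ofNat m r))) r)
    fun b => @measurable_innov _ _ 𝓕 b r _ hy _ hw

end SubAlgebra

variable {Ω : Type*} [MeasurableSpace Ω] {P : Measure Ω} [NeZero m] (X : Input m n P)
  {c : unitInterval → ℝ → ℝ}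

/-- The innovations are adapted to the extended filtration. -/
theorem measurable_decodedInnov_extFiltration (hs : ∀ u x, c u x = 1 ∨ c u x = -1)
    {t s : ℕ} {j l : Fin m} (h : t < s ∨ (t = s ∧ j < l)) :
    Measurable[X.extFiltration c s l] (X.decodedInnov c (t * m + j)) := by
  have hm : 0 < m := Nat.pos_of_ne_zero (NeZero.ne m)
  refine X.measurable_decodedInnov hs ?_ ?_ ?_
  · exact (comap_measurable X.init).mono (le_sup_left.trans le_sup_left) le_rfl
  · intro q hq
    have hlex : q / m < s ∨ (q / m = s ∧ Fin.ofNat m q < l) := by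
      have h1 := Nat.div_add_mod q m
      have h2 := Nat.mod_lt q hm
      have h3 : q / m ≤ t := by
        have : q / m < t + 1 := by
          rw [Nat.div_lt_iff_lt_mul hm]
          have : (t + 1) * m = t * m + m := by ring
          have := j.2
          omega
        omega
      rcases h with h | ⟨rfl, h⟩
      · exact Or.inl (by omega)
      · rcases h3.lt_or_eq with h4 | h4
        · exact Or.inl h4
        · refine Or.inr ⟨h4, ?_⟩
          rw [Fin.lt_def] at h ⊢
          have : m * (q / m) = t * m := by rw [h4, mul_comm]
          simp only [Fin.ofNat]
          omega
    have h1 : Measurable[X.extFiltration c s l] (X.coupledSpin c (q / m) (Fin.ofNat m q)) := by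
      refine (comap_measurable _).mono ?_ le_rfl
      refine le_trans ?_ (le_sup_right.trans le_sup_left)
      exact le_iSup₂_of_le (q / m, Fin.ofNat m q) hlex le_rfl
    exact h1
  · have h1 : (t * m + j) / m = t := by
      rw [mul_comm, Nat.mul_add_div hm, Nat.div_eq_of_lt j.2, add_zero]
    have h2 : Fin.ofNat m (t * m + j) = j := by
      ext
      simp [Fin.ofNat, Nat.mod_eq_of_lt j.2]
    rw [h1, h2]
    refine (comap_measurable _).mono ?_ le_rfl
    refine le_trans ?_ le_sup_right
    exact le_iSup₂_of_le (t, j) (h.imp id fun h => ⟨h.1, h.2.le⟩) le_rfl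

end Input

end Decode

/-! ### The conditional decomposition of the fields -/

section Identities

variable {m n : ℕ}

/-- The case distinction on k < j is the flat order in disguise: θ̂ regresses on exactly those
configurations of block k that precede the pair (t, j). -/
theorem lt_thetaLen_iff {t : ℕ} {j k : Fin m} {a : ℕ} :
    a < thetaLen t j k ↔ a * m + k < t * m + j := by
  have hj := j.2
  have hk := k.2
  unfold thetaLen
  have key : ∀ b : ℕ, a < b → a * m + m ≤ b * m := fun b hb => by
    have := Nat.mul_le_mul_right m (Nat.succ_le_of_lt hb)
    rwa [Nat.succ_mul] at this
  have key' : ∀ b : ℕ, b < a → b * m + m ≤ a * m := fun b hb => by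
    have := Nat.mul_le_mul_right m (Nat.succ_le_of_lt hb)
    rwa [Nat.succ_mul] at this
  split_ifs with h <;> rw [Fin.lt_def] at h
  · constructor
    · intro h1
      rcases (Nat.lt_succ_iff.1 h1).lt_or_eq with h2 | rfl
      · have := key t h2; omega
      · omega
    · intro h1
      by_contra h2
      have := key' t (by omega)
      omega
  · constructor
    · intro h1
      have := key t h1; omega
    · intro h1
      by_contra h2
      rcases (not_lt.1 h2).lt_or_eq with h3 | rfl
      · have := key' t h3
        omega
      · omega

theorem blockProj_transpose (k : Fin m) : (blockProj m n k)ᵀ = blockProj m n k :=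
  Matrix.diagonal_transpose _

theorem blockProj_mulVec_self (k : Fin m) (x : Fin (m * n) → ℝ) :
    blockProj m n k *ᵥ (blockProj m n k *ᵥ x) = blockProj m n k *ᵥ x := by
  funext i
  simp only [blockProj_mulVec_apply]
  split_ifs <;> rfl

theorem blockProj_mulVec_of_ne {j k : Fin m} (h : j ≠ k) (x : Fin (m * n) → ℝ) :
    blockProj m n k *ᵥ (blockProj m n j *ᵥ x) = 0 := by
  funext i
  simp only [blockProj_mulVec_apply, inBlock_iff]
  have : (j : ℕ) ≠ k := fun h' => h (Fin.ext h')
  split_ifs with h1 h2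
  · exact absurd (h2.symm.trans h1) this
  · rfl
  · rfl

theorem blockProj_dotProduct (k : Fin m) (x y : Fin (m * n) → ℝ) :
    x ⬝ᵥ (blockProj m n k *ᵥ y) = (blockProj m n k *ᵥ x) ⬝ᵥ y :=
  dotProduct_mulVec_of_symm (blockProj_transpose k) x y

theorem delta_mul (hm : 0 < m) : delta m * ((m * n : ℕ) : ℝ) = n := by
  have : (m : ℝ) ≠ 0 := by positivity
  rw [delta]; push_cast; field_simp

namespace Input

variable {Ω : Type*} [MeasurableSpace Ω] {P : Measure Ω} (X : Input m n P)
  (c : unitInterval → ℝ → ℝ) (ω : Ω)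

theorem blockProj_mulVec_spinBlock (t : ℕ) (j k : Fin m) :
    blockProj m n k *ᵥ X.spinBlock c t j ω = if j = k then X.spinBlock c t j ω else 0 := by
  rw [spinBlock]
  split_ifs with h
  · rw [h, blockProj_mulVec_self]
  · exact blockProj_mulVec_of_ne h _

theorem spinBlock_dotProduct_of_ne {j k : Fin m} (h : j ≠ k) (s t : ℕ) :
    X.spinBlock c s j ω ⬝ᵥ X.spinBlock c t k ω = 0 := by
  rw [spinBlock, ← blockProj_dotProduct, blockProj_mulVec_spinBlock, if_neg h.symm,
    dotProduct_zero]

theorem thetaLen_self (t : ℕ) (j : Fin m) : thetaLen t j j = t := if_neg (lt_irrefl j)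

theorem overlapC_eq (hm : 0 < m) (j : Fin m) (s t : ℕ) :
    X.overlapC c j ω s t = (n : ℝ)⁻¹ * (X.spinBlock c s j ω ⬝ᵥ X.spinBlock c t j ω) := by
  rw [overlapC, delta_mul hm, one_div]

theorem spinBlock_dotProduct_self (hs : ∀ u x, c u x = 1 ∨ c u x = -1) (t : ℕ) (j : Fin m) :
    X.spinBlock c t j ω ⬝ᵥ X.spinBlock c t j ω = n := by
  have h : ∀ i, X.spinBlock c t j ω i * X.spinBlock c t j ω i
      = if InBlock (j : ℕ) i then 1 else 0 := fun i => by
    rw [spinBlock, blockProj_mulVec_apply]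
    split_ifs
    · rcases X.spin_sign c hs t ω i with h | h <;> simp [h]
    · simp
  rw [dotProduct, Finset.sum_congr rfl fun i _ => h i, Finset.sum_ite, Finset.sum_const_zero,
    add_zero, Finset.sum_const, card_block j.2]
  simp

theorem pinv_matC (hm : 0 < m) (hn : 0 < n) (p : ℕ) (k : Fin m) :
    pinv (X.matC c p p k ω)
      = (n : ℝ) • pinv ((X.spinHist c p k ω)ᵀ * X.spinHist c p k ω) := by
  have h : X.matC c p p k ω = (n : ℝ)⁻¹ • ((X.spinHist c p k ω)ᵀ * X.spinHist c p k ω) := by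
    ext a b
    rw [matC, Matrix.of_apply, overlapC_eq X c ω hm]
    rfl
  rw [h, pinv_smul _ (inv_ne_zero (by positivity)), inv_inv]

theorem colC_eq (hm : 0 < m) (p t : ℕ) (j : Fin m) :
    X.colC c p t j ω = (n : ℝ)⁻¹ • ((X.spinHist c p j ω)ᵀ *ᵥ X.spinBlock c t j ω) := by
  funext a
  rw [colC, overlapC_eq X c ω hm]
  rfl

theorem psiHat_eq (hm : 0 < m) (hn : 0 < n) (t : ℕ) (j : Fin m) :
    X.psiHat c t j ω = projCoef (X.spinHist c t j ω) (X.spinBlock c t j ω) := by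
  have : (n : ℝ) ≠ 0 := by positivity
  rw [psiHat, pinv_matC X c ω hm hn, colC_eq X c ω hm, Matrix.mulVec_smul, Matrix.smul_mulVec,
    smul_smul, inv_mul_cancel₀ this, one_smul, projCoef]

theorem fieldHist_mulVec (p : ℕ) (j k : Fin m) (x : Fin p → ℝ) :
    X.fieldHist c p j k ω *ᵥ x
      = blockProj m n k *ᵥ (Matrix.of (X.J ω) *ᵥ (X.spinHist c p j ω *ᵥ x)) := by
  have : X.fieldHist c p j k ω = blockProj m n k * (Matrix.of (X.J ω) * X.spinHist c p j ω) := by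
    ext i a
    rfl
  rw [this, ← Matrix.mulVec_mulVec, ← Matrix.mulVec_mulVec]

variable [NeZero m]

theorem exists_flatSpin_eq (s : ℕ) : ∃ (a : ℕ) (l : Fin m), s = a * m + l := by
  have hm : 0 < m := Nat.pos_of_ne_zero (NeZero.ne m)
  exact ⟨s / m, ⟨s % m, Nat.mod_lt s hm⟩, (Nat.div_add_mod' s m).symm⟩

/-- Configurations of distinct blocks have disjoint supports, so the explored span is an orthogonal
sum over blocks and D^k selects the summand of block k. -/
theorem spanProj_spinHist_mulVec_past (t : ℕ) (j k : Fin m) (x : Fin (m * n) → ℝ) :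
    spanProj (X.spinHist c (thetaLen t j k) k ω) *ᵥ x
      = blockProj m n k *ᵥ (pastProj (fun s => X.flatSpin c s ω) (t * m + j) *ᵥ x) := by
  set v := fun s => X.flatSpin c s ω with hv
  set S := X.spinHist c (thetaLen t j k) k ω with hS
  have hcol : ∀ a : Fin (thetaLen t j k), (fun i => S i a) = v (a * m + k) := fun a => by
    rw [hv]; simp only [flatSpin_mul_add]; rfl
  have h1 : spanProj S *ᵥ x = spanProj S *ᵥ (pastProj v (t * m + j) *ᵥ x) := by
    rw [← sub_eq_zero, ← Matrix.mulVec_sub]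
    refine spanProj_mulVec_eq_zero _ fun a => ?_
    rw [hcol]
    exact sub_pastProj_dotProduct v (lt_thetaLen_iff.1 a.2) x
  rw [h1, pastProj_mulVec_eq_sum, Matrix.mulVec_sum, Matrix.mulVec_sum]
  refine Finset.sum_congr rfl fun s _ => ?_
  rw [Matrix.mulVec_smul, Matrix.mulVec_smul]
  congr 1
  obtain ⟨a, l, hs⟩ := exists_flatSpin_eq (m := m) (s : ℕ)
  have hvs : v s = X.spinBlock c a l ω := by
    rw [hv, hs]; exact X.flatSpin_mul_add c a l ω
  rw [hvs, blockProj_mulVec_spinBlock]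
  split_ifs with h
  · subst h
    have ha : a < thetaLen t j l := lt_thetaLen_iff.2 (hs ▸ s.2)
    exact spanProj_mulVec_col S ⟨a, ha⟩
  · refine spanProj_mulVec_eq_zero _ fun b => ?_
    exact X.spinBlock_dotProduct_of_ne c ω h a b

theorem pastProj_mulVec_blockProj (t : ℕ) (j k : Fin m) (x : Fin (m * n) → ℝ) :
    pastProj (fun s => X.flatSpin c s ω) (t * m + j) *ᵥ (blockProj m n k *ᵥ x)
      = spanProj (X.spinHist c (thetaLen t j k) k ω) *ᵥ x := by
  have h : ∀ y, y ⬝ᵥ (pastProj (fun s => X.flatSpin c s ω) (t * m + j) *ᵥ (blockProj m n k *ᵥ x))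
      = y ⬝ᵥ (spanProj (X.spinHist c (thetaLen t j k) k ω) *ᵥ x) := fun y => by
    rw [dotProduct_pastProj, blockProj_dotProduct, ← spanProj_spinHist_mulVec_past,
      ← dotProduct_spanProj]
  funext i
  simpa using h (Pi.single i 1)

/-- Only earlier configurations of the same block contribute to the projection, so the residual on
the whole explored span is the one measured by ψ̂. -/
theorem resid_flatSpin (hm : 0 < m) (hn : 0 < n) (t : ℕ) (j : Fin m) :
    resid (fun s => X.flatSpin c s ω) (t * m + j)
      = X.spinBlock c t j ω - X.spinHist c t j ω *ᵥ X.psiHat c t j ω := by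
  rw [psiHat_eq X c ω hm hn, mulVec_projCoef, resid]
  have h := pastProj_mulVec_blockProj X c ω t j j (X.spinBlock c t j ω)
  rw [blockProj_mulVec_spinBlock, if_pos rfl, thetaLen_self] at h
  simp only [flatSpin_mul_add]
  rw [h]

theorem blockProj_resid_flatSpin (hm : 0 < m) (hn : 0 < n) (t : ℕ) (j k : Fin m) :
    blockProj m n k *ᵥ resid (fun s => X.flatSpin c s ω) (t * m + j)
      = if k = j then resid (fun s => X.flatSpin c s ω) (t * m + j) else 0 := by
  have h : ∀ l, blockProj m n l *ᵥ (X.spinHist c t j ω *ᵥ X.psiHat c t j ω)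
      = if j = l then X.spinHist c t j ω *ᵥ X.psiHat c t j ω else 0 := fun l => by
    have e : X.spinHist c t j ω *ᵥ X.psiHat c t j ω
        = ∑ a, X.psiHat c t j ω a • X.spinBlock c a j ω := by
      funext i
      simp [Matrix.mulVec, dotProduct, spinHist, Finset.sum_apply, mul_comm]
    rw [e, Matrix.mulVec_sum]
    simp only [Matrix.mulVec_smul, blockProj_mulVec_spinBlock]
    split_ifs <;> simp
  rw [resid_flatSpin X c ω hm hn, Matrix.mulVec_sub, blockProj_mulVec_spinBlock, h]
  simp only [eq_comm (a := k)]
  split_ifs <;> simp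

/-- Pythagoras: the block configuration has squared norm n, and the quadratic form under the root in
b̂ is the squared norm of its projection divided by n. -/
theorem residNorm_flatSpin (hs : ∀ u x, c u x = 1 ∨ c u x = -1) (hm : 0 < m) (hn : 0 < n)
    (t : ℕ) (j : Fin m) :
    residNorm (fun s => X.flatSpin c s ω) (t * m + j) = Real.sqrt n * X.bHat c t j ω := by
  have hn' : (n : ℝ) ≠ 0 := by positivity
  rw [residNorm, bHat, ← Real.sqrt_mul (by positivity)]
  congr 1
  have h1 : X.rowC c t t j ω = X.colC c t t j ω := by
    funext a
    rw [rowC, colC, overlapC, overlapC, dotProduct_comm]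
  have h2 := psiHat_eq X c ω hm hn t j
  rw [psiHat] at h2
  rw [h1, h2, resid_flatSpin X c ω hm hn, psiHat_eq X c ω hm hn, mulVec_projCoef,
    sub_dotProduct, dotProduct_sub, dotProduct_sub, colC_eq X c ω hm, smul_dotProduct]
  set S := X.spinHist c t j ω
  set v := X.spinBlock c t j ω
  have h3 : (Sᵀ *ᵥ v) ⬝ᵥ projCoef S v = v ⬝ᵥ (spanProj S *ᵥ v) := by
    rw [← mulVec_projCoef, Matrix.dotProduct_mulVec, Matrix.mulVec_transpose]
  have h4 : (spanProj S *ᵥ v) ⬝ᵥ (spanProj S *ᵥ v) = v ⬝ᵥ (spanProj S *ᵥ v) := by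
    rw [← dotProduct_spanProj, spanProj_mulVec_self]
  rw [h3, h4, dotProduct_comm (spanProj S *ᵥ v) v, X.spinBlock_dotProduct_self c ω hs]
  simp only [smul_eq_mul]
  field_simp
  ring

theorem residNorm_flatSpin_div (hs : ∀ u x, c u x = 1 ∨ c u x = -1) (hm : 0 < m) (hn : 0 < n)
    (t : ℕ) (j : Fin m) :
    residNorm (fun s => X.flatSpin c s ω) (t * m + j) / Real.sqrt (m * n : ℕ)
      = X.bHat c t j ω * Real.sqrt (delta m) := by
  rw [residNorm_flatSpin X c ω hs hm hn, delta]
  have h1 : Real.sqrt m ≠ 0 := by positivity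
  have h2 : Real.sqrt n ≠ 0 := by positivity
  push_cast
  rw [Real.sqrt_mul (by positivity), Real.sqrt_div (by positivity), Real.sqrt_one]
  field_simp

/-- Symmetry of J rewrites Q̂ as a pairing of past spins of block k with J applied to spins of block
j, so the two terms of θ̂ combine into a regression of J f. The normalizations cancel: (1/m) · n ·
(m/n) = 1. -/
theorem delta_smul_thetaHat (hm : 0 < m) (hn : 0 < n)
    (hJ : (Matrix.of (X.J ω))ᵀ = Matrix.of (X.J ω)) (t : ℕ) (j k : Fin m) :
    delta m • X.thetaHat c t j k ω = projCoef (X.spinHist c (thetaLen t j k) k ω)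
      (Matrix.of (X.J ω) *ᵥ resid (fun s => X.flatSpin c s ω) (t * m + j)) := by
  have hm' : (m : ℝ) ≠ 0 := by positivity
  have hn' : (n : ℝ) ≠ 0 := by positivity
  set p := thetaLen t j k
  set A := Matrix.of (X.J ω) with hA
  set S := X.spinHist c p k ω with hS
  have hQ : ∀ a b, X.overlapQ c k j ω a b
      = (m / n : ℝ) * (X.spinBlock c a k ω ⬝ᵥ (A *ᵥ X.spinBlock c b j ω)) := fun a b => by
    rw [overlapQ, field, ← blockProj_dotProduct, blockProj_mulVec_spinBlock, if_pos rfl,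
      dotProduct_mulVec_of_symm hJ, coupledSpin, delta, ← hA]
    push_cast
    field_simp
  have hcol : X.colQ c p t k j ω = (m / n : ℝ) • (Sᵀ *ᵥ (A *ᵥ X.spinBlock c t j ω)) := by
    funext a
    rw [colQ, hQ]
    rfl
  have hmat : X.matQ c p t k j ω = (m / n : ℝ) • (Sᵀ * (A * X.spinHist c t j ω)) := by
    ext a b
    rw [matQ, Matrix.of_apply, hQ]
    rfl
  have h1 : pinv (X.matC c p p k ω) = (n : ℝ) • pinv (Sᵀ * S) := pinv_matC X c ω hm hn p k
  rw [thetaHat, ← Matrix.mulVec_mulVec]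
  have h2 : pinv (X.matC c t t j ω) *ᵥ X.colC c t t j ω = X.psiHat c t j ω := rfl
  rw [h2, ← Matrix.mulVec_mulVec, ← Matrix.mulVec_sub, h1, hcol, hmat,
    resid_flatSpin X c ω hm hn, projCoef, Matrix.smul_mulVec (n : ℝ),
    Matrix.smul_mulVec (m / n : ℝ), ← smul_sub, Matrix.mulVec_smul, smul_smul, smul_smul, delta]
  have h3 : 1 / (m : ℝ) * (n * (m / n)) = 1 := by field_simp
  rw [← mul_assoc] at h3
  rw [h3, one_smul, Matrix.mulVec_sub A, Matrix.mulVec_sub Sᵀ]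
  simp only [Matrix.mulVec_mulVec]

/-- The fields given the past, with the innovation singled out. -/
theorem field_eq_innov (hs : ∀ u x, c u x = 1 ∨ c u x = -1) (hm : 0 < m) (hn : 0 < n)
    (hJ : (Matrix.of (X.J ω))ᵀ = Matrix.of (X.J ω)) (t : ℕ) (j k : Fin m)
    (w : Fin (m * n) → ℝ) {x : Fin (m * n) → ℝ}
    (hx : x = innov (fun s => X.flatSpin c s ω)
      (fun s => Matrix.of (X.J ω) *ᵥ X.flatSpin c s ω) w (t * m + j)) :
    X.field c t j k ω =
      (X.bHat c t j ω * Real.sqrt (delta m)) • (blockProj m n k *ᵥ x)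
      + X.fieldHist c t j k ω *ᵥ X.psiHat c t j ω
      + delta m • (X.spinHist c (thetaLen t j k) k ω *ᵥ X.thetaHat c t j k ω)
      + (X.spinHist c (thetaLen t j k) k ω *ᵥ (-(X.bHat c t j ω * Real.sqrt (delta m)) •
            projCoef (X.spinHist c (thetaLen t j k) k ω) x)
        + if k = j then ((Real.sqrt 2 - 1) / Real.sqrt (m * n : ℕ)
            * (residDir (fun s => X.flatSpin c s ω) (t * m + j) ⬝ᵥ x)) •
            (X.spinBlock c t j ω - X.spinHist c t j ω *ᵥ X.psiHat c t j ω) else 0) := by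
  have h := mulVec_resid_eq_innov (Matrix.of (X.J ω)) (fun s => X.flatSpin c s ω) w (t * m + j)
    (Nat.mul_pos hm hn)
  rw [← hx, residNorm_flatSpin_div X c ω hs hm hn] at h
  set f := resid (fun s => X.flatSpin c s ω) (t * m + j) with hf
  have hf' := resid_flatSpin X c ω hm hn t j
  rw [← hf] at hf'
  have h1 : X.field c t j k ω = X.fieldHist c t j k ω *ᵥ X.psiHat c t j ω
      + blockProj m n k *ᵥ (Matrix.of (X.J ω) *ᵥ f) := by
    rw [fieldHist_mulVec, hf', field, coupledSpin, ← Matrix.mulVec_add, ← Matrix.mulVec_add,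
      add_sub_cancel]
  have h2 := congrArg (fun z => blockProj m n k *ᵥ z) h
  simp only [Matrix.mulVec_sub, Matrix.mulVec_add, Matrix.mulVec_smul] at h2
  rw [← spanProj_spinHist_mulVec_past, ← spanProj_spinHist_mulVec_past,
    blockProj_resid_flatSpin X c ω hm hn, sub_eq_iff_eq_add] at h2
  rw [h1, h2, ← Matrix.mulVec_smul _ (delta m), delta_smul_thetaHat X c ω hm hn hJ,
    mulVec_projCoef, Matrix.mulVec_smul, mulVec_projCoef, ← hf', ← hf, smul_ite, smul_zero,
    smul_sub, neg_smul]
  abel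

end Input

end Identities

/-! ### The error terms -/

section Remainder

/-- Extension of a vector by zero. -/
def extendZero {p : ℕ} (z : Fin p → ℝ) (a : ℕ) : ℝ := if h : a < p then z ⟨a, h⟩ else 0

namespace Exploration

variable {N : ℕ} {𝒰 : Type*} [MeasurableSpace 𝒰] {Ω : Type*} [MeasurableSpace Ω]
  {P : Measure Ω} (E : Exploration N 𝒰 P)

theorem exists_comp_hist {r : ℕ} {β : Type*} [Nonempty β] {f : Ω → β}
    (hf : ∀ ω ω', (∀ s ≤ r, E.v s ω = E.v s ω') → f ω = f ω') :
    ∃ g : (ℕ → Fin N → ℝ) → β, ∀ ω, f ω = g (E.hist r ω) := by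
  have h : f.FactorsThrough (E.hist r) := fun ω ω' h => hf ω ω' ((E.hist_eq_iff r ω ω').1 h)
  obtain ⟨g, hg⟩ := (Function.factorsThrough_iff f).1 h
  exact ⟨g, congrFun hg⟩

theorem measurable_of_hist {r : ℕ} {β : Type*} [MeasurableSpace β] [Nonempty β] {f : Ω → β}
    (hf : ∀ ω ω', (∀ s ≤ r, E.v s ω = E.v s ω') → f ω = f ω') : Measurable f := by
  obtain ⟨g, hg⟩ := E.exists_comp_hist hf
  rw [funext hg]
  exact E.measurable_comp_hist r g

end Exploration

variable {m n : ℕ}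

namespace Input

variable {Ω : Type*} [MeasurableSpace Ω] {P : Measure Ω} (X : Input m n P)
  (c : unitInterval → ℝ → ℝ)

theorem spinHist_mulVec (p : ℕ) (k : Fin m) (ω : Ω) (g : ℕ → ℝ) :
    X.spinHist c p k ω *ᵥ (fun a => g a) = ∑ a ∈ Finset.range p, g a • X.spinBlock c a k ω := by
  funext i
  rw [Finset.sum_apply, ← Fin.sum_univ_eq_sum_range (fun a => (g a • X.spinBlock c a k ω) i)]
  simp [Matrix.mulVec, dotProduct, spinHist, mul_comm]

theorem spinHist_mulVec_extendZero {p q : ℕ} (h : p ≤ q) (k : Fin m) (ω : Ω) (z : Fin p → ℝ) :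
    ∑ a ∈ Finset.range q, extendZero z a • X.spinBlock c a k ω = X.spinHist c p k ω *ᵥ z := by
  have h1 : z = fun a : Fin p => extendZero z a := by
    funext a; simp [extendZero]
  conv_rhs => rw [h1, spinHist_mulVec]
  refine (Finset.sum_subset (Finset.range_mono h) fun a _ ha => ?_).symm
  rw [extendZero, dif_neg (by simpa using ha), zero_smul]

/-- Lets the coefficients over the shorter regression range be padded by zeros to the length of Δ.
-/
theorem thetaLen_le_errLen (t : ℕ) (j k : Fin m) : thetaLen t j k ≤ errLen t j k := by
  unfold thetaLen errLen
  split_ifs with h1 h2 h3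
  · exact absurd h2.2 (not_lt.2 h1.le)
  · exact le_rfl
  · exact le_rfl
  · exact Nat.le_succ t

variable [NeZero m]

/-- The coefficients of the error term, for the innovation `x`. -/
def errCoef (t : ℕ) (j k : Fin m) (x : Fin (m * n) → ℝ) (ω : Ω) (a : ℕ) : ℝ :=
  -(X.bHat c t j ω * Real.sqrt (delta m)
      * extendZero (projCoef (X.spinHist c (thetaLen t j k) k ω) x) a)
  + (if k = j then (Real.sqrt 2 - 1) / Real.sqrt (m * n : ℕ)
      * (residDir (fun s => X.flatSpin c s ω) (t * m + j) ⬝ᵥ x)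
      * ((if a = t then 1 else 0) - extendZero (X.psiHat c t j ω) a) else 0)
  + (if t = 0 then delta m * extendZero (X.thetaHat c t j k ω) a else 0)

/-- The three summands have separate origins: ξ keeps its full covariance D^k although the field
only involves its part orthogonal to the past; J has doubled variance along the residual, which is
seen only when k = j; and the formula at time zero has no θ̂ term, so that term is absorbed in Δ. -/
theorem spinHist_mulVec_errCoef (t : ℕ) (j k : Fin m) (x : Fin (m * n) → ℝ) (ω : Ω) :
    X.spinHist c (errLen t j k) k ω *ᵥ (fun a => X.errCoef c t j k x ω a)
      = X.spinHist c (thetaLen t j k) k ω *ᵥ (-(X.bHat c t j ω * Real.sqrt (delta m)) •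
            projCoef (X.spinHist c (thetaLen t j k) k ω) x)
        + (if k = j then ((Real.sqrt 2 - 1) / Real.sqrt (m * n : ℕ)
            * (residDir (fun s => X.flatSpin c s ω) (t * m + j) ⬝ᵥ x)) •
            (X.spinBlock c t j ω - X.spinHist c t j ω *ᵥ X.psiHat c t j ω) else 0)
        + if t = 0 then delta m • (X.spinHist c (thetaLen t j k) k ω *ᵥ X.thetaHat c t j k ω)
            else 0 := by
  have hle := thetaLen_le_errLen t j k
  rw [spinHist_mulVec]
  simp only [errCoef, add_smul, Finset.sum_add_distrib]
  congr 1
  · congr 1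
    · rw [Matrix.mulVec_smul, ← X.spinHist_mulVec_extendZero c hle, Finset.smul_sum]
      refine Finset.sum_congr rfl fun a _ => ?_
      rw [smul_smul, neg_mul]
    · split_ifs with h
      · subst h
        have he : errLen t k k = t + 1 := if_neg fun h => lt_irrefl _ h.2
        rw [he, ← X.spinHist_mulVec_extendZero c t.le_succ]
        simp only [mul_smul]
        simp only [← Finset.smul_sum, sub_smul, Finset.sum_sub_distrib, ite_smul, one_smul,
          zero_smul, Finset.sum_ite_eq', Finset.mem_range]
        rw [if_pos t.lt_succ_self]
      · simp
  · split_ifs with h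
    · rw [← X.spinHist_mulVec_extendZero c hle, Finset.smul_sum]
      exact Finset.sum_congr rfl fun a _ => mul_smul _ _ _
    · simp

end Input

/-! ### Measurability of the overlaps and error coefficients -/

section Measurability

variable {Ω : Type*} [MeasurableSpace Ω] {P : Measure Ω}
  (X : Input m n P) {c : unitInterval → ℝ → ℝ} [NeZero m]

namespace Input

theorem spinBlock_eq_of_hist {t a : ℕ} {j k : Fin m} (h : a * m + k ≤ t * m + j) {ω ω' : Ω}
    (hω : ∀ s ≤ t * m + j, X.flatSpin c s ω = X.flatSpin c s ω') :
    X.spinBlock c a k ω = X.spinBlock c a k ω' := by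
  rw [← X.flatSpin_mul_add c, ← X.flatSpin_mul_add c, hω _ h]

theorem spinHist_eq_of_hist {t : ℕ} {j k : Fin m} {ω ω' : Ω}
    (hω : ∀ s ≤ t * m + j, X.flatSpin c s ω = X.flatSpin c s ω') :
    X.spinHist c (thetaLen t j k) k ω = X.spinHist c (thetaLen t j k) k ω' := by
  ext i a
  exact congrFun (X.spinBlock_eq_of_hist (lt_thetaLen_iff.1 a.2).le hω) i

theorem matC_eq_of_hist {t : ℕ} {j k : Fin m} {ω ω' : Ω}
    (hω : ∀ s ≤ t * m + j, X.flatSpin c s ω = X.flatSpin c s ω') :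
    X.matC c (thetaLen t j k) (thetaLen t j k) k ω
      = X.matC c (thetaLen t j k) (thetaLen t j k) k ω' := by
  ext a b
  rw [matC, matC, Matrix.of_apply, Matrix.of_apply, overlapC, overlapC,
    X.spinBlock_eq_of_hist (lt_thetaLen_iff.1 a.2).le hω,
    X.spinBlock_eq_of_hist (lt_thetaLen_iff.1 b.2).le hω]

theorem colC_eq_of_hist {t : ℕ} {j : Fin m} {ω ω' : Ω}
    (hω : ∀ s ≤ t * m + j, X.flatSpin c s ω = X.flatSpin c s ω') :
    X.colC c t t j ω = X.colC c t t j ω' := by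
  funext a
  have ha : (a : ℕ) < thetaLen t j j := (thetaLen_self t j).symm ▸ a.2
  rw [colC, colC, overlapC, overlapC, X.spinBlock_eq_of_hist (lt_thetaLen_iff.1 ha).le hω,
    X.spinBlock_eq_of_hist le_rfl hω]

theorem psiHat_eq_of_hist {t : ℕ} {j : Fin m} {ω ω' : Ω}
    (hω : ∀ s ≤ t * m + j, X.flatSpin c s ω = X.flatSpin c s ω') :
    X.psiHat c t j ω = X.psiHat c t j ω' := by
  have h := X.matC_eq_of_hist (k := j) hω
  rw [thetaLen_self] at h
  rw [psiHat, psiHat, h, X.colC_eq_of_hist hω]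

theorem bHat_eq_of_hist {t : ℕ} {j : Fin m} {ω ω' : Ω}
    (hω : ∀ s ≤ t * m + j, X.flatSpin c s ω = X.flatSpin c s ω') :
    X.bHat c t j ω = X.bHat c t j ω' := by
  have h1 : ∀ ω, X.rowC c t t j ω = X.colC c t t j ω := fun ω => by
    funext a
    rw [rowC, colC, overlapC, overlapC, dotProduct_comm]
  have h2 := X.psiHat_eq_of_hist hω
  rw [psiHat, psiHat] at h2
  rw [bHat, bHat, h1, h1, h2, X.colC_eq_of_hist hω]

theorem residDir_eq_of_hist {r : ℕ} {ω ω' : Ω}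
    (hω : ∀ s ≤ r, X.flatSpin c s ω = X.flatSpin c s ω') :
    residDir (fun s => X.flatSpin c s ω) r = residDir (fun s => X.flatSpin c s ω') r := by
  have h1 : colMat (fun s => X.flatSpin c s ω) r = colMat (fun s => X.flatSpin c s ω') r :=
    colMat_congr fun s hs => hω s hs.le
  rw [residDir, residDir, residNorm, residNorm, resid, resid, pastProj, pastProj, h1, hω r le_rfl]

variable [IsProbabilityMeasure P]

theorem measurable_spinBlock (hc : Measurable (Function.uncurry c))
    (hs : ∀ u x, c u x = 1 ∨ c u x = -1) (t : ℕ) (j : Fin m) :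
    Measurable (X.spinBlock c t j) := by
  rw [← funext (X.flatSpin_mul_add c t j)]
  exact (X.exploration hc hs).measurable_v _

/-- The pseudo-inverses are functions of the finite-range spin history. The factor Q̂ involves the
fields and is treated as an explicit polynomial expression in J and the spins. -/
theorem measurable_thetaHat (hc : Measurable (Function.uncurry c))
    (hs : ∀ u x, c u x = 1 ∨ c u x = -1) (t : ℕ) (j k : Fin m) :
    Measurable (X.thetaHat c t j k) := by
  have hσ := X.measurable_spinBlock hc hs
  have h1 : ∀ a b, Measurable fun ω =>
      pinv (X.matC c (thetaLen t j k) (thetaLen t j k) k ω) a b := fun a b =>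
    (X.exploration hc hs).measurable_of_hist (r := t * m + j)
      fun ω ω' h => by rw [X.matC_eq_of_hist h]
  have h2 : ∀ a b, Measurable fun ω => pinv (X.matC c t t j ω) a b := fun a b =>
    (X.exploration hc hs).measurable_of_hist (r := t * m + j) fun ω ω' h => by
      have h := X.matC_eq_of_hist (k := j) h
      rw [thetaLen_self] at h
      rw [h]
  have h3 : Measurable fun ω => X.colC c t t j ω :=
    (X.exploration hc hs).measurable_of_hist (r := t * m + j)
      fun ω ω' h => by rw [X.colC_eq_of_hist h]
  have h4 : ∀ a b, Measurable fun ω => X.overlapQ c k j ω a b := fun a b => by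
    unfold overlapQ
    refine (measurable_dotProduct (measurable_mulVec _ ?_) (hσ b j)).const_mul _
    exact measurable_of_mulVec X.measurable_J (hσ a k)
  refine measurable_pi_lambda _ fun a => ?_
  simp only [thetaHat, Pi.sub_apply, Matrix.mulVec, dotProduct, Matrix.mul_apply, colQ, matQ,
    Matrix.of_apply]
  fun_prop

theorem measurable_errCoef (hc : Measurable (Function.uncurry c))
    (hs : ∀ u x, c u x = 1 ∨ c u x = -1) (t : ℕ) (j k : Fin m) (a : ℕ)
    {x : Ω → Fin (m * n) → ℝ} (hx : Measurable x) :
    Measurable (fun ω => X.errCoef c t j k (x ω) ω a) := by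
  have h1 : Measurable (X.bHat c t j) := (X.exploration hc hs).measurable_of_hist (r := t * m + j)
    fun ω ω' h => X.bHat_eq_of_hist h
  have h2 : Measurable (X.psiHat c t j) := (X.exploration hc hs).measurable_of_hist
    (r := t * m + j) fun ω ω' h => X.psiHat_eq_of_hist h
  have h3 : Measurable fun ω => residDir (fun s => X.flatSpin c s ω) (t * m + j) :=
    (X.exploration hc hs).measurable_of_hist (r := t * m + j) fun ω ω' h => X.residDir_eq_of_hist h
  have h4 : ∀ b i, Measurable fun ω => (pinv ((X.spinHist c (thetaLen t j k) k ω)ᵀ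
      * X.spinHist c (thetaLen t j k) k ω) * (X.spinHist c (thetaLen t j k) k ω)ᵀ) b i :=
    fun b i =>
    (X.exploration hc hs).measurable_of_hist (r := t * m + j)
      fun ω ω' h => by rw [X.spinHist_eq_of_hist h]
  have h5 := X.measurable_thetaHat hc hs t j k
  have h6 := measurable_dotProduct h3 hx
  have h7 : Measurable fun ω =>
      extendZero (projCoef (X.spinHist c (thetaLen t j k) k ω) (x ω)) a := by
    refine measurable_dite_const (fun ha => ?_) measurable_const
    simp only [projCoef, Matrix.mulVec_mulVec]
    exact measurable_dotProduct (measurable_pi_lambda _ fun i => h4 _ i) hx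
  have h8 : Measurable fun ω => extendZero (X.psiHat c t j ω) a :=
    measurable_dite_const (fun ha => (measurable_pi_apply _).comp h2) measurable_const
  have h9 : Measurable fun ω => extendZero (X.thetaHat c t j k ω) a :=
    measurable_dite_const (fun ha => (measurable_pi_apply _).comp h5) measurable_const
  unfold errCoef
  refine Measurable.add (Measurable.add ?_ ?_) ?_
  · exact ((h1.mul_const _).mul h7).neg
  · exact measurable_dite_const (f := fun _ ω => _)
      (fun _ => (h6.const_mul _).mul (h8.const_sub _)) measurable_const
  · exact measurable_dite_const (f := fun _ ω => _) (fun _ => h9.const_mul _) measurable_const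

end Input

end Measurability

/-! ### Law and independence of the decoded innovations -/

section Law

variable {Ω : Type*} [MeasurableSpace Ω] {P : Measure Ω}

theorem IsCenteredGaussian.blockProj {x : Ω → Fin (m * n) → ℝ}
    (hx : IsCenteredGaussian x (1 : Matrix (Fin (m * n)) (Fin (m * n)) ℝ) P) (k : Fin m) :
    IsCenteredGaussian (fun ω => blockProj m n k *ᵥ x ω) (BlockScan.blockProj m n k) P := by
  refine ⟨HasGaussianLaw.comp_isLinearMap hx.1 (g := fun y => BlockScan.blockProj m n k *ᵥ y)
    ⟨fun _ _ => Matrix.mulVec_add _ _ _, fun _ _ => Matrix.mulVec_smul _ _ _⟩, fun a => ?_,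
    fun a b => ?_⟩
  · simp only [blockProj_mulVec_apply]
    split_ifs
    · exact hx.2.1 a
    · simp
  · have := hx.2.2 a b
    rw [Matrix.one_apply] at this
    simp only [blockProj_mulVec_apply]
    rw [BlockScan.blockProj, Matrix.diagonal_apply]
    by_cases h1 : a = b
    · subst h1
      by_cases h2 : InBlock (k : ℕ) a <;> simp_all
    · rw [if_neg h1] at this ⊢
      split_ifs <;> simp [this]

variable [IsProbabilityMeasure P] (X : Input m n P) {c : unitInterval → ℝ → ℝ} [NeZero m]

theorem Input.isCenteredGaussian_decodedInnov (hc : Measurable (Function.uncurry c))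
    (hs : ∀ u x, c u x = 1 ∨ c u x = -1) (hn : 0 < n) (r : ℕ) :
    IsCenteredGaussian (X.decodedInnov c r) (1 : Matrix (Fin (m * n)) (Fin (m * n)) ℝ) P := by
  have h := X.ae_decodedInnov_eq hc hs hn r
  refine ((X.exploration hc hs).xi_spec r).1.of_map_eq ?_ (Measure.map_congr h)
  exact ((X.exploration hc hs).measurable_xi r).aemeasurable.congr h.symm

theorem Input.iIndepFun_decodedInnov (hc : Measurable (Function.uncurry c))
    (hs : ∀ u x, c u x = 1 ∨ c u x = -1) (hn : 0 < n) (k : Fin m) :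
    iIndepFun (fun (p : ℕ × Fin m) ω => blockProj m n k *ᵥ X.decodedInnov c (p.1 * m + p.2) ω)
      P := by
  have h1 : iIndepFun (X.decodedInnov c) P :=
    (X.exploration hc hs).iIndepFun_xi.congr fun r => (X.ae_decodedInnov_eq hc hs hn r).symm
  have hinj : Function.Injective (fun p : ℕ × Fin m => p.1 * m + (p.2 : ℕ)) := by
    have hm : 0 < m := Nat.pos_of_ne_zero (NeZero.ne m)
    rintro ⟨t, j⟩ ⟨s, l⟩ h
    simp only at h
    have e1 := congrArg (· / m) h
    have e2 := congrArg (· % m) h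
    simp only [mul_comm _ m, Nat.mul_add_div hm, Nat.mul_add_mod, Nat.div_eq_of_lt j.2,
      Nat.div_eq_of_lt l.2, add_zero, Nat.mod_eq_of_lt j.2, Nat.mod_eq_of_lt l.2] at e1 e2
    exact Prod.ext e1 (Fin.ext e2)
  exact (h1.precomp hinj).comp (fun _ x => blockProj m n k *ᵥ x)
    fun _ => measurable_mulVec _ measurable_id

end Law

end Remainder

/-! ### Convergence to zero in probability -/

namespace TendstoZeroInProbability

variable {Ω : ℕ → Type*} [∀ n, MeasurableSpace (Ω n)] {P : ∀ n, Measure (Ω n)}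
  {Y Z : ∀ n, Ω n → ℝ}

theorem of_abs_le (hZ : TendstoZeroInProbability P Z) (h : ∀ n ω, |Y n ω| ≤ |Z n ω|) :
    TendstoZeroInProbability P Y := fun ε hε =>
  tendsto_of_tendsto_of_tendsto_of_le_of_le tendsto_const_nhds (hZ ε hε) (fun _ => zero_le)
    fun n => measure_mono fun ω hω => le_trans hω (h n ω)

theorem zero : TendstoZeroInProbability P (fun _ _ => 0) := fun ε hε => by
  simp [not_le.2 hε]

theorem add (hY : TendstoZeroInProbability P Y) (hZ : TendstoZeroInProbability P Z) :
    TendstoZeroInProbability P (fun n ω => Y n ω + Z n ω) := fun ε hε => by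
  have h := (hY (ε / 2) (by positivity)).add (hZ (ε / 2) (by positivity))
  rw [add_zero] at h
  refine tendsto_of_tendsto_of_tendsto_of_le_of_le tendsto_const_nhds h (fun _ => zero_le)
    fun n => (measure_mono fun ω hω => ?_).trans (measure_union_le _ _)
  by_contra hc
  simp only [Set.mem_union, Set.mem_ofPred_eq, not_or, not_le] at hc hω
  have := abs_add_le (Y n ω) (Z n ω)
  linarith

theorem sum {ι : Type*} {s : Finset ι} {Y : ι → ∀ n, Ω n → ℝ}
    (h : ∀ i ∈ s, TendstoZeroInProbability P (Y i)) :
    TendstoZeroInProbability P (fun n ω => ∑ i ∈ s, Y i n ω) := by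
  classical
  induction s using Finset.induction_on with
  | empty => simpa using zero
  | insert i s hi ih =>
    simp only [Finset.sum_insert hi]
    exact (h i (Finset.mem_insert_self i s)).add
      (ih fun k hk => h k (Finset.mem_insert_of_mem hk))

theorem abs (h : TendstoZeroInProbability P Y) :
    TendstoZeroInProbability P (fun n ω => |Y n ω|) :=
  h.of_abs_le fun n ω => by rw [abs_abs]

theorem sqrt_sum_sq {s : Finset ℕ} {p : ℕ → ℕ} {Y : ∀ n (a : ℕ), Fin (p a) → Ω n → ℝ}
    (h : ∀ a ∈ s, ∀ b, TendstoZeroInProbability P (fun n => Y n a b)) :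
    TendstoZeroInProbability P (fun n ω => Real.sqrt (∑ a ∈ s, ∑ b, Y n a b ω ^ 2)) := by
  have h1 : TendstoZeroInProbability P (fun n ω => ∑ a ∈ s, ∑ b, |Y n a b ω|) :=
    sum fun a ha => sum fun b _ => (h a ha b).abs
  refine h1.of_abs_le fun n ω => ?_
  have h2 : 0 ≤ ∑ a ∈ s, ∑ b, |Y n a b ω| :=
    Finset.sum_nonneg fun a _ => Finset.sum_nonneg fun b _ => abs_nonneg _
  rw [abs_of_nonneg (Real.sqrt_nonneg _), abs_of_nonneg h2]
  refine Real.sqrt_le_iff.2 ⟨h2, ?_⟩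
  calc ∑ a ∈ s, ∑ b, Y n a b ω ^ 2 ≤ ∑ a ∈ s, (∑ b, |Y n a b ω|) ^ 2 := by
        refine Finset.sum_le_sum fun a _ => ?_
        simpa only [sq_abs] using
          Finset.sum_sq_le_sq_sum_of_nonneg (s := Finset.univ) fun b _ => abs_nonneg (Y n a b ω)
    _ ≤ _ := Finset.sum_sq_le_sq_sum_of_nonneg fun a _ => Finset.sum_nonneg fun b _ => abs_nonneg _

/-- A criterion with an exceptional set of small probability. -/
theorem of_le (h : ∀ ε : ℝ, 0 < ε → ∀ η : ℝ, 0 < η →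
    ∀ᶠ n in atTop, P n {ω | ε ≤ |Y n ω|} ≤ ENNReal.ofReal η) : TendstoZeroInProbability P Y := by
  intro ε hε
  rw [ENNReal.tendsto_nhds_zero]
  intro η hη
  rcases eq_or_ne η ⊤ with rfl | htop
  · simp
  · have := h ε hε η.toReal (ENNReal.toReal_pos hη.ne' htop)
    rwa [ENNReal.ofReal_toReal htop] at this

end TendstoZeroInProbability

/-! ### Conditional counting -/

section Counting

variable {Ω : Type*} [MeasurableSpace Ω] {P : Measure Ω} [IsProbabilityMeasure P]

theorem indepFun_prodMk_prodMk {α β γ δ : Type*} [MeasurableSpace α] [MeasurableSpace β]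
    [MeasurableSpace γ] [MeasurableSpace δ] {A : Ω → α} {B : Ω → β} {C : Ω → γ} {D : Ω → δ}
    (hA : Measurable A) (hB : Measurable B) (hC : Measurable C) (hD : Measurable D)
    (h : IndepFun (fun ω => (A ω, C ω)) (fun ω => (B ω, D ω)) P) (hAC : IndepFun A C P)
    (hBD : IndepFun B D P) : IndepFun (fun ω => (A ω, B ω)) (fun ω => (C ω, D ω)) P := by
  have h1 : IndepFun B (fun ω => (C ω, D ω)) P := by
    refine (indepFun_prodMk_left hC hD hB ?_ hBD.symm).symm
    exact h.comp (φ := Prod.snd) (ψ := Prod.swap) measurable_snd measurable_swap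
  have h2 : IndepFun (fun ω => ((B ω, D ω), C ω)) A P :=
    indepFun_prodMk_left (hB.prodMk hD) hC hA
      (h.symm.comp (φ := id) (ψ := Prod.swap) measurable_id measurable_swap) hAC.symm
  have h3 : IndepFun A (fun ω => (B ω, (C ω, D ω))) P :=
    (h2.comp (φ := fun z : (β × δ) × γ => (z.1.1, (z.2, z.1.2))) (ψ := id) (by fun_prop)
      measurable_id).symm
  exact indepFun_prodMk_left hA hB (hC.prodMk hD) h3 h1

/-- Fubini: conditionally on R = ρ, the law of Z is unchanged. -/
theorem measure_inter_le_of_indepFun {ℛ 𝒵 : Type*} [MeasurableSpace ℛ] [MeasurableSpace 𝒵]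
    {R : Ω → ℛ} {Z : Ω → 𝒵} (hR : Measurable R) (hZ : Measurable Z) (h : IndepFun R Z P)
    {B : Set ℛ} (hB : MeasurableSet B) {E : Set (ℛ × 𝒵)} (hE : MeasurableSet E) {c : ENNReal}
    (hc : ∀ ρ ∈ B, P {ω | (ρ, Z ω) ∈ E} ≤ c) :
    P {ω | R ω ∈ B ∧ (R ω, Z ω) ∈ E} ≤ P {ω | R ω ∈ B} * c := by
  have : IsProbabilityMeasure (P.map R) := Measure.isProbabilityMeasure_map hR.aemeasurable
  have : IsProbabilityMeasure (P.map Z) := Measure.isProbabilityMeasure_map hZ.aemeasurable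
  rw [indepFun_iff_map_prod_eq_prod_map_map hR.aemeasurable hZ.aemeasurable] at h
  have hBE : MeasurableSet (Prod.fst ⁻¹' B ∩ E) := (measurable_fst hB).inter hE
  have h1 : P {ω | R ω ∈ B ∧ (R ω, Z ω) ∈ E}
      = (P.map fun ω => (R ω, Z ω)) (Prod.fst ⁻¹' B ∩ E) :=
    (Measure.map_apply (hR.prodMk hZ) hBE).symm
  rw [h1, h, Measure.prod_apply hBE]
  calc ∫⁻ ρ, P.map Z (Prod.mk ρ ⁻¹' (Prod.fst ⁻¹' B ∩ E)) ∂P.map R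
      ≤ ∫⁻ ρ, B.indicator (fun _ => c) ρ ∂P.map R := by
        refine lintegral_mono fun ρ => ?_
        by_cases hρ : ρ ∈ B
        · rw [Set.indicator_of_mem hρ, Measure.map_apply hZ (measurable_prodMk_left hBE)]
          exact (measure_mono fun ω hω => hω.2).trans (hc ρ hρ)
        · have : Prod.mk ρ ⁻¹' (Prod.fst ⁻¹' B ∩ E) = ∅ := by
            ext z; simp [hρ]
          rw [this, measure_empty]
          exact zero_le
    _ = P {ω | R ω ∈ B} * c := by
        rw [lintegral_indicator_const hB, Measure.map_apply hR hB, mul_comm]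
        rfl

open Classical in
/-- Chebyshev's inequality for the number of occurrences among pairwise independent events. -/
theorem measure_count_lt_le {q : ℕ} {E : Fin q → Set Ω} (hE : ∀ p, MeasurableSet (E p))
    (hind : Pairwise fun p p' => IndepFun ((E p).indicator fun _ => (1 : ℝ))
      ((E p').indicator fun _ => (1 : ℝ)) P)
    {κ : ℝ} (hκ : 0 < κ) (hq : 0 < q) {G : Finset (Fin q)} (hG : (q : ℝ) / 2 ≤ G.card)
    (hGκ : ∀ p ∈ G, κ ≤ P.real (E p)) :
    P {ω | ((Finset.univ.filter fun p => ω ∈ E p).card : ℝ) < κ * q / 4}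
      ≤ ENNReal.ofReal (16 / (κ ^ 2 * q)) := by
  have hq' : (0 : ℝ) < q := by exact_mod_cast hq
  have hmem : ∀ p, MemLp ((E p).indicator fun _ => (1 : ℝ)) 2 P := fun p =>
    (memLp_const 1).indicator (hE p)
  -- Only events in G have a known lower bound; the others can only increase the count.
  set S : Ω → ℝ := ∑ p ∈ G, (E p).indicator fun _ => (1 : ℝ) with hS
  have hSmem : MemLp S 2 P := memLp_finsetSum' G fun p _ => hmem p
  have hmean : κ * q / 2 ≤ ∫ ω, S ω ∂P := by
    have : ∫ ω, S ω ∂P = ∑ p ∈ G, P.real (E p) := by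
      simp only [hS, Finset.sum_apply]
      rw [integral_finsetSum _ fun p _ => (hmem p).integrable (by norm_num)]
      refine Finset.sum_congr rfl fun p _ => ?_
      rw [integral_indicator_const _ (hE p), smul_eq_mul, mul_one]
    rw [this]
    calc κ * q / 2 ≤ G.card * κ := by nlinarith
      _ = ∑ p ∈ G, κ := by rw [Finset.sum_const, nsmul_eq_mul]
      _ ≤ _ := Finset.sum_le_sum hGκ
  have hvar : Var[S; P] ≤ q := by
    rw [hS, IndepFun.variance_sum (fun p _ => hmem p) fun p _ p' _ hne => hind hne]
    calc ∑ p ∈ G, Var[(E p).indicator fun _ => (1 : ℝ); P] ≤ ∑ p ∈ G, 1 := by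
          refine Finset.sum_le_sum fun p _ => ?_
          refine (variance_le_expectation_sq (hmem p).1).trans ?_
          have : ((E p).indicator fun _ => (1 : ℝ)) ^ 2 = (E p).indicator fun _ => (1 : ℝ) := by
            funext ω
            by_cases h : ω ∈ E p <;> simp [h]
          rw [this, integral_indicator_const _ (hE p), smul_eq_mul, mul_one]
          exact measureReal_le_one
      _ = G.card := by simp
      _ ≤ q := by
          have := Finset.card_le_univ G
          rw [Fintype.card_fin] at this
          exact_mod_cast this
  have hle : {ω | ((Finset.univ.filter fun p => ω ∈ E p).card : ℝ) < κ * q / 4}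
      ⊆ {ω | κ * q / 4 ≤ |S ω - ∫ ω, S ω ∂P|} := by
    intro ω hω
    simp only [Set.mem_ofPred_eq] at hω ⊢
    have h1 : S ω ≤ ((Finset.univ.filter fun p => ω ∈ E p).card : ℝ) := by
      rw [hS, Finset.sum_apply, Finset.card_filter]
      push_cast
      refine (Finset.sum_le_sum_of_subset_of_nonneg (Finset.subset_univ G) fun p _ _ =>
        Set.indicator_nonneg (fun _ _ => zero_le_one) _).trans (le_of_eq ?_)
      refine Finset.sum_congr rfl fun p _ => ?_
      by_cases h : ω ∈ E p <;> simp [h]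
    rw [abs_sub_comm]
    refine le_trans ?_ (le_abs_self _)
    linarith
  -- The threshold κ q / 4 is at most half the mean and the variance is at most q, which gives q /
  -- (κ q / 4)² = 16 / (κ² q).
  refine (measure_mono hle).trans ((meas_ge_le_variance_div_sq hSmem (by positivity)).trans ?_)
  refine ENNReal.ofReal_le_ofReal ?_
  rw [div_le_div_iff₀ (by positivity) (by positivity)]
  have : 0 < κ ^ 2 * q := by positivity
  nlinarith

open Classical in
/-- A conditional version of `measure_count_lt_le`. -/
theorem measure_few_le {q : ℕ} {ℛ 𝒵 : Type*} [MeasurableSpace ℛ] [MeasurableSpace 𝒵]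
    {R : Ω → ℛ} {Z : Fin q → Ω → 𝒵} (hR : Measurable R) (hZ : ∀ p, Measurable (Z p))
    (hRZ : IndepFun R (fun ω p => Z p ω) P) (hind : Pairwise fun p p' => IndepFun (Z p) (Z p') P)
    {A : Fin q → Set (ℛ × 𝒵)} (hA : ∀ p, MeasurableSet (A p)) {κ : ℝ} (hκ : 0 < κ) (hq : 0 < q)
    {B : Set ℛ} (hB : MeasurableSet B)
    (hBG : ∀ ρ ∈ B, ∃ G : Finset (Fin q), (q : ℝ) / 2 ≤ G.card ∧
      ∀ p ∈ G, κ ≤ P.real {ω | (ρ, Z p ω) ∈ A p}) :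
    P {ω | R ω ∈ B ∧
        ((Finset.univ.filter fun p => (R ω, Z p ω) ∈ A p).card : ℝ) < κ * q / 4}
      ≤ P {ω | R ω ∈ B} * ENNReal.ofReal (16 / (κ ^ 2 * q)) := by
  have hE : MeasurableSet {x : ℛ × (Fin q → 𝒵) |
      ((Finset.univ.filter fun p => (x.1, x.2 p) ∈ A p).card : ℝ) < κ * q / 4} := by
    refine measurableSet_lt ?_ measurable_const
    simp only [Finset.card_filter]
    push_cast
    refine Finset.measurable_sum _ fun p _ => Measurable.ite ?_ measurable_const measurable_const
    exact (by fun_prop : Measurable fun x : ℛ × (Fin q → 𝒵) => (x.1, x.2 p)) (hA p)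
  refine measure_inter_le_of_indepFun hR (measurable_pi_lambda _ hZ) hRZ hB hE fun ρ hρ => ?_
  -- The set of good indices may vary with the conditioning value; only its size matters.
  obtain ⟨G, hG, hGκ⟩ := hBG ρ hρ
  have hAρ : ∀ p, MeasurableSet {z | (ρ, z) ∈ A p} := fun p => measurable_prodMk_left (hA p)
  refine measure_count_lt_le (E := fun p => {ω | (ρ, Z p ω) ∈ A p})
    (fun p => hZ p (hAρ p)) (fun p p' hne => ?_) hκ hq hG hGκ
  have hm : ∀ p, Measurable ({z | (ρ, z) ∈ A p}.indicator fun _ => (1 : ℝ)) := fun p =>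
    measurable_const.indicator (hAρ p)
  exact (hind hne).comp (hm p) (hm p')

end Counting

/-! ### Uniform lower bounds for Gaussian probabilities -/

section GaussianLower

open scoped NNReal

/-- Comparison of densities on [-M, M]: v ≤ 1 makes the normalizing constant at least the standard
one, the exponent is at least -(M + K)² / (2 β), and the standard exponential is at most 1. -/
theorem gaussianReal_lower {K M β : ℝ} (hβ : 0 < β) {o : ℝ} (ho : |o| ≤ K) {v : ℝ≥0}
    (hv : β ≤ v) (hv1 : v ≤ 1) {S : Set ℝ} :
    ENNReal.ofReal (Real.exp (-(M + K) ^ 2 / (2 * β)))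
      * gaussianReal 0 1 (S ∩ Set.Icc (-M) M) ≤ gaussianReal o v S := by
  have hv0 : v ≠ 0 := by
    rintro rfl
    simp only [NNReal.coe_zero] at hv
    linarith
  rw [gaussianReal_apply 0 one_ne_zero, gaussianReal_apply o hv0]
  rw [← lintegral_const_mul _ (by fun_prop)]
  refine (setLIntegral_mono (by fun_prop) (g := gaussianPDF o v) ?_).trans
    (lintegral_mono_set Set.inter_subset_left)
  rintro x ⟨_, hx⟩
  rw [gaussianPDF, gaussianPDF, ← ENNReal.ofReal_mul (Real.exp_pos _).le]
  refine ENNReal.ofReal_le_ofReal ?_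
  rw [gaussianPDFReal, gaussianPDFReal]
  have hvpos : (0 : ℝ) < v := hβ.trans_le hv
  have h1 : (Real.sqrt (2 * Real.pi * ((1 : ℝ≥0) : ℝ)))⁻¹ ≤ (Real.sqrt (2 * Real.pi * v))⁻¹ := by
    refine inv_anti₀ (Real.sqrt_pos.2 (by positivity)) (Real.sqrt_le_sqrt ?_)
    have : (v : ℝ) ≤ ((1 : ℝ≥0) : ℝ) := by exact_mod_cast hv1
    exact mul_le_mul_of_nonneg_left this (by positivity)
  have hxo : (x - o) ^ 2 ≤ (M + K) ^ 2 := by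
    refine sq_le_sq' ?_ ?_ <;> have := abs_le.1 ho <;> linarith [hx.1, hx.2]
  have h2 : Real.exp (-(M + K) ^ 2 / (2 * β)) ≤ Real.exp (-(x - o) ^ 2 / (2 * v)) := by
    refine Real.exp_le_exp.2 ?_
    rw [neg_div, neg_div, neg_le_neg_iff]
    exact div_le_div₀ (by positivity) hxo (by positivity) (by linarith)
  have h3 : Real.exp (-(x - 0) ^ 2 / (2 * ((1 : ℝ≥0) : ℝ))) ≤ 1 := by
    refine Real.exp_le_one_iff.2 ?_
    rw [neg_div]
    exact neg_nonpos.2 (by positivity)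
  calc _ = (Real.sqrt (2 * Real.pi * ((1 : ℝ≥0) : ℝ)))⁻¹
        * (Real.exp (-(M + K) ^ 2 / (2 * β))
          * Real.exp (-(x - 0) ^ 2 / (2 * ((1 : ℝ≥0) : ℝ)))) := by
        ring
    _ ≤ (Real.sqrt (2 * Real.pi * v))⁻¹ * (Real.exp (-(x - o) ^ 2 / (2 * v)) * 1) := by
        gcongr
    _ = _ := by rw [mul_one]

/-- Sets charged by the standard Gaussian are uniformly charged by the Gaussian laws with bounded
means and nondegenerate variances. -/
theorem exists_gaussian_lower {𝒰 : Type*} [MeasurableSpace 𝒰] {μ : Measure 𝒰} [IsFiniteMeasure μ]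
    {A : Set (𝒰 × ℝ)} (hA : MeasurableSet A) (hpos : 0 < (μ.prod (gaussianReal 0 1)) A) (K : ℝ)
    {β : ℝ} (hβ : 0 < β) : ∃ κ : ℝ, 0 < κ ∧ ∀ (o : ℝ), |o| ≤ K → ∀ v : ℝ≥0, β ≤ v → v ≤ 1 →
      ENNReal.ofReal κ ≤ (μ.prod (gaussianReal o v)) A := by
  have hmono : Monotone fun M : ℕ => A ∩ Prod.snd ⁻¹' Set.Icc (-(M : ℝ)) M := by
    intro M M' h x hx
    have : (M : ℝ) ≤ M' := by exact_mod_cast h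
    exact ⟨hx.1, by linarith [hx.2.1], hx.2.2.trans this⟩
  have hU : A = ⋃ M : ℕ, A ∩ Prod.snd ⁻¹' Set.Icc (-(M : ℝ)) M := by
    ext x
    simp only [Set.mem_iUnion, Set.mem_inter_iff, Set.mem_preimage, Set.mem_Icc]
    refine ⟨fun h => ?_, fun ⟨_, h⟩ => h.1⟩
    obtain ⟨M, hM⟩ := exists_nat_ge |x.2|
    exact ⟨M, h, abs_le.1 hM⟩
  -- Truncation to a bounded range of fields makes the comparison of densities uniform; some
  -- truncation still has positive mass.
  obtain ⟨M, hM⟩ : ∃ M : ℕ, 0 < (μ.prod (gaussianReal 0 1))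
      (A ∩ Prod.snd ⁻¹' Set.Icc (-(M : ℝ)) M) := by
    by_contra hcon
    simp only [not_exists, pos_iff_ne_zero, not_not] at hcon
    rw [hU, measure_iUnion_null hcon] at hpos
    exact lt_irrefl _ hpos
  have hAM : MeasurableSet (A ∩ Prod.snd ⁻¹' Set.Icc (-(M : ℝ)) M) :=
    hA.inter (measurable_snd measurableSet_Icc)
  set g := (μ.prod (gaussianReal 0 1)) (A ∩ Prod.snd ⁻¹' Set.Icc (-(M : ℝ)) M) with hg
  have hgtop : g ≠ ⊤ := measure_ne_top _ _
  set e := Real.exp (-(M + K) ^ 2 / (2 * β)) with he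
  refine ⟨e * g.toReal, mul_pos (Real.exp_pos _) (ENNReal.toReal_pos hM.ne' hgtop),
    fun o ho v hv hv1 => ?_⟩
  rw [ENNReal.ofReal_mul (Real.exp_pos _).le, ENNReal.ofReal_toReal hgtop, hg,
    Measure.prod_apply hAM, Measure.prod_apply hA,
    ← lintegral_const_mul _ (measurable_measure_prodMk_left hAM)]
  exact lintegral_mono fun u =>
    gaussianReal_lower hβ ho hv hv1

end GaussianLower

/-! ### Differences over pairs of equivalent sites -/

section Pairs

variable {Ω : Type*} [MeasurableSpace Ω] {P : Measure Ω} {N : ℕ} {J : Ω → Fin N → Fin N → ℝ}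

/-- Uncorrelated bilinear statistics of a GOE matrix are independent. -/
theorem IsGOE.indepFun_of_uncorrelated (hJ : IsGOE J P) {ι κ : Type*} [Fintype ι] [Fintype κ]
    (a b : ι → Fin N → ℝ) (c d : κ → Fin N → ℝ)
    (h : ∀ i k, (a i ⬝ᵥ c k) * (b i ⬝ᵥ d k) + (a i ⬝ᵥ d k) * (b i ⬝ᵥ c k) = 0) :
    IndepFun (fun ω i => a i ⬝ᵥ (Matrix.of (J ω) *ᵥ b i))
      (fun ω k => c k ⬝ᵥ (Matrix.of (J ω) *ᵥ d k)) P := by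
  have := hJ.1.isProbabilityMeasure
  refine HasGaussianLaw.indepFun_of_covariance_eval
    (X := fun i ω => a i ⬝ᵥ (Matrix.of (J ω) *ᵥ b i))
    (Y := fun k ω => c k ⬝ᵥ (Matrix.of (J ω) *ᵥ d k)) ?_ fun i k => ?_
  · simp only [dotProduct_mulVec_eq_sum]
    refine HasGaussianLaw.comp_isLinearMap hJ.1 (g := fun z : Fin N × Fin N → ℝ =>
      (fun i => (fun p : Fin N × Fin N => a i p.1 * b i p.2) ⬝ᵥ z,
        fun k => (fun p : Fin N × Fin N => c k p.1 * d k p.2) ⬝ᵥ z)) ⟨?_, ?_⟩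
    · intro x y
      simp only [dotProduct_add]
      rfl
    · intro l x
      simp only [dotProduct_smul]
      rfl
  · rw [covariance_eq_sub (hJ.memLp _ _) (hJ.memLp _ _), hJ.integral_dotProduct, zero_mul,
      sub_zero]
    simp only [Pi.mul_apply]
    rw [hJ.integral_mul, h, zero_div]

theorem IsGOE.map_dotProduct (hJ : IsGOE J P) (a b : Fin N → ℝ) :
    P.map (fun ω => a ⬝ᵥ (Matrix.of (J ω) *ᵥ b))
      = gaussianReal 0 (((a ⬝ᵥ a) * (b ⬝ᵥ b) + (a ⬝ᵥ b) * (b ⬝ᵥ a)) / N).toNNReal := by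
  have := hJ.1.isProbabilityMeasure
  have hg : HasGaussianLaw (fun ω => a ⬝ᵥ (Matrix.of (J ω) *ᵥ b)) P := by
    simp only [dotProduct_mulVec_eq_sum]
    exact HasGaussianLaw.comp_isLinearMap hJ.1
      (g := fun x => (fun p : Fin N × Fin N => a p.1 * b p.2) ⬝ᵥ x)
      ⟨fun x y => dotProduct_add _ _ _, fun c x => dotProduct_smul _ _ _⟩
  rw [hg.map_eq_gaussianReal, hJ.integral_dotProduct, variance_eq_sub (hJ.memLp a b),
    hJ.integral_dotProduct]
  simp only [Pi.pow_apply, pow_two]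
  rw [hJ.integral_mul, mul_zero, sub_zero]

variable {q : ℕ}

/-- Half the difference of two coordinate vectors. -/
def pairDir (i i' : Fin q → Fin N) (p : Fin q) : Fin N → ℝ :=
  (1 / 2 : ℝ) • (Pi.single (i p) 1 - Pi.single (i' p) 1)

theorem pairDir_dotProduct (i i' : Fin q → Fin N) (p : Fin q) (z : Fin N → ℝ) :
    pairDir i i' p ⬝ᵥ z = (z (i p) - z (i' p)) / 2 := by
  rw [pairDir, smul_dotProduct, sub_dotProduct, single_one_dotProduct, single_one_dotProduct,
    smul_eq_mul]
  ring

theorem pairDir_dotProduct_pairDir {i i' : Fin q → Fin N}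
    (hi : Function.Injective (Sum.elim i i')) (p p' : Fin q) :
    pairDir i i' p ⬝ᵥ pairDir i i' p' = if p = p' then 1 / 2 else 0 := by
  have h1 : ∀ p p', i p = i p' ↔ p = p' := fun p p' =>
    (hi.eq_iff (a := Sum.inl p) (b := Sum.inl p')).trans (by simp)
  have h2 : ∀ p p', i' p = i' p' ↔ p = p' := fun p p' =>
    (hi.eq_iff (a := Sum.inr p) (b := Sum.inr p')).trans (by simp)
  have h3 : ∀ p p', i p ≠ i' p' := fun p p' h =>
    absurd (hi (a₁ := Sum.inl p) (a₂ := Sum.inr p') h) (by simp)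
  rw [pairDir_dotProduct]
  simp only [pairDir, Pi.smul_apply, Pi.sub_apply, Pi.single_apply, smul_eq_mul, h1, h2, h3,
    (h3 _ _).symm, if_false]
  split_ifs <;> norm_num

/-- The half-difference u of two coordinate vectors with equal history is orthogonal to the explored
span, so ⟨u, J f⟩ is uncorrelated with J v s for s < r because f ⊥ v s. The rest of the field at i p
is the coordinate of J (x - f), uncorrelated since f ⊥ x - f, plus the half-sum functional of J f,
uncorrelated since half-sums and half-differences are orthogonal. -/
theorem indepFun_pairs (hJ : IsGOE J P) (v : ℕ → Fin N → ℝ) (r : ℕ) {x : Fin N → ℝ}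
    {i i' : Fin q → Fin N} (hi : Function.Injective (Sum.elim i i'))
    (hv : ∀ p, ∀ s ≤ r, v s (i p) = v s (i' p))
    (hx : x ∈ Submodule.span ℝ (v '' Set.Iio (r + 1)))
    (hxf : resid v r ⬝ᵥ x = resid v r ⬝ᵥ resid v r) :
    IndepFun (fun ω p => pairDir i i' p ⬝ᵥ (Matrix.of (J ω) *ᵥ resid v r))
      (fun ω => ((fun s : Fin r => Matrix.of (J ω) *ᵥ v s), fun p => (Matrix.of (J ω) *ᵥ x) (i p)
        - pairDir i i' p ⬝ᵥ (Matrix.of (J ω) *ᵥ resid v r))) P := by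
  set f := resid v r with hf
  have ha : ∀ p, ∀ z ∈ Submodule.span ℝ (v '' Set.Iio (r + 1)), pairDir i i' p ⬝ᵥ z = 0 :=
    fun p z hz => dotProduct_eq_zero_of_mem_span (fun s hs => by
      rw [pairDir_dotProduct, hv p s (Nat.lt_succ_iff.1 hs), sub_self, zero_div]) hz
  have hfs : f ∈ Submodule.span ℝ (v '' Set.Iio (r + 1)) :=
    Submodule.sub_mem _ (Submodule.subset_span ⟨r, r.lt_succ_self, rfl⟩)
      (Submodule.span_mono (Set.image_mono (Set.Iio_subset_Iio r.le_succ))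
        (pastProj_mulVec_mem_span v r _))
  have haf := fun p => ha p f hfs
  set C : (Fin r × Fin N) ⊕ (Fin q ⊕ Fin q) → Fin N → ℝ := Sum.elim (fun z => Pi.single z.2 1)
    (Sum.elim (fun p => Pi.single (i p) 1) (fun p => Pi.single (i p) 1 - pairDir i i' p)) with hC
  set D : (Fin r × Fin N) ⊕ (Fin q ⊕ Fin q) → Fin N → ℝ := Sum.elim (fun z => v z.1)
    (Sum.elim (fun _ => x - f) (fun _ => f)) with hD
  have key := hJ.indepFun_of_uncorrelated (fun p => pairDir i i' p) (fun _ => f) C D ?_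
  · have h2 := key.comp (φ := id) (ψ := fun (z : (Fin r × Fin N) ⊕ (Fin q ⊕ Fin q) → ℝ) =>
      ((fun (s : Fin r) l => z (Sum.inl (s, l))), fun p => z (Sum.inr (Sum.inl p))
        + z (Sum.inr (Sum.inr p)))) measurable_id (by fun_prop)
    convert h2 using 1
    · rfl
    funext ω
    simp only [Function.comp_apply, hC, hD, Sum.elim_inl, Sum.elim_inr]
    refine Prod.ext ?_ ?_
    · funext s l
      simp
    · funext p
      simp only [sub_dotProduct, single_one_dotProduct, Matrix.mulVec_sub, Pi.sub_apply]
      ring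
  · intro p k
    rcases k with ⟨s, l⟩ | p' | p'
    · simp only [hC, hD, Sum.elim_inl]
      rw [resid_dotProduct v s.2, ha p _ (Submodule.subset_span ⟨s, s.2.trans r.lt_succ_self, rfl⟩)]
      simp
    · simp only [hC, hD, Sum.elim_inl, Sum.elim_inr]
      rw [dotProduct_sub, hxf, sub_self, dotProduct_sub, haf, ha p x hx]
      simp
    · simp only [hC, hD, Sum.elim_inr]
      rw [haf, dotProduct_sub, pairDir_dotProduct_pairDir hi, pairDir_dotProduct]
      have h1 : i p = i p' ↔ p = p' :=
        (hi.eq_iff (a := Sum.inl p) (b := Sum.inl p')).trans (by simp)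
      have h3 : i' p ≠ i p' := fun h =>
        absurd (hi (a₁ := Sum.inr p) (a₂ := Sum.inl p') h) (by simp)
      simp only [Pi.single_apply, h1, h3, if_false]
      split_ifs <;> norm_num

theorem pairwise_indepFun_pairs (hJ : IsGOE J P) {i i' : Fin q → Fin N}
    (hi : Function.Injective (Sum.elim i i')) {f : Fin N → ℝ} (hf : ∀ p, pairDir i i' p ⬝ᵥ f = 0) :
    Pairwise fun p p' => IndepFun (fun ω => pairDir i i' p ⬝ᵥ (Matrix.of (J ω) *ᵥ f))
      (fun ω => pairDir i i' p' ⬝ᵥ (Matrix.of (J ω) *ᵥ f)) P := by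
  intro p p' hne
  have := hJ.indepFun_of_uncorrelated (fun _ : Unit => pairDir i i' p) (fun _ => f)
    (fun _ : Unit => pairDir i i' p') (fun _ => f) fun _ _ => by
      rw [pairDir_dotProduct_pairDir hi, if_neg hne, hf]; simp
  exact this.comp (φ := fun z : Unit → ℝ => z ()) (ψ := fun z : Unit → ℝ => z ())
    (by fun_prop) (by fun_prop)

theorem sum_sq_comp_le {ι : Type*} [Fintype ι] {e : ι → Fin N} (he : Function.Injective e)
    (z : Fin N → ℝ) : ∑ p, z (e p) ^ 2 ≤ nrm z ^ 2 := by
  classical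
  rw [nrm_sq, dotProduct]
  simp only [← pow_two]
  rw [← Finset.sum_image (s := Finset.univ) (g := e) (f := fun j => z j ^ 2) he.injOn]
  exact Finset.sum_le_sum_of_subset_of_nonneg (Finset.subset_univ _) fun _ _ _ => sq_nonneg _

/-- The part of the field that does not involve the difference over a pair is of order one at
half of the pairs. -/
theorem card_bounded_ge {A : Matrix (Fin N) (Fin N) ℝ} {x f : Fin N → ℝ} {i i' : Fin q → Fin N}
    (hi : Function.Injective (Sum.elim i i')) {K : ℝ} (hK : 0 < K)
    (h : 2 * nrm (A *ᵥ (x - f)) ^ 2 + nrm (A *ᵥ f) ^ 2 ≤ K ^ 2 * q / 2) :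
    (q : ℝ) / 2 ≤ ((Finset.univ.filter fun p =>
      |(A *ᵥ x) (i p) - pairDir i i' p ⬝ᵥ (A *ᵥ f)| ≤ K).card : ℝ) := by
  set O : Fin q → ℝ := fun p => (A *ᵥ x) (i p) - pairDir i i' p ⬝ᵥ (A *ᵥ f) with hO
  have h1 : ∑ p, O p ^ 2 ≤ 2 * nrm (A *ᵥ (x - f)) ^ 2 + nrm (A *ᵥ f) ^ 2 := by
    -- The remaining part equals the coordinate of A (x - f) plus half the sum of the two
    -- coordinates of A f.
    have e1 : ∀ p, O p ^ 2 ≤ 2 * (A *ᵥ (x - f)) (i p) ^ 2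
        + ((A *ᵥ f) (i p) ^ 2 + (A *ᵥ f) (i' p) ^ 2) := fun p => by
      simp only [hO, pairDir_dotProduct, Matrix.mulVec_sub, Pi.sub_apply]
      nlinarith [sq_nonneg ((A *ᵥ x) (i p) - (A *ᵥ f) (i p)
        - ((A *ᵥ f) (i p) + (A *ᵥ f) (i' p)) / 2), sq_nonneg ((A *ᵥ f) (i p) - (A *ᵥ f) (i' p))]
    refine (Finset.sum_le_sum fun p _ => e1 p).trans ?_
    rw [Finset.sum_add_distrib, ← Finset.mul_sum]
    have e2 := sum_sq_comp_le (hi.comp Sum.inl_injective) (A *ᵥ (x - f))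
    have e3 := sum_sq_comp_le hi (A *ᵥ f)
    rw [Fintype.sum_sum_type] at e3
    simp only [Function.comp_apply, Sum.elim_inl, Sum.elim_inr] at e2 e3
    rw [Finset.sum_add_distrib]
    linarith
  have h2 : K ^ 2 * ((Finset.univ.filter fun p => ¬ |O p| ≤ K).card : ℝ) ≤ ∑ p, O p ^ 2 := by
    rw [mul_comm, ← nsmul_eq_mul, ← Finset.sum_const]
    refine (Finset.sum_le_sum fun p hp => ?_).trans (Finset.sum_le_sum_of_subset_of_nonneg
      (Finset.subset_univ _) fun _ _ _ => sq_nonneg _)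
    have := not_le.1 (Finset.mem_filter.1 hp).2
    rw [← sq_abs (O p)]
    exact pow_le_pow_left₀ hK.le this.le 2
  have h3 := Finset.card_filter_add_card_filter_not (s := Finset.univ) (fun p => |O p| ≤ K)
  rw [Finset.card_univ, Fintype.card_fin] at h3
  have h4 : ((Finset.univ.filter fun p => |O p| ≤ K).card : ℝ)
      + ((Finset.univ.filter fun p => ¬ |O p| ≤ K).card : ℝ) = q := by exact_mod_cast h3
  have h5 : ((Finset.univ.filter fun p => ¬ |O p| ≤ K).card : ℝ) ≤ q / 2 := by
    have : 0 < K ^ 2 := by positivity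
    by_contra hc
    nlinarith
  linarith

end Pairs

/-! ### Anti-concentration of a block update over pairs of indistinguishable sites -/

/-! ### One update, conditionally on the preceding history -/

section Step

variable {m n : ℕ} {Ω : Type*} [MeasurableSpace Ω] {P : Measure Ω}

namespace Input

variable (X : Input m n P) {c : unitInterval → ℝ → ℝ}

/-- The seeds of the first `t` passes other than those of block `b` in pass `t`. -/
def restU (t b : ℕ) (ω : Ω) : ℕ → Fin (m * n) → unitInterval := fun s i =>
  if s ≤ t ∧ ¬ (s = t ∧ InBlock b i) then X.U ω s i else 0

theorem measurable_restU (t b : ℕ) : Measurable (X.restU t b) := by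
  have := X.measurable_U
  refine measurable_pi_lambda _ fun s => measurable_pi_lambda _ fun i => ?_
  exact measurable_dite_const (f := fun _ ω => X.U ω s i) (fun _ => by fun_prop) measurable_const

/-- Seeds after pass t are dropped as well, so only finitely many are involved and disjointness of
two finite index sets suffices. -/
theorem indepFun_restU [IsProbabilityMeasure P] (t b : ℕ) {q : ℕ} {i : Fin q → Fin (m * n)}
    (hi : ∀ p, InBlock b (i p)) : IndepFun (X.restU t b) (fun ω p => X.U ω t (i p)) P := by
  have hU := X.measurable_U
  set S : Finset (ℕ × Fin (m * n)) :=
    (Finset.range (t + 1) ×ˢ Finset.univ).filter fun z => ¬ (z.1 = t ∧ InBlock b z.2) with hS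
  set T : Finset (ℕ × Fin (m * n)) := Finset.univ.image fun p => (t, i p) with hT
  have hST : Disjoint S T := by
    rw [Finset.disjoint_left]
    intro z hz hz'
    obtain ⟨p, _, rfl⟩ := Finset.mem_image.1 hz'
    exact (Finset.mem_filter.1 hz).2 ⟨rfl, hi p⟩
  have h := X.indep_U.indepFun_finset S T hST fun z => by fun_prop
  have hmemS : ∀ s l, (s ≤ t ∧ ¬ (s = t ∧ InBlock b l)) → (s, l) ∈ S := fun s l h =>
    Finset.mem_filter.2 ⟨Finset.mem_product.2 ⟨Finset.mem_range.2 (by omega), Finset.mem_univ _⟩,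
      h.2⟩
  have hmemT : ∀ p, (t, i p) ∈ T := fun p => Finset.mem_image_of_mem _ (Finset.mem_univ p)
  have h2 := h.comp (φ := fun (z : S → unitInterval) (s : ℕ) (l : Fin (m * n)) =>
      if h : s ≤ t ∧ ¬ (s = t ∧ InBlock b l) then z ⟨(s, l), hmemS s l h⟩ else 0)
    (ψ := fun (z : T → unitInterval) (p : Fin q) => z ⟨(t, i p), hmemT p⟩)
    (measurable_pi_lambda _ fun s => measurable_pi_lambda _ fun l =>
      measurable_dite_const (fun _ => measurable_pi_apply _) measurable_const)
    (measurable_pi_lambda _ fun p => measurable_pi_apply _)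
  convert h2 using 1
  · funext ω s l
    simp only [restU, Function.comp_apply]
    split_ifs <;> rfl
  · rfl

theorem scanRule_restU {t b r : ℕ} (hr : r < t * m + b) (ω : Ω) (y : ℕ → Fin (m * n) → ℝ)
    (hb : b < m) :
    scanRule m n c r (X.init ω, X.restU t b ω) y = scanRule m n c r (X.init ω, X.U ω) y := by
  have hm : 0 < m := by omega
  funext i
  unfold scanRule
  split_ifs with h1 h2
  · rfl
  · have h3 : X.restU t b ω (r / m) i = X.U ω (r / m) i := by
      have hd := Nat.div_add_mod' r m
      rw [restU, if_pos]
      constructor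
      · have : r / m < t + 1 := by
          rw [Nat.div_lt_iff_lt_mul hm, Nat.succ_mul]
          omega
        omega
      · rintro ⟨h4, h5⟩
        have h6 := ((inBlock_iff _ _).1 h1).symm.trans ((inBlock_iff _ _).1 h5)
        rw [h4, h6] at hd
        omega
    simp only [h3]
  · rfl

theorem measurableSet_follow {c : unitInterval → ℝ → ℝ} (hc : Measurable (Function.uncurry c))
    {q : ℕ} (r : ℕ) (v : ℕ → Fin (m * n) → ℝ) :
    MeasurableSet {z : ((Fin (m * n) → ℝ) × (ℕ → Fin (m * n) → unitInterval)) ×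
      ((Fin r → Fin (m * n) → ℝ) × (Fin q → ℝ)) | ∀ s ≤ r, scanRule m n c s z.1
        (fun a => if h : a < r then z.2.1 ⟨a, h⟩ else 0) = v s} := by
  have h1 : ∀ s, Measurable fun z : ((Fin (m * n) → ℝ) × (ℕ → Fin (m * n) → unitInterval)) ×
      ((Fin r → Fin (m * n) → ℝ) × (Fin q → ℝ)) => scanRule m n c s z.1
        (fun a => if h : a < r then z.2.1 ⟨a, h⟩ else 0) := fun s => by
    have h2 : Measurable fun z : ((Fin (m * n) → ℝ) × (ℕ → Fin (m * n) → unitInterval)) ×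
        ((Fin r → Fin (m * n) → ℝ) × (Fin q → ℝ)) =>
          (fun a => if h : a < r then z.2.1 ⟨a, h⟩ else 0 : ℕ → Fin (m * n) → ℝ) :=
      measurable_pi_lambda _ fun a =>
        measurable_dite_const (fun h => by fun_prop) measurable_const
    exact (measurable_scanRule hc s).comp (measurable_fst.prodMk h2)
  have h3 := Finset.measurableSet_biInter (Finset.range (r + 1)) fun s _ =>
    measurableSet_eq_fun (h1 s) (measurable_const (a := v s))
  convert h3 using 1
  ext z
  simp

theorem measurableSet_half_bounded {α β : Type*} [MeasurableSpace α] [MeasurableSpace β] {q : ℕ}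
    (r : ℕ) (K : ℝ) : MeasurableSet {z : α × ((Fin r → β) × (Fin q → ℝ)) |
      (q : ℝ) / 2 ≤ ((Finset.univ.filter fun p => |z.2.2 p| ≤ K).card : ℝ)} := by
  refine measurableSet_le measurable_const ?_
  simp only [Finset.card_filter]
  push_cast
  refine Finset.measurable_sum _ fun p _ => Measurable.ite ?_ measurable_const measurable_const
  exact measurableSet_le (by fun_prop) measurable_const

variable [NeZero m]

theorem flatSpin_apply_of_inBlock (c : unitInterval → ℝ → ℝ) {t b : ℕ} (ht : 1 ≤ t) (hb : b < m)
    {i : Fin (m * n)} (hi : InBlock b i) (ω : Ω) :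
    X.flatSpin c (t * m + b) ω i = c (X.U ω t i) ((Matrix.of (X.J ω) *ᵥ
      ∑ q ∈ Finset.range m, X.flatSpin c (t * m + b - m + q) ω) i) := by
  have hm : 0 < m := Nat.pos_of_ne_zero (NeZero.ne m)
  have h1 : (t * m + b) / m = t := by
    rw [mul_comm, Nat.mul_add_div hm, Nat.div_eq_of_lt hb, add_zero]
  have h2 : (t * m + b) % m = b := by
    rw [mul_comm, Nat.mul_add_mod, Nat.mod_eq_of_lt hb]
  have h3 : ¬ t * m + b < m := by
    have := Nat.mul_le_mul_right m ht
    omega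
  rw [flatSpin_eq_scanRule, scanRule, h1, h2, if_pos hi, if_neg h3, Matrix.mulVec_sum,
    Finset.sum_apply]

open Classical in
-- Freeze the history up to r. The field acting on site i p is o + d, where d is the half-difference
-- of J f over the pair. Given all data other than the q fresh seeds and the d's, the updates at the
-- sites i p are independent. On the operator bound, o is at most K in absolute value for half of
-- the pairs, where the sign σ has conditional probability at least κ; conditional Chebyshev then
-- bounds the probability of few occurrences. The operator bound enters only through o, so it never
-- disturbs the law of d.
theorem measure_fiber_few_le [IsProbabilityMeasure P] (hc : IsUpdateRule c) {t b r : ℕ}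
    (ht : 1 ≤ t) (hb : b < m) (hr : r + 1 = t * m + b) (ω₀ : Ω) {q : ℕ} (hq : 0 < q)
    {i i' : Fin q → Fin (m * n)}
    (hi : Function.Injective (Sum.elim i i')) (hib : ∀ p, InBlock b (i p))
    (hv : ∀ p, ∀ s ≤ r, X.flatSpin c s ω₀ (i p) = X.flatSpin c s ω₀ (i' p))
    {K κ L σ : ℝ} (hK : 0 < K) (hκ : 0 < κ)
    (hκA : ∀ o : ℝ, |o| ≤ K → ENNReal.ofReal κ ≤ ((volume : Measure unitInterval).prod
      (gaussianReal o ((1 / 2 * (resid (fun s => X.flatSpin c s ω₀) r ⬝ᵥ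
        resid (fun s => X.flatSpin c s ω₀) r)) / (m * n : ℕ)).toNNReal)) {p | c p.1 p.2 = σ})
    (hLK : 2 * (L * nrm (∑ a ∈ Finset.range m, X.flatSpin c (r + 1 - m + a) ω₀
        - resid (fun s => X.flatSpin c s ω₀) r)) ^ 2
      + (L * nrm (resid (fun s => X.flatSpin c s ω₀) r)) ^ 2 ≤ K ^ 2 * q / 2) :
    P {ω | (∀ s ≤ r, X.flatSpin c s ω = X.flatSpin c s ω₀) ∧
        OpBound (Matrix.of (X.J ω)) (fun s => X.flatSpin c s ω) L (r + 1) ∧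
        ((Finset.univ.filter fun p => X.flatSpin c (r + 1) ω (i p) = σ).card : ℝ) < κ * q / 4}
      ≤ P {ω | ∀ s ≤ r, X.flatSpin c s ω = X.flatSpin c s ω₀}
        * ENNReal.ofReal (16 / (κ ^ 2 * q)) := by
  have hm : 0 < m := Nat.pos_of_ne_zero (NeZero.ne m)
  set E := X.exploration hc.measurable hc.sign with hE
  set v : ℕ → Fin (m * n) → ℝ := fun s => X.flatSpin c s ω₀ with hvdef
  set f := resid v r with hf
  set x : Fin (m * n) → ℝ := ∑ a ∈ Finset.range m, v (r + 1 - m + a) with hx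
  have hrm : m ≤ r + 1 := by
    have := Nat.mul_le_mul_right m ht
    omega
  -- the direction `x` and its relation to the residual
  have hspan : ∀ s ≤ r, v s ∈ Submodule.span ℝ (v '' Set.Iio (r + 1)) := fun s hs =>
    Submodule.subset_span ⟨s, Nat.lt_succ_of_le hs, rfl⟩
  have hxspan : x ∈ Submodule.span ℝ (v '' Set.Iio (r + 1)) :=
    Submodule.sum_mem _ fun a ha => hspan _ (by have := Finset.mem_range.1 ha; omega)
  have hfspan : f ∈ Submodule.span ℝ (v '' Set.Iio (r + 1)) :=
    Submodule.sub_mem _ (hspan r le_rfl)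
      (Submodule.span_mono (Set.image_mono (Set.Iio_subset_Iio r.le_succ))
        (pastProj_mulVec_mem_span v r _))
  have hfv : f ⬝ᵥ v r = f ⬝ᵥ f := by
    have h0 : f ⬝ᵥ (pastProj v r *ᵥ v r) = 0 :=
      dotProduct_eq_zero_of_mem_span (fun s hs => resid_dotProduct v hs)
        (pastProj_mulVec_mem_span v r _)
    conv_rhs => rhs; rw [hf, resid]
    rw [dotProduct_sub, h0, sub_zero]
  -- The last term of the window is v r, which pairs with its residual to |f|²; the earlier terms
  -- are orthogonal to f.
  have hxf : f ⬝ᵥ x = f ⬝ᵥ f := by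
    rw [hx, dotProduct_sum, Finset.sum_eq_single (m - 1)]
    · have : r + 1 - m + (m - 1) = r := by omega
      rw [this, hfv]
    · intro a ha hne
      have := Finset.mem_range.1 ha
      exact resid_dotProduct v (by omega)
    · intro h
      exact absurd (Finset.mem_range.2 (by omega)) h
  have haf : ∀ p, pairDir i i' p ⬝ᵥ f = 0 := fun p =>
    dotProduct_eq_zero_of_mem_span (fun s hs => by
      rw [pairDir_dotProduct, show v s (i p) = v s (i' p) from hv p s (Nat.lt_succ_iff.1 hs),
        sub_self, zero_div]) hfspan
  -- the random elements
  set d : Fin q → Ω → ℝ := fun p ω => pairDir i i' p ⬝ᵥ (Matrix.of (X.J ω) *ᵥ f) with hd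
  -- The part of the field at the first site of each pair that belongs to the conditioning data.
  set o : Ω → Fin q → ℝ := fun ω p => (Matrix.of (X.J ω) *ᵥ x) (i p) - d p ω with ho
  set Y : Ω → Fin r → Fin (m * n) → ℝ := fun ω s => Matrix.of (X.J ω) *ᵥ v s with hY
  set A' : Ω → (Fin (m * n) → ℝ) × (ℕ → Fin (m * n) → unitInterval) :=
    fun ω => (X.init ω, X.restU t b ω) with hA'
  have hUm := X.measurable_U
  have hJx : ∀ z : Fin (m * n) → ℝ, Measurable fun M : Fin (m * n) → Fin (m * n) → ℝ =>
    Matrix.of M *ᵥ z := fun z => measurable_of_mulVec measurable_id measurable_const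
  have hdM : Measurable fun M : Fin (m * n) → Fin (m * n) → ℝ => fun p : Fin q =>
      pairDir i i' p ⬝ᵥ (Matrix.of M *ᵥ f) :=
    measurable_pi_lambda _ fun p => measurable_dotProduct measurable_const (hJx f)
  have hYoM : Measurable fun M : Fin (m * n) → Fin (m * n) → ℝ =>
      ((fun s : Fin r => Matrix.of M *ᵥ v s), fun p : Fin q => (Matrix.of M *ᵥ x) (i p)
        - pairDir i i' p ⬝ᵥ (Matrix.of M *ᵥ f)) := by
    refine (measurable_pi_lambda _ fun s => hJx _).prodMk (measurable_pi_lambda _ fun p => ?_)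
    exact ((measurable_pi_apply _).comp (hJx x)).sub ((measurable_pi_apply p).comp hdM)
  have hdm : ∀ p, Measurable (d p) := fun p =>
    (measurable_pi_apply p).comp (hdM.comp X.measurable_J)
  have hYo : Measurable fun ω => (Y ω, o ω) := hYoM.comp X.measurable_J
  have hA'm : Measurable A' := X.measurable_init.prodMk (X.measurable_restU t b)
  have hUp : Measurable fun ω (p : Fin q) => X.U ω t (i p) := by fun_prop
  -- independence
  have i1 : IndepFun A' (fun ω (p : Fin q) => X.U ω t (i p)) P := by
    refine indepFun_prodMk_left X.measurable_init (X.measurable_restU t b) hUp ?_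
      (X.indepFun_restU t b hib)
    have hm1 : Measurable fun u : ℕ → Fin (m * n) → unitInterval =>
        ((fun s l => if s ≤ t ∧ ¬ (s = t ∧ InBlock b l) then u s l else 0 :
          ℕ → Fin (m * n) → unitInterval), fun p : Fin q => u t (i p)) := by
      refine (measurable_pi_lambda _ fun s => measurable_pi_lambda _ fun l => ?_).prodMk
        (by fun_prop)
      exact measurable_dite_const (f := fun _ (u : ℕ → Fin (m * n) → unitInterval) => u s l)
        (fun _ => by fun_prop) measurable_const
    exact X.indep_init_J_U.comp measurable_fst hm1
  have i2 : IndepFun (fun ω => (Y ω, o ω)) (fun ω p => d p ω) P :=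
    (indepFun_pairs X.goe_J v r hi hv hxspan hxf).symm
  have hAJ : IndepFun (fun ω => (X.init ω, X.U ω)) X.J P := E.indep_A_J
  have i3 : IndepFun (fun ω => (A' ω, fun p : Fin q => X.U ω t (i p)))
      (fun ω => ((Y ω, o ω), fun p => d p ω)) P := by
    refine hAJ.comp (φ := fun z => ((z.1, fun s l => if s ≤ t ∧ ¬ (s = t ∧ InBlock b l)
      then z.2 s l else 0), fun p => z.2 t (i p))) ?_ (hYoM.prodMk hdM)
    refine (measurable_fst.prodMk
      (measurable_pi_lambda _ fun s => measurable_pi_lambda _ fun l => ?_)).prodMk (by fun_prop)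
    exact measurable_dite_const (f := fun _ (z : (Fin (m * n) → ℝ) × (ℕ → Fin (m * n) →
      unitInterval)) => z.2 s l) (fun _ => by fun_prop) measurable_const
  have i4 := indepFun_prodMk_prodMk hA'm hYo hUp (measurable_pi_lambda _ hdm) i3 i1 i2
  have iRZ : IndepFun (fun ω => (A' ω, (Y ω, o ω))) (fun ω p => (X.U ω t (i p), d p ω)) P :=
    i4.comp (φ := id) (ψ := fun (z : (Fin q → unitInterval) × (Fin q → ℝ)) p => (z.1 p, z.2 p))
      measurable_id (by fun_prop)
  have iUd : IndepFun (fun ω (p : Fin q) => X.U ω t (i p)) (fun ω p => d p ω) P :=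
    i3.comp (φ := Prod.snd) (ψ := Prod.snd) measurable_snd measurable_snd
  have iZ : Pairwise fun p p' => IndepFun (fun ω => (X.U ω t (i p), d p ω))
      (fun ω => (X.U ω t (i p'), d p' ω)) P := by
    intro p p' hne
    refine indepFun_prodMk_prodMk (by fun_prop) (hdm p) (by fun_prop) (hdm p') ?_ ?_
      (pairwise_indepFun_pairs X.goe_J hi haf hne)
    · exact iUd.comp (φ := fun z => (z p, z p')) (ψ := fun z => (z p, z p')) (by fun_prop)
        (by fun_prop)
    · refine X.indep_U.indepFun (i := (t, i p)) (j := (t, i p')) fun h => hne ?_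
      have := hi (a₁ := Sum.inl p) (a₂ := Sum.inl p') (Prod.ext_iff.1 h).2
      simpa using this
  -- the event of following the history, in terms of the conditioning variables
  set B : Set (((Fin (m * n) → ℝ) × (ℕ → Fin (m * n) → unitInterval)) ×
      ((Fin r → Fin (m * n) → ℝ) × (Fin q → ℝ))) :=
    {z | ∀ s ≤ r, scanRule m n c s z.1 (fun a => if h : a < r then z.2.1 ⟨a, h⟩ else 0) = v s} ∩
      {z | (q : ℝ) / 2 ≤ ((Finset.univ.filter fun p => |z.2.2 p| ≤ K).card : ℝ)} with hB
  have hBm : MeasurableSet B :=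
    (measurableSet_follow hc.measurable r v).inter (measurableSet_half_bounded r K)
  have hhist : ∀ ω, (∀ s ≤ r, X.flatSpin c s ω = v s) ↔ ∀ s ≤ r, scanRule m n c s (A' ω)
      (fun a => if h : a < r then Y ω ⟨a, h⟩ else 0) = v s := by
    intro ω
    have h1 := (E.hist_eq_iff r ω ω₀).symm.trans (E.hist_eq_iff_rule r ω ω₀)
    refine Iff.trans h1 (forall₂_congr fun s hs => ?_)
    rw [hA']
    simp only
    rw [X.scanRule_restU (by omega) ω _ hb, scanRule_congr s _
      (fun a => if h : a < r then Y ω ⟨a, h⟩ else 0) (fun a => Matrix.of (X.J ω) *ᵥ v a)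
      fun a ha => by simp [ha.trans_le hs, hY]]
    rfl
  set T : Fin q → Set ((((Fin (m * n) → ℝ) × (ℕ → Fin (m * n) → unitInterval)) ×
      ((Fin r → Fin (m * n) → ℝ) × (Fin q → ℝ))) × (unitInterval × ℝ)) :=
    fun p => {z | c z.2.1 (z.1.2.2 p + z.2.2) = σ} with hT
  have hcm := hc.measurable
  have hTm : ∀ p, MeasurableSet (T p) := fun p => by
    refine measurableSet_eq_fun ?_ measurable_const
    exact hcm.comp (by fun_prop : Measurable fun z : (((Fin (m * n) → ℝ) × (ℕ → Fin (m * n) →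
      unitInterval)) × ((Fin r → Fin (m * n) → ℝ) × (Fin q → ℝ))) × (unitInterval × ℝ) =>
        (z.2.1, z.1.2.2 p + z.2.2))
  have key := measure_few_le (R := fun ω => (A' ω, (Y ω, o ω)))
    (Z := fun p ω => (X.U ω t (i p), d p ω)) (hA'm.prodMk hYo)
    (fun p => (by fun_prop : Measurable fun ω => X.U ω t (i p)).prodMk (hdm p)) iRZ iZ hTm hκ hq
    hBm ?_
  · refine (measure_mono ?_).trans (key.trans (mul_le_mul_left (measure_mono ?_) _))
    · rintro ω ⟨h1, h2, h3⟩
      have hvs : (∑ a ∈ Finset.range m, X.flatSpin c (r + 1 - m + a) ω) = x :=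
        Finset.sum_congr rfl fun a ha => h1 _ (by have := Finset.mem_range.1 ha; omega)
      have h2' : OpBound (Matrix.of (X.J ω)) v L (r + 1) := by
        intro z hz
        refine h2 z ?_
        have : (fun s => X.flatSpin c s ω) '' Set.Iio (r + 1) = v '' Set.Iio (r + 1) :=
          Set.image_congr fun s hs => h1 s (Nat.lt_succ_iff.1 hs)
        rwa [this]
      refine ⟨⟨(hhist ω).1 h1, ?_⟩, ?_⟩
      -- The field direction x and the residual f both lie in the explored span, so the operator
      -- bound converts into a second-moment bound over the pairs.
      · refine card_bounded_ge hi hK (le_trans ?_ hLK)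
        have e1 := h2' (x - f) (Submodule.sub_mem _ hxspan hfspan)
        have e2 := h2' f hfspan
        have e3 := pow_le_pow_left₀ (nrm_nonneg _) e1 2
        have e4 := pow_le_pow_left₀ (nrm_nonneg _) e2 2
        linarith
      · refine lt_of_eq_of_lt ?_ h3
        congr 2
        ext p
        simp only [Finset.mem_filter, Finset.mem_univ, true_and, hT, Set.mem_ofPred_eq, ho,
          sub_add_cancel]
        rw [hr, X.flatSpin_apply_of_inBlock c ht hb (hib p), ← hr, hvs]
    · rintro ω ⟨h1, _⟩
      exact (hhist ω).2 h1
  · rintro ⟨z1, z2, z3⟩ ⟨_, hz⟩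
    refine ⟨_, hz, fun p hp => ?_⟩
    have hp' := (Finset.mem_filter.1 hp).2
    simp only at hp'
    -- Conditionally the update sees a uniform seed and a Gaussian with mean o; the half in the
    -- variance is the squared norm of the half-difference vector.
    have hlaw : P.map (fun ω => (X.U ω t (i p), z3 p + d p ω))
        = (volume : Measure unitInterval).prod (gaussianReal (z3 p)
          ((1 / 2 * (f ⬝ᵥ f)) / (m * n : ℕ)).toNNReal) := by
      have hdo : Measurable fun ω => z3 p + d p ω := (hdm p).const_add _
      have hi' : IndepFun (fun ω => X.U ω t (i p)) (fun ω => z3 p + d p ω) P :=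
        iUd.comp (φ := fun z : Fin q → unitInterval => z p)
          (ψ := fun z : Fin q → ℝ => z3 p + z p) (by fun_prop) (by fun_prop)
      rw [indepFun_iff_map_prod_eq_prod_map_map (by fun_prop) hdo.aemeasurable] at hi'
      rw [hi', X.unif_U]
      congr 1
      have h1 : (fun ω => z3 p + d p ω) = (fun y => z3 p + y) ∘ d p := rfl
      rw [h1, ← Measure.map_map (by fun_prop) (hdm p), hd]
      simp only
      rw [X.goe_J.map_dotProduct, gaussianReal_map_const_add, pairDir_dotProduct_pairDir hi,
        if_pos rfl, haf, zero_mul, add_zero, zero_add]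
    have hAm : MeasurableSet {p : unitInterval × ℝ | c p.1 p.2 = σ} :=
      measurableSet_eq_fun hcm measurable_const
    have h1 := hκA (z3 p) hp'
    rw [← hlaw, Measure.map_apply (by have := hdm p; fun_prop) hAm] at h1
    rw [Measure.real, ← ENNReal.ofReal_le_iff_le_toReal (measure_ne_top _ _)]
    exact h1

end Input

end Step

/-! ### Sign patterns of the sites of a block -/

section SignPatterns

variable {N : ℕ}

open Classical in
/-- The sites at which the vectors `v b, v (m + b), …, v ((t - 1) m + b)` take the values `τ`. -/
def typeSet (m : ℕ) (v : ℕ → Fin N → ℝ) (t b : ℕ) (τ : ℕ → ℝ) : Finset (Fin N) :=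
  Finset.univ.filter fun i => ∀ s < t, v (s * m + b) i = τ s

theorem mem_typeSet {m : ℕ} {v : ℕ → Fin N → ℝ} {t b : ℕ} {τ : ℕ → ℝ} {i : Fin N} :
    i ∈ typeSet m v t b τ ↔ ∀ s < t, v (s * m + b) i = τ s := by
  simp [typeSet]

theorem typeSet_congr {m : ℕ} {v v' : ℕ → Fin N → ℝ} {t b : ℕ} {τ τ' : ℕ → ℝ}
    (hv : ∀ s < t, v (s * m + b) = v' (s * m + b)) (hτ : ∀ s < t, τ s = τ' s) :
    typeSet m v t b τ = typeSet m v' t b τ' := by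
  ext i
  rw [mem_typeSet, mem_typeSet]
  exact forall₂_congr fun s hs => by rw [hv s hs, hτ s hs]

/-- The sign pattern which is positive exactly on `S`. -/
def signOf (S : Finset ℕ) (s : ℕ) : ℝ := if s ∈ S then 1 else -1

theorem signOf_eq (S : Finset ℕ) (s : ℕ) : signOf S s = 1 ∨ signOf S s = -1 := by
  unfold signOf; split_ifs <;> simp

/-- Every sign pattern of the first `t` configurations of block `b` occurs at `M` or more
sites. -/
def Rich (m : ℕ) (v : ℕ → Fin N → ℝ) (t b : ℕ) (M : ℝ) : Prop :=
  ∀ S ∈ (Finset.range t).powerset, M ≤ ((typeSet m v t b (signOf S)).card : ℝ)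

theorem Rich.congr {m : ℕ} {v v' : ℕ → Fin N → ℝ} {t b : ℕ} {M : ℝ} (h : Rich m v t b M)
    (hv : ∀ s < t, v (s * m + b) = v' (s * m + b)) : Rich m v' t b M := by
  intro S hS
  rw [← typeSet_congr hv fun _ _ => rfl]
  exact h S hS

theorem Rich.mono {m : ℕ} {v : ℕ → Fin N → ℝ} {t b : ℕ} {M M' : ℝ} (h : Rich m v t b M)
    (hM : M' ≤ M) : Rich m v t b M' := fun S hS => hM.trans (h S hS)

theorem Rich.card_typeSet {m : ℕ} {v : ℕ → Fin N → ℝ} {t b : ℕ} {M : ℝ} (h : Rich m v t b M)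
    (S : Finset ℕ) : M ≤ ((typeSet m v t b (signOf S)).card : ℝ) := by
  rw [typeSet_congr (fun _ _ => rfl) (τ' := signOf (S ∩ Finset.range t)) fun s hs => by
    simp [signOf, hs]]
  exact h _ (Finset.mem_powerset.2 Finset.inter_subset_right)

/-- Take the sign pattern matching the signs of α. At its sites the combination equals Σ |α s|,
whose square dominates Σ α s², and there are at least M such sites. This is the lower bound on the
Gram matrix of past spins. -/
theorem Rich.le_dotProduct_self {m : ℕ} {v : ℕ → Fin N → ℝ} {t b : ℕ} {M : ℝ}
    (h : Rich m v t b M) (α : ℕ → ℝ) :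
    M * ∑ s ∈ Finset.range t, α s ^ 2 ≤ (∑ s ∈ Finset.range t, α s • v (s * m + b)) ⬝ᵥ
      (∑ s ∈ Finset.range t, α s • v (s * m + b)) := by
  set S := (Finset.range t).filter fun s => 0 ≤ α s with hS
  set x := ∑ s ∈ Finset.range t, α s • v (s * m + b) with hx
  have hxi : ∀ i ∈ typeSet m v t b (signOf S), ∑ s ∈ Finset.range t, α s ^ 2 ≤ x i * x i := by
    intro i hi
    have h1 : x i = ∑ s ∈ Finset.range t, |α s| := by
      rw [hx, Finset.sum_apply]
      refine Finset.sum_congr rfl fun s hs => ?_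
      rw [Pi.smul_apply, mem_typeSet.1 hi s (Finset.mem_range.1 hs), signOf, smul_eq_mul]
      by_cases h0 : 0 ≤ α s
      · have h1 : s ∈ S := Finset.mem_filter.2 ⟨hs, h0⟩
        rw [if_pos h1, abs_of_nonneg h0, mul_one]
      · have h1 : s ∉ S := fun h => h0 (Finset.mem_filter.1 h).2
        rw [if_neg h1, abs_of_neg (not_le.1 h0), mul_neg_one]
    rw [h1, ← pow_two]
    have := Finset.sum_sq_le_sq_sum_of_nonneg (s := Finset.range t) (f := fun s => |α s|)
      fun s _ => abs_nonneg _
    simpa using this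
  have h0 : 0 ≤ ∑ s ∈ Finset.range t, α s ^ 2 := Finset.sum_nonneg fun s _ => sq_nonneg _
  calc M * ∑ s ∈ Finset.range t, α s ^ 2
      ≤ ((typeSet m v t b (signOf S)).card : ℝ) * ∑ s ∈ Finset.range t, α s ^ 2 :=
        mul_le_mul_of_nonneg_right (h S (Finset.mem_powerset.2 (Finset.filter_subset _ _))) h0
    _ = ∑ i ∈ typeSet m v t b (signOf S), ∑ s ∈ Finset.range t, α s ^ 2 := by simp
    _ ≤ ∑ i ∈ typeSet m v t b (signOf S), x i * x i := Finset.sum_le_sum hxi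
    _ ≤ ∑ i, x i * x i := Finset.sum_le_univ_sum_of_nonneg fun i => mul_self_nonneg _

theorem exists_sum_embedding {α : Type*} {s : Finset α} {q : ℕ} (h : 2 * q ≤ s.card) :
    ∃ i i' : Fin q → α, Function.Injective (Sum.elim i i') ∧ (∀ p, i p ∈ s) ∧ ∀ p, i' p ∈ s := by
  have : Nonempty ((Fin q ⊕ Fin q) ↪ s) := by
    refine Function.Embedding.nonempty_of_card_le ?_
    simp only [Fintype.card_sum, Fintype.card_fin, Fintype.card_coe]
    omega
  obtain ⟨e⟩ := this
  refine ⟨fun p => e (Sum.inl p), fun p => e (Sum.inr p), ?_, fun p => (e _).2, fun p => (e _).2⟩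
  have : Sum.elim (fun p => (e (Sum.inl p) : α)) (fun p => (e (Sum.inr p) : α))
      = Subtype.val ∘ e := by
    funext z; cases z <;> rfl
  rw [this]
  exact Subtype.val_injective.comp e.injective

end SignPatterns

/-! ### One update splits every sign pattern -/

section RichStep

variable {m n : ℕ} [NeZero m] {Ω : Type*} [MeasurableSpace Ω] {P : Measure Ω}

namespace Input

variable (X : Input m n P) {c : unitInterval → ℝ → ℝ}

theorem nrm_flatSpin (hs : ∀ u x, c u x = 1 ∨ c u x = -1) (r : ℕ) (ω : Ω) :
    nrm (X.flatSpin c r ω) = Real.sqrt n := by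
  rw [nrm_eq_sqrt, flatSpin, spinBlock_dotProduct_self X c ω hs]

theorem inBlock_of_flatSpin_ne_zero {r : ℕ} {ω : Ω} {i : Fin (m * n)}
    (h : X.flatSpin c r ω i ≠ 0) : InBlock (r % m) i := by
  rw [flatSpin_apply] at h
  by_contra h'
  exact h (if_neg h')

theorem inBlock_of_mem_typeSet {t b : ℕ} (ht : 1 ≤ t) (hb : b < m) {ω : Ω} {S : Finset ℕ}
    {i : Fin (m * n)} (hi : i ∈ typeSet m (fun s => X.flatSpin c s ω) t b (signOf S)) :
    InBlock b i := by
  have h := mem_typeSet.1 hi 0 ht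
  have h1 := X.inBlock_of_flatSpin_ne_zero (c := c) (r := 0 * m + b) (ω := ω) (i := i) (by
    rw [h]
    rcases signOf_eq S 0 with h | h <;> simp [h])
  rwa [zero_mul, zero_add, Nat.mod_eq_of_lt hb] at h1

/-- Within block b the pattern prescribes the values, and the configurations of all other blocks
vanish at both sites; hence sites of one class cannot be told apart by any explored vector. -/
theorem flatSpin_eq_of_mem_typeSet {t b : ℕ} (ht : 1 ≤ t) (hb : b < m) {ω : Ω} {S : Finset ℕ}
    {i i' : Fin (m * n)} (hi : i ∈ typeSet m (fun s => X.flatSpin c s ω) t b (signOf S))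
    (hi' : i' ∈ typeSet m (fun s => X.flatSpin c s ω) t b (signOf S)) {s : ℕ}
    (hs : s < t * m + b) : X.flatSpin c s ω i = X.flatSpin c s ω i' := by
  by_cases h : s % m = b
  · have h1 : s / m * m + b = s := by rw [← h]; exact Nat.div_add_mod' s m
    have h2 : s / m < t := by
      by_contra h3
      have := Nat.mul_le_mul_right m (not_lt.1 h3)
      omega
    have e1 := mem_typeSet.1 hi _ h2
    have e2 := mem_typeSet.1 hi' _ h2
    simp only [h1] at e1 e2
    rw [e1, e2]
  · have h0 : ∀ i : Fin (m * n), InBlock b i → X.flatSpin c s ω i = 0 := fun i hi => by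
      rw [flatSpin_apply, if_neg]
      intro h'
      rw [inBlock_iff] at hi h'
      omega
    rw [h0 i (X.inBlock_of_mem_typeSet ht hb hi), h0 i' (X.inBlock_of_mem_typeSet ht hb hi')]

/-- The residual is a combination of the block's configurations in which the newest has coefficient
1, so richness bounds its squared norm below. -/
theorem le_resid_flatSpin (hn : 0 < n) {t : ℕ} {b : Fin m} {M : ℝ} (hM : 0 ≤ M) {ω : Ω}
    (h : Rich m (fun s => X.flatSpin c s ω) (t + 1) b M) :
    M ≤ resid (fun s => X.flatSpin c s ω) (t * m + b) ⬝ᵥ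
      resid (fun s => X.flatSpin c s ω) (t * m + b) := by
  have hm : 0 < m := Nat.pos_of_ne_zero (NeZero.ne m)
  set α : ℕ → ℝ := fun s => (if s = t then 1 else 0) - extendZero (X.psiHat c t b ω) s with hα
  have h1 : ∑ s ∈ Finset.range (t + 1), α s • X.flatSpin c (s * m + b) ω
      = resid (fun s => X.flatSpin c s ω) (t * m + b) := by
    rw [resid_flatSpin X c ω hm hn, ← X.spinHist_mulVec_extendZero c t.le_succ]
    simp only [hα, sub_smul, Finset.sum_sub_distrib, ite_smul, one_smul, zero_smul,
      Finset.sum_ite_eq', Finset.mem_range, flatSpin_mul_add]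
    rw [if_pos t.lt_succ_self]
  have h2 := h.le_dotProduct_self α
  rw [h1] at h2
  refine le_trans ?_ h2
  refine le_mul_of_one_le_right hM ?_
  have h3 := Finset.single_le_sum (f := fun s => α s ^ 2) (fun s _ => sq_nonneg _)
    (Finset.mem_range.2 t.lt_succ_self)
  refine le_trans (le_of_eq ?_) h3
  simp [hα, extendZero]

variable [IsProbabilityMeasure P]

/-- If the patterns of block `b` up to pass `t - 1`, and those of the block updated just before,
are rich, then the update of block `b` in pass `t` splits every pattern. -/
theorem measure_not_rich_succ_le (hc : IsUpdateRule c) {t b : ℕ} (ht : 1 ≤ t) (hb : b < m)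
    {t' : ℕ} {b' : Fin m} (hr : t' * m + b' + 1 = t * m + b) {q : ℕ} (hq : 0 < q) (hn : 0 < n)
    {ε K κ L : ℝ} (hε : 0 < ε) (hK : 0 < K) (hκ : 0 < κ) (hL : 0 ≤ L)
    (hκA : ∀ σ : ℝ, σ = 1 ∨ σ = -1 → ∀ o : ℝ, |o| ≤ K → ∀ v : NNReal, ε / (2 * m) ≤ v → v ≤ 1 →
      ENNReal.ofReal κ ≤ ((volume : Measure unitInterval).prod
        (gaussianReal o v)) {p | c p.1 p.2 = σ})
    (hKq : L ^ 2 * n * (2 * (m + 1) ^ 2 + 1) ≤ K ^ 2 * q / 2) :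
    P {ω | ¬ Rich m (fun s => X.flatSpin c s ω) (t + 1) b (κ * q / 4)}
      ≤ P {ω | ¬ Rich m (fun s => X.flatSpin c s ω) t b (2 * q)}
        + P {ω | ¬ Rich m (fun s => X.flatSpin c s ω) (t' + 1) b' (ε * n)}
        + P {ω | ¬ OpBound (Matrix.of (X.J ω)) (fun s => X.flatSpin c s ω) L (t * m + b)}
        + 2 ^ (t + 1) * ENNReal.ofReal (16 / (κ ^ 2 * q)) := by
  classical
  have hm : 0 < m := Nat.pos_of_ne_zero (NeZero.ne m)
  set E := X.exploration hc.measurable hc.sign with hE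
  set r := t' * m + b' with hrdef
  set G : Set Ω := {ω | Rich m (fun s => X.flatSpin c s ω) t b (2 * q) ∧
    Rich m (fun s => X.flatSpin c s ω) (t' + 1) b' (ε * n) ∧
    OpBound (Matrix.of (X.J ω)) (fun s => X.flatSpin c s ω) L (r + 1)} with hG
  have main : ∀ S : Finset ℕ, P (G ∩ {ω | ((typeSet m (fun s => X.flatSpin c s ω) (t + 1) b
      (signOf S)).card : ℝ) < κ * q / 4}) ≤ ENNReal.ofReal (16 / (κ ^ 2 * q)) := by
    intro S
    -- Work on one history at a time. Richness of the two blocks is determined by the history; if it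
    -- fails there, the fiber meets the event in the empty set.
    refine measure_le_of_fibers (E.finite_hist r) (E.measurableSet_hist r) fun ω₀ => ?_
    have hfib : E.hist r ⁻¹' {E.hist r ω₀}
        = {ω | ∀ s ≤ r, X.flatSpin c s ω = X.flatSpin c s ω₀} := by
      ext ω
      exact E.hist_eq_iff r ω ω₀
    rw [hfib]
    by_cases h0 : Rich m (fun s => X.flatSpin c s ω₀) t b (2 * q) ∧
      Rich m (fun s => X.flatSpin c s ω₀) (t' + 1) b' (ε * n)
    swap
    · have : {ω | ∀ s ≤ r, X.flatSpin c s ω = X.flatSpin c s ω₀} ∩ (G ∩ {ω | ((typeSet m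
          (fun s => X.flatSpin c s ω) (t + 1) b (signOf S)).card : ℝ) < κ * q / 4}) = ∅ := by
        ext ω
        refine iff_of_false ?_ (Set.notMem_empty ω)
        rintro ⟨h1, ⟨h2, h3, _⟩, _⟩
        refine h0 ⟨h2.congr fun s hs => h1 _ ?_, h3.congr fun s hs => h1 _ ?_⟩
        · have := Nat.mul_le_mul_right m (Nat.succ_le_of_lt hs)
          rw [Nat.succ_mul] at this
          omega
        · have := Nat.mul_le_mul_right m (Nat.lt_succ_iff.1 hs)
          omega
      rw [this, measure_empty]
      exact zero_le
    obtain ⟨h0, h0'⟩ := h0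
    -- A class of at least 2 q sites provides q disjoint pairs.
    obtain ⟨i, i', hi, hi1, hi2⟩ := exists_sum_embedding (q := q)
      (s := typeSet m (fun s => X.flatSpin c s ω₀) t b (signOf S)) (by
        have := h0.card_typeSet S
        exact_mod_cast this)
    have hib := fun p => X.inBlock_of_mem_typeSet ht hb (hi1 p)
    set v : ℕ → Fin (m * n) → ℝ := fun s => X.flatSpin c s ω₀ with hv
    have hf1 := X.le_resid_flatSpin hn (by positivity) h0'
    have hf2 : nrm (resid v r) ≤ Real.sqrt n := by
      have := nrm_sub_pastProj_le v r (v r)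
      rwa [hv, X.nrm_flatSpin hc.sign] at this
    have hf3 : resid v r ⬝ᵥ resid v r ≤ n := by
      rw [← nrm_sq]
      have := pow_le_pow_left₀ (nrm_nonneg _) hf2 2
      rwa [Real.sq_sqrt (Nat.cast_nonneg n)] at this
    have hn' : (0 : ℝ) < n := by exact_mod_cast hn
    have hm' : (1 : ℝ) ≤ m := by exact_mod_cast hm
    refine le_trans (measure_mono ?_) (X.measure_fiber_few_le hc ht hb hr ω₀ hq hi hib
      (fun p s hs => X.flatSpin_eq_of_mem_typeSet ht hb (hi1 p) (hi2 p) (by omega)) hK hκ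
      (L := L) (σ := signOf S t) ?_ ?_)
    · rintro ω ⟨h1, ⟨_, _, h2⟩, h3⟩
      refine ⟨h1, h2, lt_of_le_of_lt ?_ h3⟩
      refine Nat.cast_le.2 (Finset.card_le_card_of_injOn i ?_ ?_)
      · intro p hp
        have hp := (Finset.mem_filter.1 hp).2
        refine mem_typeSet.2 fun s hs => ?_
        rcases Nat.lt_succ_iff_lt_or_eq.1 hs with hs | rfl
        · have hsr : s * m + b ≤ r := by
            have := Nat.mul_le_mul_right m (Nat.succ_le_of_lt hs)
            rw [Nat.succ_mul] at this
            omega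
          simp only [h1 _ hsr]
          exact mem_typeSet.1 (hi1 p) s hs
        · rw [← hr]; exact hp
      · intro p _ p' _ h
        have := hi (a₁ := Sum.inl p) (a₂ := Sum.inl p') h
        simpa using this
    · intro o ho
      refine hκA _ (signOf_eq S t) o ho _ ?_ ?_
      -- The lower variance bound: |f|² ≥ ε n and N = m n give |f|² / (2 N) ≥ ε / (2 m).
      · refine le_trans ?_ (Real.le_coe_toNNReal _)
        rw [div_le_div_iff₀ (by positivity) (by positivity)]
        push_cast
        nlinarith
      · rw [Real.toNNReal_le_one, div_le_one (by positivity)]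
        push_cast
        nlinarith
    · have e1 : nrm (∑ a ∈ Finset.range m, X.flatSpin c (r + 1 - m + a) ω₀) ≤ m * Real.sqrt n := by
        have := Finset.le_sum_of_subadditive (nrm (ι := Fin (m * n))) (by simp [nrm]) nrm_add_le
          (Finset.range m) fun a => X.flatSpin c (r + 1 - m + a) ω₀
        refine this.trans (le_of_eq ?_)
        rw [Finset.sum_congr rfl fun a _ => X.nrm_flatSpin hc.sign _ ω₀]
        simp
      have e2 : nrm (∑ a ∈ Finset.range m, X.flatSpin c (r + 1 - m + a) ω₀ - resid v r)
          ≤ (m + 1) * Real.sqrt n := by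
        have h1 := nrm_add_le (∑ a ∈ Finset.range m, X.flatSpin c (r + 1 - m + a) ω₀)
          ((-1 : ℝ) • resid v r)
        rw [nrm_smul, neg_one_smul, ← sub_eq_add_neg] at h1
        simp only [abs_neg, abs_one, one_mul] at h1
        linarith
      have e3 := pow_le_pow_left₀ (mul_nonneg hL (nrm_nonneg _)) (mul_le_mul_of_nonneg_left e2 hL) 2
      have e4 := pow_le_pow_left₀ (mul_nonneg hL (nrm_nonneg _))
        (mul_le_mul_of_nonneg_left hf2 hL) 2
      refine (add_le_add (mul_le_mul_of_nonneg_left e3 zero_le_two) e4).trans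
        (le_trans (le_of_eq ?_) hKq)
      rw [mul_pow, mul_pow, mul_pow, Real.sq_sqrt hn'.le]
      ring
  calc P {ω | ¬ Rich m (fun s => X.flatSpin c s ω) (t + 1) b (κ * q / 4)}
      ≤ P (({ω | ¬ Rich m (fun s => X.flatSpin c s ω) t b (2 * q)}
        ∪ {ω | ¬ Rich m (fun s => X.flatSpin c s ω) (t' + 1) b' (ε * n)}
        ∪ {ω | ¬ OpBound (Matrix.of (X.J ω)) (fun s => X.flatSpin c s ω) L (t * m + b)})
        ∪ ⋃ S ∈ (Finset.range (t + 1)).powerset, G ∩ {ω | ((typeSet m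
          (fun s => X.flatSpin c s ω) (t + 1) b (signOf S)).card : ℝ) < κ * q / 4}) := by
        refine measure_mono fun ω hω => ?_
        by_cases h1 : ω ∈ G
        · right
          simp only [Set.mem_ofPred_eq, Rich] at hω
          push Not at hω
          obtain ⟨S, hS, h⟩ := hω
          exact Set.mem_biUnion hS ⟨h1, h⟩
        · left
          rw [hG, hr] at h1
          simp only [Set.mem_ofPred_eq, Set.mem_union] at h1 ⊢
          tauto
    _ ≤ _ := by
        refine (measure_union_le _ _).trans (add_le_add ((measure_union_le _ _).trans
          (add_le_add_left (measure_union_le _ _) _)) ?_)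
        refine (measure_biUnion_finset_le _ _).trans ((Finset.sum_le_sum fun S _ =>
          main S).trans (le_of_eq ?_))
        simp

end Input

end RichStep

/-! ### Sign patterns of the initial configuration -/

section InitialPatterns

variable {m n : ℕ} {Ω : Type*} [MeasurableSpace Ω] {P : Measure Ω}

namespace Input

variable (X : Input m n P) {c : unitInterval → ℝ → ℝ}

theorem init_mul_self (ω : Ω) (i : Fin (m * n)) : X.init ω i * X.init ω i = 1 := by
  rcases X.sign_init ω i with h | h <;> simp [h]

theorem abs_init (ω : Ω) (i : Fin (m * n)) : |X.init ω i| = 1 := by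
  rcases X.sign_init ω i with h | h <;> simp [h]

variable [IsProbabilityMeasure P]

theorem integrable_init_mul_init (i j : Fin (m * n)) :
    Integrable (fun ω => X.init ω i * X.init ω j) P := by
  have := X.measurable_init
  refine Integrable.of_bound (C := 1) (by fun_prop) (Eventually.of_forall fun ω => ?_)
  rw [Real.norm_eq_abs, abs_mul, X.abs_init, X.abs_init, one_mul]

/-- Flipping the sign at site i is an involution of the sign vectors that preserves their weight and
reverses the product. -/
theorem integral_init_mul_init {i j : Fin (m * n)} (hij : i ≠ j) :
    ∫ ω, X.init ω i * X.init ω j ∂P = 0 := by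
  classical
  set T : Finset (Fin (m * n) → ℝ) := Fintype.piFinset fun _ => {1, -1} with hT
  have hmem : ∀ s, s ∈ T ↔ ∀ i, s i = 1 ∨ s i = -1 := fun s => by
    simp [hT, Fintype.mem_piFinset]
  have h1 : ∀ ω, X.init ω i * X.init ω j
      = ∑ s ∈ T, {ω | X.init ω = s}.indicator (fun _ => s i * s j) ω := by
    intro ω
    rw [Finset.sum_eq_single (X.init ω)]
    · simp
    · intro s _ hs
      exact Set.indicator_of_notMem (s := {ω | X.init ω = s}) (fun h => hs (Eq.symm h)) _
    · intro h
      exact absurd ((hmem _).2 (X.sign_init ω)) h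
  have hms : ∀ s : Fin (m * n) → ℝ, MeasurableSet {ω | X.init ω = s} := fun s =>
    X.measurable_init (measurableSet_singleton s)
  simp only [h1]
  rw [integral_finsetSum _ fun s _ => (integrable_const _).indicator (hms s)]
  refine Finset.sum_involution (fun s _ => Function.update s i (-s i)) ?_ ?_ ?_ ?_
  · intro s hs
    have hs' : Function.update s i (-s i) ∈ T := by
      rw [hmem] at hs ⊢
      intro l
      rcases eq_or_ne l i with rfl | h
      · rw [Function.update_self]
        rcases hs l with h | h <;> simp [h]
      · rw [Function.update_of_ne h]
        exact hs l
    rw [integral_indicator_const _ (hms _), integral_indicator_const _ (hms _), Measure.real,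
      Measure.real, X.unif_init _ ((hmem s).1 hs), X.unif_init _ ((hmem _).1 hs'),
      Function.update_self, Function.update_of_ne hij.symm]
    simp only [smul_eq_mul]
    ring
  · intro s hs _ h
    have := congrFun h i
    rw [Function.update_self] at this
    rcases (hmem s).1 hs i with h | h <;> rw [h] at this <;> norm_num at this
  · intro s hs
    rw [hmem] at hs ⊢
    intro l
    rcases eq_or_ne l i with rfl | h
    · rw [Function.update_self]
      rcases hs l with h | h <;> simp [h]
    · rw [Function.update_of_ne h]
      exact hs l
  · intro s _
    simp

theorem integral_sq_sum_init (B : Finset (Fin (m * n))) :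
    ∫ ω, (∑ i ∈ B, X.init ω i) ^ 2 ∂P = B.card := by
  classical
  have h1 : ∀ ω, (∑ i ∈ B, X.init ω i) ^ 2 = ∑ i ∈ B, ∑ j ∈ B, X.init ω i * X.init ω j := by
    intro ω
    rw [pow_two, Finset.sum_mul_sum]
  simp only [h1]
  rw [integral_finsetSum _ fun i _ => integrable_finsetSum _ fun j _ =>
    X.integrable_init_mul_init i j]
  rw [Finset.card_eq_sum_ones, Nat.cast_sum]
  refine Finset.sum_congr rfl fun i hi => ?_
  rw [integral_finsetSum _ fun j _ => X.integrable_init_mul_init i j,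
    Finset.sum_eq_single i (fun j _ hj => X.integral_init_mul_init hj.symm)
      fun h => absurd hi h]
  simp [X.init_mul_self]

variable [NeZero m]

/-- The number of sites of the block with sign σ is (n + σ Σ) / 2 for the block sum Σ. Fewer than n
/ 4 of them forces |Σ| ≥ n / 2, and Σ has second moment n. -/
theorem measure_not_rich_one_le {b : ℕ} (hb : b < m) (hn : 0 < n) :
    P {ω | ¬ Rich m (fun s => X.flatSpin c s ω) 1 b (1 / 4 * n)} ≤ ENNReal.ofReal (4 / n) := by
  classical
  have hn' : (0 : ℝ) < n := by exact_mod_cast hn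
  have hJ := X.measurable_init
  set B := Finset.univ.filter fun i : Fin (m * n) => InBlock b i with hB
  have hBc : B.card = n := card_block hb
  have hZm : Measurable fun ω => (∑ i ∈ B, X.init ω i) ^ 2 := by fun_prop
  have hZi : Integrable (fun ω => (∑ i ∈ B, X.init ω i) ^ 2) P := by
    simp only [pow_two, Finset.sum_mul_sum]
    exact integrable_finsetSum _ fun i _ => integrable_finsetSum _ fun j _ =>
      X.integrable_init_mul_init i j
  have hcount : ∀ ω, ∀ σ : ℝ, σ = 1 ∨ σ = -1 →
      ∑ i ∈ B, (1 + σ * X.init ω i) / 2 = ((B.filter fun i => X.init ω i = σ).card : ℝ) := by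
    intro ω σ hσ
    rw [Finset.card_filter, Nat.cast_sum]
    refine Finset.sum_congr rfl fun i _ => ?_
    rcases hσ with rfl | rfl <;> rcases X.sign_init ω i with h | h <;> rw [h] <;> norm_num
  calc _ ≤ P {ω | (n : ℝ) ^ 2 / 4 ≤ (∑ i ∈ B, X.init ω i) ^ 2} := by
        refine measure_mono fun ω hω => ?_
        simp only [Set.mem_ofPred_eq, Rich] at hω ⊢
        push Not at hω
        obtain ⟨S, _, h⟩ := hω
        have h1 := hcount ω _ (signOf_eq S 0)
        have h2 : (B.filter fun i => X.init ω i = signOf S 0)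
            ⊆ typeSet m (fun s => X.flatSpin c s ω) 1 b (signOf S) := by
          intro i hi
          obtain ⟨hi1, hi2⟩ := Finset.mem_filter.1 hi
          refine mem_typeSet.2 fun s hs => ?_
          obtain rfl : s = 0 := by omega
          rw [flatSpin_apply, zero_mul, zero_add, Nat.mod_eq_of_lt hb, Nat.div_eq_of_lt hb,
            if_pos (Finset.mem_filter.1 hi1).2]
          exact hi2
        have h3 : ((B.filter fun i => X.init ω i = signOf S 0).card : ℝ) < 1 / 4 * n :=
          lt_of_le_of_lt (by exact_mod_cast Finset.card_le_card h2) h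
        rw [← h1, ← Finset.sum_div, Finset.sum_add_distrib, ← Finset.mul_sum] at h3
        simp only [Finset.sum_const, hBc, nsmul_eq_mul, mul_one] at h3
        rcases signOf_eq S 0 with h4 | h4 <;> rw [h4] at h3 <;> nlinarith
    _ ≤ (∫⁻ ω, ENNReal.ofReal ((∑ i ∈ B, X.init ω i) ^ 2) ∂P)
        / ENNReal.ofReal ((n : ℝ) ^ 2 / 4) := measure_sq_ge_le hZm (by positivity)
    _ = ENNReal.ofReal (4 / n) := by
        rw [← ofReal_integral_eq_lintegral_ofReal hZi
          (Eventually.of_forall fun ω => sq_nonneg _), X.integral_sq_sum_init, hBc,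
          ← ENNReal.ofReal_div_of_pos (by positivity)]
        congr 1
        field_simp

end Input

end InitialPatterns

/-! ### Richness of the patterns in the limit -/

section EventuallyRich

variable {m : ℕ} [NeZero m] {c : unitInterval → ℝ → ℝ}
  {Ω : ℕ → Type*} [∀ n, MeasurableSpace (Ω n)] {P : ∀ n, Measure (Ω n)}

/-- With high probability each sign pattern of the first `t` configurations of block `b` occurs
at a positive fraction of the sites. -/
def EventuallyRich (c : unitInterval → ℝ → ℝ) (X : ∀ n, Input m n (P n)) (t b : ℕ) : Prop :=
  ∀ η : ℝ, 0 < η → ∃ ε : ℝ, 0 < ε ∧ ∀ᶠ n : ℕ in atTop,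
    P n {ω | ¬ Rich m (fun s => (X n).flatSpin c s ω) t b (ε * n)} ≤ ENNReal.ofReal η

variable [∀ n, IsProbabilityMeasure (P n)]

theorem eventuallyRich_one (X : ∀ n, Input m n (P n)) {b : ℕ} (hb : b < m) :
    EventuallyRich c X 1 b := by
  intro η hη
  refine ⟨1 / 4, by norm_num, ?_⟩
  filter_upwards [eventually_gt_atTop 0, eventually_ge_atTop ⌈4 / η⌉₊] with n hn hn'
  refine ((X n).measure_not_rich_one_le hb hn).trans (ENNReal.ofReal_le_ofReal ?_)
  have h1 : (0 : ℝ) < n := by exact_mod_cast hn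
  rw [div_le_iff₀ h1]
  have h2 : 4 / η ≤ n := Nat.ceil_le.1 hn'
  rw [div_le_iff₀ hη] at h2
  linarith

theorem exists_lower_bound (hc : IsUpdateRule c) (K : ℝ) {β : ℝ} (hβ : 0 < β) :
    ∃ κ : ℝ, 0 < κ ∧ ∀ σ : ℝ, σ = 1 ∨ σ = -1 → ∀ o : ℝ, |o| ≤ K → ∀ v : NNReal, β ≤ v → v ≤ 1 →
      ENNReal.ofReal κ ≤ ((volume : Measure unitInterval).prod
        (gaussianReal o v)) {p | c p.1 p.2 = σ} := by
  have hm : ∀ σ : ℝ, MeasurableSet {p : unitInterval × ℝ | c p.1 p.2 = σ} := fun σ =>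
    measurableSet_eq_fun hc.measurable measurable_const
  have hneg : 0 < ((volume : Measure unitInterval).prod (gaussianReal 0 1))
      {p | c p.1 p.2 = -1} := by
    have h1 : {p : unitInterval × ℝ | c p.1 p.2 = -1} = {p | c p.1 p.2 = 1}ᶜ := by
      ext p
      simp only [Set.mem_ofPred_eq, Set.mem_compl_iff]
      rcases hc.sign p.1 p.2 with h | h <;> rw [h] <;> norm_num
    rw [h1, prob_compl_eq_one_sub (hm 1)]
    exact tsub_pos_of_lt hc.lt_one
  obtain ⟨κ₁, h1, h1'⟩ := exists_gaussian_lower (hm 1) hc.pos K hβ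
  obtain ⟨κ₂, h2, h2'⟩ := exists_gaussian_lower (hm (-1)) hneg K hβ
  refine ⟨min κ₁ κ₂, lt_min h1 h2, ?_⟩
  rintro σ (rfl | rfl) o ho v hv hv'
  · exact (ENNReal.ofReal_le_ofReal (min_le_left _ _)).trans (h1' o ho v hv hv')
  · exact (ENNReal.ofReal_le_ofReal (min_le_right _ _)).trans (h2' o ho v hv hv')

/-- Constants are chosen in the order ε₁, ε₂ (richness so far), L (operator bound), K, κ; only then
is n taken large. Four bad events receive η / 4 each. -/
theorem EventuallyRich.succ (hc : IsUpdateRule c) {X : ∀ n, Input m n (P n)} {t b : ℕ}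
    (ht : 1 ≤ t) (hb : b < m) {t' : ℕ} {b' : Fin m} (hr : t' * m + b' + 1 = t * m + b)
    (h : EventuallyRich c X t b) (h' : EventuallyRich c X (t' + 1) b') :
    EventuallyRich c X (t + 1) b := by
  intro η hη
  have hm : 0 < m := Nat.pos_of_ne_zero (NeZero.ne m)
  obtain ⟨ε₁, hε₁, e1⟩ := h (η / 4) (by positivity)
  obtain ⟨ε₂, hε₂, e2⟩ := h' (η / 4) (by positivity)
  obtain ⟨L, hL, e3⟩ := Exploration.exists_opBound (t * m + b) (η := η / 4) (by positivity)
  -- Chosen so that the field bound holds once q ≥ ε₁ n / 4; the added 1 keeps K positive when L =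
  -- 0.
  set K := Real.sqrt (8 * (L ^ 2 * (2 * ((m : ℝ) + 1) ^ 2 + 1)) / ε₁ + 1) with hK
  have hK2 : K ^ 2 = 8 * (L ^ 2 * (2 * ((m : ℝ) + 1) ^ 2 + 1)) / ε₁ + 1 :=
    Real.sq_sqrt (by positivity)
  have hK0 : 0 < K := Real.sqrt_pos.2 (by positivity)
  obtain ⟨κ, hκ, hκA⟩ := exists_lower_bound hc K (β := ε₂ / (2 * m)) (by positivity)
  refine ⟨κ * ε₁ / 16, by positivity, ?_⟩
  -- The first threshold makes q = ⌊ε₁ n / 2⌋ at least ε₁ n / 4, the second makes the Chebyshev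
  -- error summed over all patterns at most η / 4.
  filter_upwards [e1, e2, eventually_gt_atTop 0, eventually_ge_atTop ⌈4 / ε₁⌉₊,
    eventually_ge_atTop ⌈2 ^ (t + 1) * 16 * 16 / (κ ^ 2 * ε₁ * η)⌉₊] with n hn1 hn2 hn hn3 hn4
  have hn' : (0 : ℝ) < n := by exact_mod_cast hn
  have hn3 : 4 / ε₁ ≤ n := Nat.ceil_le.1 hn3
  have hn4 : 2 ^ (t + 1) * 16 * 16 / (κ ^ 2 * ε₁ * η) ≤ n := Nat.ceil_le.1 hn4
  rw [div_le_iff₀ hε₁] at hn3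
  rw [div_le_iff₀ (by positivity)] at hn4
  set q := ⌊ε₁ * n / 2⌋₊ with hq
  have hq1 : 2 * (q : ℝ) ≤ ε₁ * n := by
    have := Nat.floor_le (a := ε₁ * n / 2) (by positivity)
    linarith
  have hq2 : ε₁ * n / 4 ≤ q := by
    have := Nat.lt_floor_add_one (ε₁ * n / 2)
    linarith
  have hq0 : 0 < q := by
    have : (0 : ℝ) < q := lt_of_lt_of_le (by positivity) hq2
    exact_mod_cast this
  have key := (X n).measure_not_rich_succ_le hc ht hb hr hq0 hn hε₂ hK0 hκ hL hκA (by
    have h1 : L ^ 2 * (2 * ((m : ℝ) + 1) ^ 2 + 1) ≤ K ^ 2 * ε₁ / 8 := by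
      rw [hK2]
      field_simp
      linarith
    have h2 := mul_le_mul_of_nonneg_right h1 hn'.le
    have h3 := mul_le_mul_of_nonneg_left hq2 (sq_nonneg K)
    linarith)
  have h4 : P n {ω | ¬ Rich m (fun s => (X n).flatSpin c s ω) (t + 1) b (κ * ε₁ / 16 * n)}
      ≤ P n {ω | ¬ Rich m (fun s => (X n).flatSpin c s ω) (t + 1) b (κ * q / 4)} := by
    refine measure_mono fun ω hω hω' => hω (hω'.mono ?_)
    have := mul_le_mul_of_nonneg_left hq2 hκ.le
    linarith
  have h5 : P n {ω | ¬ Rich m (fun s => (X n).flatSpin c s ω) t b (2 * q)}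
      ≤ ENNReal.ofReal (η / 4) := by
    refine le_trans (measure_mono ?_) hn1
    exact fun ω hω hω' => hω (Rich.mono hω' hq1)
  have h6 := e3 (Nat.mul_pos hm hn) ((X n).exploration hc.measurable hc.sign)
  have h7 : (2 : ENNReal) ^ (t + 1) * ENNReal.ofReal (16 / (κ ^ 2 * q))
      ≤ ENNReal.ofReal (η / 4) := by
    have : (2 : ENNReal) = ENNReal.ofReal 2 := by simp
    rw [this, ← ENNReal.ofReal_pow zero_le_two, ← ENNReal.ofReal_mul (by positivity)]
    refine ENNReal.ofReal_le_ofReal ?_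
    have hqp : (0 : ℝ) < q := by exact_mod_cast hq0
    rw [← mul_div_assoc, div_le_div_iff₀ (by positivity) (by norm_num)]
    have := mul_le_mul_of_nonneg_left hq2 (by positivity : 0 ≤ η * κ ^ 2)
    nlinarith
  refine h4.trans (key.trans ((add_le_add (add_le_add (add_le_add h5 hn2) h6) h7).trans ?_))
  rw [← ENNReal.ofReal_add (by positivity) (by positivity),
    ← ENNReal.ofReal_add (by positivity) (by positivity),
    ← ENNReal.ofReal_add (by positivity) (by positivity)]
  exact ENNReal.ofReal_le_ofReal (by linarith)

/-- All sign patterns of all blocks remain rich at all times. -/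
theorem eventuallyRich (hc : IsUpdateRule c) (X : ∀ n, Input m n (P n)) (t : ℕ) (b : Fin m) :
    EventuallyRich c X (t + 1) b := by
  have hm : 0 < m := Nat.pos_of_ne_zero (NeZero.ne m)
  induction hR : t * m + (b : ℕ) using Nat.strong_induction_on generalizing t b with
  | _ R ih =>
    subst hR
    rcases Nat.eq_zero_or_pos t with rfl | ht
    · exact eventuallyRich_one X b.2
    · have h1 : m ≤ t * m := Nat.le_mul_of_pos_left m ht
      have h2 := Nat.div_add_mod' (t * m + b - 1) m
      have h3 := Nat.mod_lt (t * m + b - 1) hm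
      obtain ⟨s, rfl⟩ : ∃ s, t = s + 1 := ⟨t - 1, by omega⟩
      -- Two instances with smaller flat index are used: the same block one pass earlier, and the
      -- block updated immediately before, possibly the last one of the preceding pass.
      refine EventuallyRich.succ hc ht b.2 (t' := ((s + 1) * m + b - 1) / m)
        (b' := ⟨((s + 1) * m + b - 1) % m, h3⟩) (by simp only; omega)
        (ih (s * m + b) (by rw [Nat.succ_mul]; omega) s b rfl)
        (ih _ ?_ _ _ rfl)
      simp only
      omega

end EventuallyRich

/-! ### The error coefficients vanish in the limit -/

/-- Z tends to zero in L², and |Y| ≤ C |Z| off an event of probability η. The constant C may depend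
on η, which suits bounds valid only under richness with level ε(η). -/
theorem TendstoZeroInProbability.of_le_mul {Ω : ℕ → Type*} [∀ n, MeasurableSpace (Ω n)]
    {P : ∀ n, Measure (Ω n)} {Y Z : ∀ n, Ω n → ℝ} (hZm : ∀ n, Measurable (Z n)) {D : ℕ → ℝ}
    (hD : Tendsto D atTop (𝓝 0))
    (hZ : ∀ᶠ n in atTop, ∫⁻ ω, ENNReal.ofReal (Z n ω ^ 2) ∂(P n) ≤ ENNReal.ofReal (D n))
    (h : ∀ η : ℝ, 0 < η → ∃ C : ℝ, 0 < C ∧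
      ∀ᶠ n in atTop, P n {ω | ¬ |Y n ω| ≤ C * |Z n ω|} ≤ ENNReal.ofReal η) :
    TendstoZeroInProbability P Y := by
  refine .of_le fun ε hε η hη => ?_
  obtain ⟨C, hC, h⟩ := h (η / 2) (by positivity)
  have hD' := hD.eventually (gt_mem_nhds (show 0 < η / 2 * (ε / C) ^ 2 by positivity))
  filter_upwards [h, hZ, hD'] with n h1 h2 h3
  calc P n {ω | ε ≤ |Y n ω|}
      ≤ P n ({ω | ¬ |Y n ω| ≤ C * |Z n ω|} ∪ {ω | (ε / C) ^ 2 ≤ Z n ω ^ 2}) := by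
        refine measure_mono fun ω hω => ?_
        by_contra hc
        simp only [Set.mem_union, Set.mem_ofPred_eq, not_or, not_le] at hc hω
        have h4 : |Z n ω| < ε / C := by
          have := abs_lt_of_sq_lt_sq hc.2 (by positivity)
          exact this
        rw [lt_div_iff₀ hC] at h4
        linarith [hc.1]
    _ ≤ ENNReal.ofReal (η / 2) + ENNReal.ofReal (η / 2) := by
        refine (measure_union_le _ _).trans (add_le_add h1 ?_)
        refine (measure_sq_ge_le ((hZm n).pow_const 2) (by positivity)).trans ?_
        refine (ENNReal.div_le_div_right h2 _).trans ?_
        rw [← ENNReal.ofReal_div_of_pos (by positivity)]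
        refine ENNReal.ofReal_le_ofReal ?_
        rw [div_le_iff₀ (by positivity)]
        exact h3.le
    _ = ENNReal.ofReal η := by
        rw [← ENNReal.ofReal_add (by positivity) (by positivity), add_halves]

section Coefficients

variable {ι κ : Type*} [Fintype ι] [Fintype κ]

theorem projCoef_dotProduct_transpose_mulVec (S : Matrix ι κ ℝ) (x : ι → ℝ) :
    (S *ᵥ projCoef S x) ⬝ᵥ (S *ᵥ projCoef S x) = (S *ᵥ projCoef S x) ⬝ᵥ x := by
  rw [mulVec_projCoef, ← dotProduct_spanProj, spanProj_mulVec_self, dotProduct_comm]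

/-- With α the regression coefficients, M |α|² ≤ |S α|² = ⟨S α, x⟩ = ⟨α, Sᵀ x⟩. The coefficients are
thus controlled by the correlations of x with the columns, not by |x|. -/
theorem abs_projCoef_le {S : Matrix ι κ ℝ} {M : ℝ}
    (hS : ∀ α : κ → ℝ, M * (α ⬝ᵥ α) ≤ (S *ᵥ α) ⬝ᵥ (S *ᵥ α)) (hM : 0 ≤ M) (x : ι → ℝ) (a : κ) :
    M * |projCoef S x a| ≤ nrm (Sᵀ *ᵥ x) := by
  set α := projCoef S x with hα
  have h1 : M * nrm α ^ 2 ≤ nrm α * nrm (Sᵀ *ᵥ x) := by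
    rw [nrm_sq]
    refine (hS α).trans ?_
    rw [hα, projCoef_dotProduct_transpose_mulVec, ← hα, ← Matrix.vecMul_transpose,
      ← Matrix.dotProduct_mulVec]
    exact (le_abs_self _).trans (abs_dotProduct_le _ _)
  have h2 : M * nrm α ≤ nrm (Sᵀ *ᵥ x) := by
    rcases (nrm_nonneg α).eq_or_lt with h0 | h0
    · rw [← h0, mul_zero]
      exact nrm_nonneg _
    · nlinarith
  exact (mul_le_mul_of_nonneg_left (abs_apply_le_nrm α a) hM).trans h2

theorem sq_projCoef_le {S : Matrix ι κ ℝ} {M : ℝ}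
    (hS : ∀ α : κ → ℝ, M * (α ⬝ᵥ α) ≤ (S *ᵥ α) ⬝ᵥ (S *ᵥ α)) (hM : 0 ≤ M) (x : ι → ℝ) (a : κ) :
    M * projCoef S x a ^ 2 ≤ x ⬝ᵥ x := by
  set α := projCoef S x with hα
  have h1 : nrm (S *ᵥ α) ^ 2 ≤ nrm (S *ᵥ α) * nrm x := by
    rw [nrm_sq, hα, projCoef_dotProduct_transpose_mulVec]
    exact (le_abs_self _).trans (abs_dotProduct_le _ _)
  have h2 : nrm (S *ᵥ α) ^ 2 ≤ nrm x ^ 2 := by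
    rcases (nrm_nonneg (S *ᵥ α)).eq_or_lt with h0 | h0
    · rw [← h0, zero_pow two_ne_zero]
      exact sq_nonneg _
    · nlinarith [nrm_nonneg x]
  rw [nrm_sq, nrm_sq] at h2
  refine le_trans ?_ ((hS α).trans h2)
  rw [← nrm_sq, ← sq_abs (α a)]
  exact mul_le_mul_of_nonneg_left
    (pow_le_pow_left₀ (abs_nonneg _) (abs_apply_le_nrm α a) 2) hM

end Coefficients

theorem measurable_nrm {Ω : Type*} [MeasurableSpace Ω] {N : ℕ} {x : Ω → Fin N → ℝ}
    (hx : Measurable x) : Measurable fun ω => nrm (x ω) := by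
  simp only [nrm_eq_sqrt]
  exact (measurable_dotProduct hx hx).sqrt

/-! ### Moment and coefficient bounds at fixed size -/

section Single

variable {m n : ℕ} {Ω : Type*} [MeasurableSpace Ω] {P : Measure Ω}

namespace Input

variable (X : Input m n P) {c : unitInterval → ℝ → ℝ}

/-- At time zero the spins are independent of J. Conditionally on them the pairing is a Gaussian
bilinear statistic, and the symmetric term of its variance vanishes because the two blocks are
disjoint. -/
theorem lintegral_sq_spinBlock_coupledSpin_zero [IsProbabilityMeasure P]
    (hc : IsUpdateRule c) {j k : Fin m} (hjk : k ≠ j) :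
    ∫⁻ ω, ENNReal.ofReal ((X.spinBlock c 0 k ω ⬝ᵥ X.coupledSpin c 0 j ω) ^ 2) ∂P
      = ENNReal.ofReal (n * n / (m * n : ℕ)) := by
  have hJ := X.measurable_J
  have hi := X.measurable_init
  have h := X.indep_init_J
  have : IsProbabilityMeasure (P.map X.J) := Measure.isProbabilityMeasure_map hJ.aemeasurable
  rw [indepFun_iff_map_prod_eq_prod_map_map hi.aemeasurable hJ.aemeasurable] at h
  set F : (Fin (m * n) → ℝ) × (Fin (m * n) → Fin (m * n) → ℝ) → ENNReal := fun z =>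
    ENNReal.ofReal (((blockProj m n k *ᵥ z.1) ⬝ᵥ
      (Matrix.of z.2 *ᵥ (blockProj m n j *ᵥ z.1))) ^ 2) with hF
  have hFm : Measurable F :=
    ((measurable_dotProduct (measurable_mulVec _ measurable_fst) (measurable_of_mulVec
      measurable_snd (measurable_mulVec _ measurable_fst))).pow_const 2).ennreal_ofReal
  have hFm' : ∀ s, Measurable fun z => F (s, z) := fun s => hFm.comp measurable_prodMk_left
  have h1 : ∫⁻ ω, ENNReal.ofReal ((X.spinBlock c 0 k ω ⬝ᵥ X.coupledSpin c 0 j ω) ^ 2) ∂P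
      = ∫⁻ z, F z ∂(P.map fun ω => (X.init ω, X.J ω)) :=
    (lintegral_map hFm (hi.prodMk hJ)).symm
  have hFl : Measurable fun s => ∫⁻ z, F (s, z) ∂(P.map X.J) := hFm.lintegral_prod_right'
  rw [h1, h, lintegral_prod _ hFm.aemeasurable, lintegral_map hFl hi]
  have h2 : ∀ ω, ∫⁻ z, F (X.init ω, z) ∂(P.map X.J) = ENNReal.ofReal (n * n / (m * n : ℕ)) := by
    intro ω
    rw [lintegral_map (hFm' _) hJ]
    simp only [hF]
    rw [← ofReal_integral_eq_lintegral_ofReal (X.goe_J.memLp _ _).integrable_sq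
      (Eventually.of_forall fun ω => sq_nonneg _)]
    congr 1
    have h3 := X.goe_J.integral_mul (X.spinBlock c 0 k ω) (X.spinBlock c 0 j ω)
      (X.spinBlock c 0 k ω) (X.spinBlock c 0 j ω)
    rw [spinBlock_dotProduct_self X c ω hc.sign, spinBlock_dotProduct_self X c ω hc.sign,
      spinBlock_dotProduct_of_ne X c ω hjk, zero_mul, add_zero] at h3
    simp only [pow_two]
    exact h3
  simp only [h2]
  simp

variable [NeZero m]

theorem le_spinHist_mulVec {p : ℕ} {k : Fin m} {M : ℝ} {ω : Ω}
    (h : Rich m (fun s => X.flatSpin c s ω) p k M) (α : Fin p → ℝ) :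
    M * (α ⬝ᵥ α) ≤ (X.spinHist c p k ω *ᵥ α) ⬝ᵥ (X.spinHist c p k ω *ᵥ α) := by
  have h1 := h.le_dotProduct_self (extendZero α)
  simp only [flatSpin_mul_add] at h1
  rw [X.spinHist_mulVec_extendZero c le_rfl] at h1
  convert h1 using 2
  rw [← Fin.sum_univ_eq_sum_range (fun s => extendZero α s ^ 2), dotProduct]
  refine Finset.sum_congr rfl fun a _ => ?_
  rw [extendZero, dif_pos a.2, pow_two]

theorem abs_extendZero_projCoef_le {p : ℕ} {k : Fin m} {M : ℝ} (hM : 0 ≤ M) {ω : Ω}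
    (h : Rich m (fun s => X.flatSpin c s ω) p k M) (x : Fin (m * n) → ℝ) (a : ℕ) :
    M * |extendZero (projCoef (X.spinHist c p k ω) x) a| ≤ nrm ((X.spinHist c p k ω)ᵀ *ᵥ x) := by
  unfold extendZero
  split_ifs with ha
  · exact abs_projCoef_le (X.le_spinHist_mulVec h) hM x _
  · rw [abs_zero, mul_zero]
    exact nrm_nonneg _

theorem sq_extendZero_psiHat_le (hs : ∀ u x, c u x = 1 ∨ c u x = -1) (hn : 0 < n) {t : ℕ}
    {j : Fin m} {ε : ℝ} (hε : 0 ≤ ε) {ω : Ω}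
    (h : Rich m (fun s => X.flatSpin c s ω) t j (ε * n)) (a : ℕ) :
    ε * extendZero (X.psiHat c t j ω) a ^ 2 ≤ 1 := by
  have hm : 0 < m := Nat.pos_of_ne_zero (NeZero.ne m)
  have hn' : (0 : ℝ) < n := by exact_mod_cast hn
  unfold extendZero
  split_ifs with ha
  · have h1 := sq_projCoef_le (X.le_spinHist_mulVec h) (by positivity)
      (X.spinBlock c t j ω) ⟨a, ha⟩
    rw [spinBlock_dotProduct_self X c ω hs, ← psiHat_eq X c ω hm hn] at h1
    nlinarith
  · simp

theorem bHat_le_one (hs : ∀ u x, c u x = 1 ∨ c u x = -1) (hn : 0 < n) (t : ℕ) (j : Fin m)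
    (ω : Ω) : X.bHat c t j ω ≤ 1 := by
  have hm : 0 < m := Nat.pos_of_ne_zero (NeZero.ne m)
  have h1 := nrm_sub_pastProj_le (fun s => X.flatSpin c s ω) (t * m + j)
    (X.flatSpin c (t * m + j) ω)
  have h2 := residNorm_flatSpin X c ω hs hm hn t j
  rw [residNorm_eq_nrm, resid] at h2
  rw [h2, X.nrm_flatSpin hs] at h1
  have : 0 < Real.sqrt n := Real.sqrt_pos.2 (by exact_mod_cast hn)
  nlinarith

theorem measurable_transpose_spinHist_mulVec [IsProbabilityMeasure P] (hc : IsUpdateRule c)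
    (p : ℕ) (k : Fin m) {x : Ω → Fin (m * n) → ℝ} (hx : Measurable x) :
    Measurable fun ω => (X.spinHist c p k ω)ᵀ *ᵥ x ω :=
  measurable_pi_lambda _ fun a =>
    measurable_dotProduct (X.measurable_spinBlock hc.measurable hc.sign a k) hx

theorem lintegral_sq_nrm_transpose_spinHist [IsProbabilityMeasure P] (hc : IsUpdateRule c)
    (p : ℕ) (k : Fin m) {x : Ω → Fin (m * n) → ℝ} (hx : Measurable x) {V : ℝ} (hV : 0 ≤ V)
    (h : ∀ a < p, ∫⁻ ω, ENNReal.ofReal ((X.spinBlock c a k ω ⬝ᵥ x ω) ^ 2) ∂P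
      ≤ ENNReal.ofReal V) :
    ∫⁻ ω, ENNReal.ofReal ((nrm ((X.spinHist c p k ω)ᵀ *ᵥ x ω) / n) ^ 2) ∂P
      ≤ ENNReal.ofReal (p * V / n ^ 2) := by
  have h1 : ∀ ω, ENNReal.ofReal ((nrm ((X.spinHist c p k ω)ᵀ *ᵥ x ω) / n) ^ 2)
      = (∑ a : Fin p, ENNReal.ofReal ((X.spinBlock c a k ω ⬝ᵥ x ω) ^ 2))
        * ENNReal.ofReal (1 / n ^ 2) := by
    intro ω
    rw [← ENNReal.ofReal_sum_of_nonneg fun _ _ => sq_nonneg _,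
      ← ENNReal.ofReal_mul (Finset.sum_nonneg fun _ _ => sq_nonneg _), div_pow, nrm_sq,
      mul_one_div]
    congr 2
    exact Finset.sum_congr rfl fun a _ => (pow_two _).symm
  have hm : ∀ a : Fin p, Measurable fun ω =>
      ENNReal.ofReal ((X.spinBlock c a k ω ⬝ᵥ x ω) ^ 2) := fun a =>
    ((measurable_dotProduct (X.measurable_spinBlock hc.measurable hc.sign a k) hx).pow_const
      2).ennreal_ofReal
  simp only [h1]
  rw [lintegral_mul_const _ (Finset.measurable_sum _ fun a _ => hm a),
    lintegral_finsetSum _ fun a _ => hm a]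
  refine (mul_le_mul_left (Finset.sum_le_sum fun (a : Fin p) _ => h a a.2) _).trans (le_of_eq ?_)
  rw [Finset.sum_const, Finset.card_univ, Fintype.card_fin, nsmul_eq_mul,
    ← ENNReal.ofReal_natCast p, ← ENNReal.ofReal_mul (Nat.cast_nonneg p),
    ← ENNReal.ofReal_mul (by positivity), mul_one_div]

/-- The configuration belongs to the history, hence is independent of the innovation, and its
squared norm is n. -/
theorem lintegral_sq_spinBlock_dotProduct_xi [IsProbabilityMeasure P] (hc : IsUpdateRule c)
    {t : ℕ} {j k : Fin m} {a : ℕ} (ha : a < thetaLen t j k) :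
    ∫⁻ ω, ENNReal.ofReal ((X.spinBlock c a k ω ⬝ᵥ
      (X.exploration hc.measurable hc.sign).xi (t * m + j) ω) ^ 2) ∂P = ENNReal.ofReal n := by
  have h := (X.exploration hc.measurable hc.sign).lintegral_sq_hist_dotProduct_xi (t * m + j)
    fun v => v (a * m + k)
  have h1 : ∀ ω, (X.exploration hc.measurable hc.sign).hist (t * m + j) ω (a * m + k)
      = X.spinBlock c a k ω := fun ω => by
    rw [Exploration.hist, if_pos (lt_thetaLen_iff.1 ha).le, ← X.flatSpin_mul_add]
    rfl
  simp only [h1] at h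
  rw [h]
  simp only [spinBlock_dotProduct_self X c _ hc.sign]
  simp

theorem lintegral_sq_residDir_dotProduct_xi_le [IsProbabilityMeasure P] (hc : IsUpdateRule c)
    (r : ℕ) :
    ∫⁻ ω, ENNReal.ofReal ((residDir (fun s => X.flatSpin c s ω) r ⬝ᵥ
      (X.exploration hc.measurable hc.sign).xi r ω) ^ 2) ∂P ≤ 1 := by
  obtain ⟨g, hg⟩ := (X.exploration hc.measurable hc.sign).exists_comp_hist (r := r)
    (f := fun ω => residDir (fun s => X.flatSpin c s ω) r) fun ω ω' h => X.residDir_eq_of_hist h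
  have h := (X.exploration hc.measurable hc.sign).lintegral_sq_hist_dotProduct_xi r g
  simp only [← hg] at h
  rw [h]
  refine (lintegral_mono (g := fun _ => 1) fun ω => ?_).trans (by simp)
  rw [← nrm_sq, ENNReal.ofReal_le_one]
  exact pow_le_one₀ (nrm_nonneg _) (nrm_residDir_le _ _)

end Input

end Single

/-! ### Error coefficients as the size tends to infinity -/

section Limit

variable {m : ℕ} [NeZero m] {c : unitInterval → ℝ → ℝ}
  {Ω : ℕ → Type*} [∀ n, MeasurableSpace (Ω n)] {P : ∀ n, Measure (Ω n)}
  [∀ n, IsProbabilityMeasure (P n)]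

/-- The coefficients in a regression on the past configurations of a block vanish, if the
correlations with these configurations are of smaller order than the block size. -/
theorem tendsto_extendZero_projCoef (hc : IsUpdateRule c) (X : ∀ n, Input m n (P n)) (p : ℕ)
    (k : Fin m) {x : ∀ n, Ω n → Fin (m * n) → ℝ} (hx : ∀ n, Measurable (x n))
    (h : ∀ n, 0 < n → ∀ a < p, ∫⁻ ω, ENNReal.ofReal (((X n).spinBlock c a k ω ⬝ᵥ x n ω) ^ 2) ∂(P n)
      ≤ ENNReal.ofReal n) (a : ℕ) :
    TendstoZeroInProbability P
      (fun n ω => extendZero (projCoef ((X n).spinHist c p k ω) (x n ω)) a) := by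
  rcases Nat.eq_zero_or_pos p with rfl | hp
  · simpa [extendZero] using TendstoZeroInProbability.zero (P := P)
  obtain ⟨p, rfl⟩ : ∃ q, p = q + 1 := ⟨p - 1, by omega⟩
  refine .of_le_mul (Z := fun n ω => nrm (((X n).spinHist c (p + 1) k ω)ᵀ *ᵥ x n ω) / n)
    (D := fun n => ((p + 1 : ℕ) : ℝ) / n) (fun n => (measurable_nrm
      ((X n).measurable_transpose_spinHist_mulVec hc _ k (hx n))).div_const _)
    (tendsto_const_div_atTop_nhds_zero_nat _) ?_ ?_
  · filter_upwards [eventually_gt_atTop 0] with n hn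
    have hn' : (n : ℝ) ≠ 0 := by positivity
    refine ((X n).lintegral_sq_nrm_transpose_spinHist hc _ k (hx n) (Nat.cast_nonneg n)
      (h n hn)).trans (le_of_eq ?_)
    congr 1
    field_simp
  · intro η hη
    obtain ⟨ε, hε, h1⟩ := eventuallyRich hc X p k η hη
    refine ⟨1 / ε, by positivity, ?_⟩
    filter_upwards [h1, eventually_gt_atTop 0] with n h1 hn
    have hn' : (0 : ℝ) < n := by exact_mod_cast hn
    refine le_trans (measure_mono ?_) h1
    intro ω hω hR
    refine hω ?_
    have := (X n).abs_extendZero_projCoef_le (by positivity) hR (x n ω) a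
    rw [abs_of_nonneg (div_nonneg (nrm_nonneg _) hn'.le), one_div_mul_eq_div, div_div,
      le_div_iff₀ (by positivity)]
    linarith

theorem delta_le_one : delta m ≤ 1 := by
  have : (1 : ℝ) ≤ m := by exact_mod_cast Nat.pos_of_ne_zero (NeZero.ne m)
  rw [delta, div_le_one (by linarith)]
  exact this

/-- The first summand is a regression of ξ with correlations of order √n against a Gram matrix of
order n. The second is ⟨e, ξ⟩ = O(1) divided by √N, times coefficients bounded by richness. The
third is present only at t = 0, where it is a regression of J σ^{0|j} on σ^{0|k}, again with
correlations of order √n. -/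
theorem tendsto_errCoef (hc : IsUpdateRule c) (X : ∀ n, Input m n (P n)) (t : ℕ) (j k : Fin m)
    (a : ℕ) :
    TendstoZeroInProbability P (fun n ω => (X n).errCoef c t j k
            (((X n).exploration hc.measurable hc.sign).xi (t * m + j) ω) ω a) := by
  have hm : 0 < m := Nat.pos_of_ne_zero (NeZero.ne m)
  set x : ∀ n, Ω n → Fin (m * n) → ℝ := fun n =>
    ((X n).exploration hc.measurable hc.sign).xi (t * m + j) with hx
  have hxm : ∀ n, Measurable (x n) := fun n => Exploration.measurable_xi _ _
  unfold Input.errCoef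
  refine (TendstoZeroInProbability.add ?_ ?_).add ?_
  · have h1 := tendsto_extendZero_projCoef hc X (thetaLen t j k) k hxm
      (fun n _ a ha => ((X n).lintegral_sq_spinBlock_dotProduct_xi hc ha).le) a
    refine .of_le fun ε hε η hη => ?_
    have h2 := (h1 ε hε).eventually (ge_mem_nhds (show 0 < ENNReal.ofReal η by simpa using hη))
    filter_upwards [h2, eventually_gt_atTop 0] with n h2 hn
    refine le_trans (measure_mono ?_) h2
    intro ω hω
    simp only [Set.mem_ofPred_eq] at hω ⊢
    refine hω.trans ?_
    rw [abs_neg, abs_mul]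
    refine mul_le_of_le_one_left (abs_nonneg _) ?_
    rw [abs_of_nonneg (mul_nonneg (show 0 ≤ (X n).bHat c t j ω from Real.sqrt_nonneg _)
      (Real.sqrt_nonneg _))]
    exact mul_le_one₀ ((X n).bHat_le_one hc.sign hn t j ω) (Real.sqrt_nonneg _)
      (Real.sqrt_le_one.2 delta_le_one)
  · by_cases hkj : k = j
    swap
    · simpa [hkj] using TendstoZeroInProbability.zero (P := P)
    simp only [if_pos hkj]
    refine .of_le_mul (Z := fun n ω =>
      (residDir (fun s => (X n).flatSpin c s ω) (t * m + j) ⬝ᵥ x n ω) / Real.sqrt n)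
      (D := fun n => 1 / (n : ℝ)) (fun n => ?_) (tendsto_const_div_atTop_nhds_zero_nat _) ?_ ?_
    · have : Measurable fun ω => residDir (fun s => (X n).flatSpin c s ω) (t * m + j) :=
        ((X n).exploration hc.measurable hc.sign).measurable_of_hist (r := t * m + j)
          fun ω ω' h => (X n).residDir_eq_of_hist h
      exact (measurable_dotProduct this (hxm n)).div_const _
    · filter_upwards [eventually_gt_atTop 0] with n hn
      have h1 := (X n).lintegral_sq_residDir_dotProduct_xi_le hc (t * m + j)
      have h2 : ∀ y : ℝ, ENNReal.ofReal ((y / Real.sqrt n) ^ 2)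
          = ENNReal.ofReal (1 / n) * ENNReal.ofReal (y ^ 2) := fun y => by
        rw [← ENNReal.ofReal_mul (by positivity), div_pow, Real.sq_sqrt (Nat.cast_nonneg n),
          one_div_mul_eq_div]
      simp only [h2]
      rw [lintegral_const_mul' _ _ ENNReal.ofReal_ne_top]
      exact mul_le_of_le_one_right' h1
    · intro η hη
      have h1 : ∃ ε : ℝ, 0 < ε ∧ ∀ᶠ n : ℕ in atTop, P n {ω | ¬ ε * extendZero
          ((X n).psiHat c t j ω) a ^ 2 ≤ 1} ≤ ENNReal.ofReal η := by
        rcases Nat.eq_zero_or_pos t with rfl | ht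
        · exact ⟨1, one_pos, Eventually.of_forall fun n => by simp [extendZero]⟩
        · obtain ⟨s, rfl⟩ : ∃ s, t = s + 1 := ⟨t - 1, by omega⟩
          obtain ⟨ε, hε, h1⟩ := eventuallyRich hc X s j η hη
          refine ⟨ε, hε, ?_⟩
          filter_upwards [h1, eventually_gt_atTop 0] with n h1 hn
          refine le_trans (measure_mono ?_) h1
          exact fun ω hω hR => hω ((X n).sq_extendZero_psiHat_le hc.sign hn hε.le hR a)
      obtain ⟨ε, hε, h1⟩ := h1
      refine ⟨1 + Real.sqrt (1 / ε), by positivity, ?_⟩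
      filter_upwards [h1, eventually_gt_atTop 0] with n h1 hn
      have hn' : (0 : ℝ) < Real.sqrt n := Real.sqrt_pos.2 (by exact_mod_cast hn)
      refine le_trans (measure_mono ?_) h1
      intro ω hω hψ
      refine hω ?_
      set ψ := extendZero ((X n).psiHat c t j ω) a
      have h3 : |ψ| ≤ Real.sqrt (1 / ε) := by
        refine Real.abs_le_sqrt ?_
        rw [le_div_iff₀ hε]
        linarith
      have h4 : |(if a = t then (1 : ℝ) else 0) - ψ| ≤ 1 + Real.sqrt (1 / ε) := by
        refine (abs_sub _ _).trans (add_le_add ?_ h3)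
        split_ifs <;> simp
      have h5 : |(Real.sqrt 2 - 1) / Real.sqrt (m * n : ℕ)| ≤ 1 / Real.sqrt n := by
        have h6 : 1 ≤ Real.sqrt 2 := Real.one_le_sqrt.2 (by norm_num)
        have h7 : Real.sqrt 2 ≤ 2 := Real.sqrt_le_iff.2 ⟨by norm_num, by norm_num⟩
        rw [abs_of_nonneg (div_nonneg (by linarith) (Real.sqrt_nonneg _))]
        refine div_le_div₀ zero_le_one (by linarith) hn' (Real.sqrt_le_sqrt ?_)
        exact_mod_cast Nat.le_mul_of_pos_left n hm
      rw [div_eq_mul_one_div (_ ⬝ᵥ _), abs_mul, abs_mul, abs_mul _ (1 / Real.sqrt n),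
        abs_of_pos (one_div_pos.2 hn'), mul_comm]
      refine mul_le_mul h4 ?_ (by positivity) (by positivity)
      rw [mul_comm]
      exact mul_le_mul_of_nonneg_left h5 (abs_nonneg _)
  · by_cases ht : t = 0
    swap
    · simpa [ht] using TendstoZeroInProbability.zero (P := P)
    subst ht
    simp only [if_pos]
    by_cases hkj : k < j
    -- At time zero with k ≥ j there is no earlier configuration of block k, so θ̂ is empty.
    swap
    · have : ∀ n ω, extendZero ((X n).thetaHat c 0 j k ω) a = 0 := fun n ω => by
        rw [extendZero, dif_neg]
        simp [thetaLen, hkj]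
      simpa [this] using TendstoZeroInProbability.zero (P := P)
    have h1 := tendsto_extendZero_projCoef hc X (thetaLen 0 j k) k
      (x := fun n => (X n).coupledSpin c 0 j)
      (fun n => measurable_of_mulVec (X n).measurable_J
        ((X n).measurable_spinBlock hc.measurable hc.sign 0 j))
      (fun n hn b hb => by
        obtain rfl : b = 0 := by
          rw [thetaLen, if_pos hkj] at hb
          omega
        rw [(X n).lintegral_sq_spinBlock_coupledSpin_zero hc hkj.ne]
        refine ENNReal.ofReal_le_ofReal ?_
        have hn' : (0 : ℝ) < n := by exact_mod_cast hn
        have hm' : (1 : ℝ) ≤ m := by exact_mod_cast hm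
        push_cast
        rw [div_le_iff₀ (by positivity)]
        nlinarith) a
    refine .of_le fun ε hε η hη => ?_
    have h2 := (h1 ε hε).eventually (ge_mem_nhds (show 0 < ENNReal.ofReal η by simpa using hη))
    filter_upwards [h2, eventually_gt_atTop 0] with n h2 hn
    -- The identification of θ̂ with regression coefficients uses symmetry of J, which holds only
    -- almost surely.
    refine le_trans (measure_mono_ae ?_) h2
    filter_upwards [(X n).goe_J.ae_symm] with ω hJ hω
    refine le_trans hω (le_of_eq ?_)
    have h3 := Input.delta_smul_thetaHat (X n) c ω hm hn hJ 0 j k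
    have h4 : resid (fun s => (X n).flatSpin c s ω) (0 * m + j) = (X n).spinBlock c 0 j ω := by
      rw [Input.resid_flatSpin (X n) c ω hm hn]
      simp [Matrix.mulVec_eq_sum]
    rw [h4] at h3
    congr 1
    have h5 : projCoef ((X n).spinHist c (thetaLen 0 j k) k ω) ((X n).coupledSpin c 0 j ω)
        = delta m • (X n).thetaHat c 0 j k ω := h3.symm
    rw [h5]
    unfold extendZero
    split_ifs
    · rfl
    · exact mul_zero _

end Limit

end BlockScan

end

/-! ### Assembly of the decomposition -/

theorem mainTheorem7 (m : ℕ) (hm : 0 < m)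
    (c : unitInterval → ℝ → ℝ) (hc : BlockScan.IsUpdateRule c)
    (Ω : ℕ → Type*) [∀ n, MeasurableSpace (Ω n)]
    (P : ∀ n, Measure (Ω n)) [∀ n, IsProbabilityMeasure (P n)]
    (X : ∀ n, BlockScan.Input m n (P n)) :
    ∃ (ξ : ∀ n : ℕ, ℕ → Fin m → Fin m → Ω n → Fin (m * n) → ℝ)
      (Δ : ∀ (n t : ℕ) (j k : Fin m), Ω n → Fin (BlockScan.errLen t j k) → ℝ),
      (∀ n : ℕ, 0 < n →
        -- the vectors are random variables, and `ξ^{t, j → k} ∼ N(0, D^k)`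
        (∀ t j k, Measurable (ξ n t j k) ∧ Measurable (Δ n t j k)) ∧
        (∀ t j k, BlockScan.IsCenteredGaussian (ξ n t j k) (BlockScan.blockProj m n k) (P n)) ∧
        -- (1) adaptedness
        (∀ t j k s l, (t < s ∨ (t = s ∧ j < l)) →
          Measurable[(X n).extFiltration c s l] (ξ n t j k)) ∧
        -- (2) independence across `t` and `j`
        (∀ k, iIndepFun (fun (p : ℕ × Fin m) => ξ n p.1 p.2 k) (P n)) ∧
        -- (3) initial time
        (∀ j k, ∀ᵐ ω ∂(P n),
          (X n).field c 0 j k ω = Real.sqrt (BlockScan.delta m) • ξ n 0 j k ω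
            + (X n).spinHist c (BlockScan.errLen 0 j k) k ω *ᵥ Δ n 0 j k ω) ∧
        -- (4) recursion
        (∀ t, 1 ≤ t → ∀ j k, ∀ᵐ ω ∂(P n),
          (X n).field c t j k ω =
            ((X n).bHat c t j ω * Real.sqrt (BlockScan.delta m)) • ξ n t j k ω
            + (X n).fieldHist c t j k ω *ᵥ (X n).psiHat c t j ω
            + BlockScan.delta m •
                ((X n).spinHist c (BlockScan.thetaLen t j k) k ω *ᵥ (X n).thetaHat c t j k ω)
            + (X n).spinHist c (BlockScan.errLen t j k) k ω *ᵥ Δ n t j k ω)) ∧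
      -- (5) the Frobenius norm of `(Δ^{0, j → k}, …, Δ^{t, j → k})` vanishes in probability
      (∀ t j k, BlockScan.TendstoZeroInProbability P (fun n ω =>
        Real.sqrt (∑ s ∈ Finset.range (t + 1), ∑ r, Δ n s j k ω r ^ 2))) := by
  have : NeZero m := ⟨hm.ne'⟩
  -- One formula for all times. The only difference at t = 0 is that the θ̂ term has moved into the
  -- error.
  have key : ∀ (n : ℕ), 0 < n → ∀ t j k, ∀ᵐ ω ∂(P n),
      (X n).field c t j k ω =
        ((X n).bHat c t j ω * Real.sqrt (BlockScan.delta m)) •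
          (BlockScan.blockProj m n k *ᵥ (X n).decodedInnov c (t * m + j) ω)
        + (X n).fieldHist c t j k ω *ᵥ (X n).psiHat c t j ω
        + (if t = 0 then 0 else BlockScan.delta m •
            ((X n).spinHist c (BlockScan.thetaLen t j k) k ω *ᵥ (X n).thetaHat c t j k ω))
        + (X n).spinHist c (BlockScan.errLen t j k) k ω *ᵥ (fun a => (X n).errCoef c t j k
            (((X n).exploration hc.measurable hc.sign).xi (t * m + j) ω) ω a) := by
    intro n hn t j k
    filter_upwards [(X n).ae_decodedInnov_eq hc.measurable hc.sign hn (t * m + j),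
      (X n).goe_J.ae_symm] with ω hω hJ
    rw [hω, BlockScan.Input.spinHist_mulVec_errCoef]
    refine ((X n).field_eq_innov c ω hc.sign hm hn hJ t j k
      (((X n).exploration hc.measurable hc.sign).w (t * m + j) ω)
      (x := ((X n).exploration hc.measurable hc.sign).xi (t * m + j) ω) rfl).trans ?_
    split_ifs <;> abel
  -- ξ is built from decoded innovations, because it must be adapted to the filtration. No
  -- adaptedness is asked of Δ, so it may use the true innovations, which agree almost surely.
  refine ⟨fun n t j k ω => BlockScan.blockProj m n k *ᵥ (X n).decodedInnov c (t * m + j) ω,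
    fun n t j k ω a => (X n).errCoef c t j k
      (((X n).exploration hc.measurable hc.sign).xi (t * m + j) ω) ω a,
    fun n hn => ⟨fun t j k => ⟨?_, ?_⟩, fun t j k => ?_, fun t j k s l h => ?_, fun k => ?_,
      fun j k => ?_, fun t ht j k => ?_⟩, fun t j k => ?_⟩
  · refine BlockScan.measurable_mulVec _ ?_
    exact (X n).measurable_decodedInnov hc.sign (X n).measurable_init
      (fun s _ => ((X n).exploration hc.measurable hc.sign).measurable_y s)
      (by have := (X n).measurable_W; fun_prop)
  · exact measurable_pi_lambda _ fun a => (X n).measurable_errCoef hc.measurable hc.sign t j k a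
      (((X n).exploration hc.measurable hc.sign).measurable_xi _)
  · exact ((X n).isCenteredGaussian_decodedInnov hc.measurable hc.sign hn _).blockProj k
  · exact @BlockScan.measurable_mulVec _ ((X n).extFiltration c s l) _ _ _ _ _
      ((X n).measurable_decodedInnov_extFiltration hc.sign h)
  · exact (X n).iIndepFun_decodedInnov hc.measurable hc.sign hn k
  · filter_upwards [key n hn 0 j k] with ω hω
    -- At time zero the regression on earlier times is empty.
    have h1 : (X n).bHat c 0 j ω = 1 := by simp [BlockScan.Input.bHat]
    have h2 : (X n).fieldHist c 0 j k ω *ᵥ (X n).psiHat c 0 j ω = 0 := by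
      funext i; simp [Matrix.mulVec]
    rw [h1, h2, if_pos rfl, one_mul, add_zero, add_zero] at hω
    exact hω
  · filter_upwards [key n hn t j k] with ω hω
    rwa [if_neg (by omega : ¬ t = 0)] at hω
  · exact BlockScan.TendstoZeroInProbability.sqrt_sum_sq fun s _ a =>
      BlockScan.tendsto_errCoef hc X s j k a
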